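/- **Notation.** $H,O\in\mathbb C^{d\times d}$ are Hermitian, $\rho=e^{-H}/\operatorname{Tr}e^{-H}$, $\|\cdot\|$ is the operator norm and $A(t)=e^{iHt}Ae^{-iHt}$. Let $H=\sum_jE_j|\psi_j\rangle\langle\psi_j|$, $A_\nu=\sum_{E_i-E_j=\nu}\langle\psi_i|A|\psi_j\rangle\,|\psi_i\rangle\langle\psi_j|$, $\mathcal S[A]=\sum_\nu\frac12\tanh(\frac\nu4)A_\nu$ and $\mathcal S^\pm[A]=\frac A2\pm\mathcal S[A]$. Put $a_k=(-1)^{k+1}\binom{1/2}{k}>0$, $\epsilon\in(0,\frac12]$, $m=\lfloor\log_2(1/\epsilon)\rfloor$, and $$K=\sqrt{\sqrt\rho\,(I-O)\sqrt\rho}\;\rho^{-1/2}.$$ For maps $S^\pm$ on matrices let $\nabla^{(1)}[M]=M$ and $\nabla^{(k)}[M]=\sum_{p=1}^{k-1}S^+[\nabla^{(p)}[M]]\,S^-[\nabla^{(k-p)}[M]]$ for $k\ge2$. **(1) Error bound.** Let $\widetilde{\mathcal S}^\pm$ be linear maps on $\mathbb C^{d\times d}$ and $s\ge\max(\|\mathcal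 S^\pm\|_{\infty\to\infty},\|\widetilde{\mathcal S}^\pm\|_{\infty\to\infty})$, where $\|\cdot\|_{\infty\to\infty}$ is the norm induced by the operator norm. If $\|O\|,\|\widetilde O\|\le\frac1{16s^2}$, $\|O-\widetilde O\|\le\frac{\epsilon}{16s^2}$ and $\|\mathcal S^\pm-\widetilde{\mathcal S}^\pm\|_{\infty\to\infty}\le\epsilon s$, then, with $\widetilde\nabla^{(k)}$ built from $\widetilde{\mathcal S}^\pm$, $$\Big\|I-\sum_{k=1}^m\widetilde{\mathcal S}^-[\widetilde\nabla^{(k)}[\widetilde O]]-K\Big\|\le\epsilon.$$ **(2) Integral representation.** Let $f_1^\pm$ be finite complex Borel measures on $\mathbb R$ (for instance an integrable function plus finitely many Dirac masses), written as densities, with $\|\cdot\|_1$ the total variation, and for $k\ge2$ let $$f_k^\pm(t_1,\dots,t_k)=\sum_{p=1}^{k-1}\int f_1^\pm(t)\,f_p^+(t_1-t,\dots,t_p-t)\,f_{k-p}^-(t_{p+1}-t,\dots,t_k-t)\,dt .$$ (a) If $\|f_1^\pm\|_1\le\frac12$, then $\|f_k^\pm\|_1\le a_k$ for all $k\ge1$.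 (b) If $f_1^\pm$ are supported in an interval $I=-I$, then $f_k^\pm$ is supported in $(kI)^k$. (c) If $s\ge1+\frac1\pi\ln(1+\frac{\|H\|}2)$, $\|\mathcal S^\pm-s\int f_1^\pm(t)\,e^{iHt}[\,\cdot\,]e^{-iHt}dt\|_{\infty\to\infty}\le\epsilon s$, $\|O\|,\|\widetilde O\|\le\frac1{16s^2}$ and $\|O-\widetilde O\|\le\frac\epsilon{16s^2}$, then $$\Big\|K-I+\frac1s\sum_{k=1}^m\int f_k^-(t_1,\dots,t_k)\,(s^2\widetilde O(t_1))\cdots(s^2\widetilde O(t_k))\,dt_1\cdots dt_k\Big\|\le\epsilon .$$ **(3) Short-time representation and linear combinations.** There is a universal constant $c>0$ such that the following and (4) hold. Suppose $\|O\|\le c/\ln^2(\|H\|+2)$. Let $$s=1+\tfrac2\pi\ln\Big(1+\tfrac{2\|H\|}{\epsilon\pi}\Big),\quad\tau=\tfrac{\ln(4/\epsilon)}{2\pi},\quad\Delta=\{t:|t|\le\tau,\ 2\|H\||t|\ge\epsilon\},\quad f_1^\pm(t)=\frac{\delta(t)}{2s}\mp\frac{i\,\mathbf 1_\Delta(t)}{s\sinh(2\pi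 t)} .$$ Then the kernels $f_k^\pm$ of (2) satisfy $\|f_k^\pm\|_1\le a_k$, are supported in $[-k\tau,k\tau]^k$, and $$\Big\|K-I+\frac1s\sum_{k=1}^m\int f_k^-(t_1,\dots,t_k)\,(s^2O(t_1))\cdots(s^2O(t_k))\,dt_1\cdots dt_k\Big\|\le\epsilon .$$ Moreover $K$ is within $\epsilon$ of a finite linear combination $\sum_jw_j\prod_{i=1}^{k_j}\big(s^2O(t_{j,i})\big)$ with $\sum_j|w_j|\le2$, $k_j\le m$ and $|t_{j,i}|\le k_j\tau$. **(4) Quasi-locality.** For all $G,J\in\mathbb R$, $D\in\mathbb N$ and $\xi,\alpha>0$ there are $C,\xi'>0$ such that the following holds. Let $\Lambda$ be a finite metric space each of whose closed balls of radius $r\ge0$ has at most $G(1+r)^D$ points (a $D$-dimensional lattice), with a copy of $\mathbb C^q$ at every site. Let $H=\sum_{Z\subseteq\Lambda}h_Z$ with Hermitian $h_Z$ supported on $Z$, $h_Z=0$ if $\operatorname{diam}Z>1$, and $\sum_{Z\ni x}|Z|\|h_Z\|\le J$ for every $x\in\Lambda$. Let $\emptyset\ne X\subseteq\Lambda$, $A\ge0$,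 and let $O$ be Hermitian with $\|O\|\le c/\ln^2(\|H\|+2)$ such that for every $r\ge0$ it is within $A\,e^{-(r/\xi)^\alpha}$ of an operator supported on $X^{+r}=\{y:\operatorname{dist}(y,X)\le r\}$. Then for every $r\ge0$ the operator $K$ is within $$C\,\big(1+A\ln^2(\|H\|+2)\big)\,|X|\;e^{-(r/\xi')^{\min(\alpha,1/3)}}$$ of an operator supported on $X^{+r}$. -/

import Mathlib

open scoped Matrix.Norms.L2Operator MatrixOrder ComplexOrder

universe u

namespace GibbsKraus

noncomputable section

section Operators

variable {n : Type u} [Fintype n] [DecidableEq n]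

/-- The Gibbs state `exp (-H) / Tr (exp (-H))`. -/
def gibbs (H : Matrix n n ℂ) : Matrix n n ℂ :=
  (Matrix.trace (NormedSpace.exp (-H)))⁻¹ • NormedSpace.exp (-H)

/-- The operator `√(√ρ (1 - O) √ρ) ρ^(-1/2)` for the Gibbs state `ρ` of `H`. -/
def krausOp (H O : Matrix n n ℂ) : Matrix n n ℂ :=
  CFC.sqrt (CFC.sqrt (gibbs H) * (1 - O) * CFC.sqrt (gibbs H)) * (CFC.sqrt (gibbs H))⁻¹

/-- The Heisenberg evolution `exp (i H t) A exp (-i H t)`. -/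
def heis (H : Matrix n n ℂ) (t : ℝ) (A : Matrix n n ℂ) : Matrix n n ℂ :=
  NormedSpace.exp ((Complex.I * (t : ℂ)) • H) * A * NormedSpace.exp (-((Complex.I * (t : ℂ)) • H))

/-- The Bohr frequencies: all differences of two eigenvalues of `H`. -/
def bohrSet {H : Matrix n n ℂ} (hH : H.IsHermitian) : Finset ℝ :=
  Finset.univ.image fun p : n × n => hH.eigenvalues p.1 - hH.eigenvalues p.2

/-- The part `A_ν = ∑_{E_i - E_j = ν} ⟨ψ_i| A |ψ_j⟩ |ψ_i⟩⟨ψ_j|` of `A`, where `ψ` is an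
eigenbasis of `H` with eigenvalues `E`; in the eigenbasis it keeps the entries `(i, j)` with
`E_i - E_j = ν`. -/
def bohrPart {H : Matrix n n ℂ} (hH : H.IsHermitian) (ν : ℝ) (A : Matrix n n ℂ) : Matrix n n ℂ :=
  (hH.eigenvectorUnitary : Matrix n n ℂ) *
    Matrix.of (fun i j => if hH.eigenvalues i - hH.eigenvalues j = ν then
      (star (hH.eigenvectorUnitary : Matrix n n ℂ) * A *
        (hH.eigenvectorUnitary : Matrix n n ℂ)) i j else 0) *
    star (hH.eigenvectorUnitary : Matrix n n ℂ)

/-- The superoperator `𝒮[A] = ∑_ν (1/2) tanh (ν/4) A_ν`. -/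
def opS {H : Matrix n n ℂ} (hH : H.IsHermitian) (A : Matrix n n ℂ) : Matrix n n ℂ :=
  ∑ ν ∈ bohrSet hH, (((1 / 2) * Real.tanh (ν / 4) : ℝ) : ℂ) • bohrPart hH ν A

/-- The sign `+1` for `true` and `-1` for `false`. -/
def sgn (b : Bool) : ℂ := if b then 1 else -1

/-- The superoperators `𝒮^± [A] = A / 2 ± 𝒮[A]`; `true` stands for `+` and `false` for `-`. -/
def opSpm {H : Matrix n n ℂ} (hH : H.IsHermitian) (b : Bool) (A : Matrix n n ℂ) : Matrix n n ℂ :=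
  (1 / 2 : ℂ) • A + sgn b • opS hH A

/-- `‖T‖_{∞→∞} ≤ c`, the norm induced by the operator norm on matrices. -/
def SuperopNormLE (T : Matrix n n ℂ → Matrix n n ℂ) (c : ℝ) : Prop :=
  ∀ A, ‖T A‖ ≤ c * ‖A‖

/-- The degree-`k` maps `∇^(k)`: `∇^(1)[M] = M` and
`∇^(k)[M] = ∑_{p=1}^{k-1} S^+[∇^(p)[M]] * S^-[∇^(k-p)[M]]` for `k ≥ 2`. -/
def nabla (Sp Sm : Matrix n n ℂ → Matrix n n ℂ) (M : Matrix n n ℂ) : ℕ → Matrix n n ℂ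
  | 0 => 0
  | 1 => M
  | (k + 2) => ∑ p : Fin (k + 1),
      Sp (nabla Sp Sm M (p + 1)) * Sm (nabla Sp Sm M (k + 1 - p))
termination_by k => k
decreasing_by all_goals omega

end Operators

/-- The coefficients `a_k = (-1)^(k+1) * binom(1/2, k)`. -/
def coeffA (k : ℕ) : ℝ := (-1) ^ (k + 1) * Ring.choose (1 / 2 : ℝ) k

section Kernels

open MeasureTheory

/-- The integral of a function with values in a complex Banach space with respect to a complex
measure. -/
def cintegral {X E : Type*} [MeasurableSpace X] [NormedAddCommGroup E] [NormedSpace ℂ E]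
    (F : ComplexMeasure X) (g : X → E) : E :=
  VectorMeasure.integral F g
    ((ContinuousLinearMap.lsmul ℝ ℂ : ℂ →L[ℝ] E →L[ℝ] E).flip)

/-- The superposition of simultaneous shifts
`(t₁, …, t_k) ↦ ∫ f(t) g(t₁ - t, …, t_p - t) h(t_{p+1} - t, …, t_k - t) dt`, `k = p + q`, as the
image of the product measure of `f`, `g`, `h` under `(t, u, v) ↦ (u + t, v + t)`. -/
def shiftConv {k p q : ℕ} (hk : k = p + q) (f : ComplexMeasure ℝ)
    (g : ComplexMeasure (Fin p → ℝ)) (h : ComplexMeasure (Fin q → ℝ)) :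
    ComplexMeasure (Fin k → ℝ) :=
  (f.prod (g.prod h (ContinuousLinearMap.mul ℝ ℂ)) (ContinuousLinearMap.mul ℝ ℂ)).map
    fun w i => Fin.append w.2.1 w.2.2 (Fin.cast hk i) + w.1

/-- The kernels `f_k^±` over `ℝ^k`, `k ≥ 1`, generated by `f_1^±`:
`f_k^±(t₁, …, t_k) = ∑_{p=1}^{k-1} ∫ f_1^±(t) f_p^+(t₁ - t, …, t_p - t)
f_{k-p}^-(t_{p+1} - t, …, t_k - t) dt`. Here `true` stands for `+` and `false` for `-`. -/
def kernel (f : Bool → ComplexMeasure ℝ) : (k : ℕ) → Bool → ComplexMeasure (Fin k → ℝ)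
  | 0, _ => 0
  | 1, b => (f b).map fun t _ => t
  | (k + 2), b => ∑ p : Fin (k + 1),
      shiftConv (p := p + 1) (q := k + 1 - p) (by omega) (f b)
        (kernel f (p + 1) true) (kernel f (k + 1 - p) false)
termination_by k => k
decreasing_by all_goals omega

/-- The total variation norm, which is the `L¹` norm of the density when there is one. -/
def l1norm {X : Type*} [MeasurableSpace X] (F : ComplexMeasure X) : ENNReal :=
  F.variation Set.univ

/-- The closed support. -/
def supp {X : Type*} [MeasurableSpace X] [TopologicalSpace X] (F : ComplexMeasure X) : Set X :=
  F.variation.support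

/-- The superoperator `A ↦ ∫ f(t) exp (i H t) A exp (-i H t) dt`. -/
def heisAverage {n : Type u} [Fintype n] [DecidableEq n] (H : Matrix n n ℂ)
    (f : ComplexMeasure ℝ) (A : Matrix n n ℂ) : Matrix n n ℂ :=
  cintegral f fun t => heis H t A

/-- `∫ F(t₁, …, t_k) A(t₁) ⋯ A(t_k) dt₁ ⋯ dt_k` with `A(t) = exp (i H t) A exp (-i H t)`. -/
def heisIntegral {n : Type u} [Fintype n] [DecidableEq n] (H : Matrix n n ℂ) {k : ℕ}
    (F : ComplexMeasure (Fin k → ℝ)) (A : Matrix n n ℂ) : Matrix n n ℂ :=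
  cintegral F fun t => (List.ofFn fun i => heis H (t i) A).prod

/-- The truncation order `⌊log₂ (1/ε)⌋`. -/
def order (ε : ℝ) : ℕ := ⌊Real.logb 2 (1 / ε)⌋₊

/-- The normalization `s = 1 + (2/π) ln (1 + 2 h / (ε π))`; here `h` is `‖H‖`. -/
def normS (h ε : ℝ) : ℝ := 1 + 2 / Real.pi * Real.log (1 + 2 * h / (ε * Real.pi))

/-- The time cut-off `ln (4/ε) / (2π)`. -/
def cutoff (ε : ℝ) : ℝ := Real.log (4 / ε) / (2 * Real.pi)

/-- `[-τ, τ] \ (-ε/(2h), ε/(2h))` with `τ = ln (4/ε) / (2π)`; it is empty for `h = 0`. -/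
def window (h ε : ℝ) : Set ℝ := {t | |t| ≤ cutoff ε ∧ ε ≤ 2 * h * |t|}

/-- The kernels `f_1^±(t) = δ(t) / (2s) ∓ i 1_Δ(t) / (s sinh (2πt))`, `Δ = window h ε`. -/
def seed (h ε : ℝ) (b : Bool) : ComplexMeasure ℝ :=
  VectorMeasure.dirac 0 (1 / (2 * (normS h ε : ℂ))) -
    sgn b • volume.withDensityᵥ ((window h ε).indicator fun t : ℝ =>
      Complex.I / ((normS h ε : ℂ) * (Real.sinh (2 * Real.pi * t) : ℂ)))

end Kernels

section Locality

variable {Λ : Type u} [Fintype Λ] [DecidableEq Λ] {q : ℕ}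

/-- An operator on `⨂_{x ∈ Λ} ℂ^q` is supported on `X ⊆ Λ` if it is `A ⊗ 1` with `A` acting on
the sites in `X`. -/
def SupportedOn (X : Set Λ) (M : Matrix (Λ → Fin q) (Λ → Fin q) ℂ) : Prop :=
  open scoped Classical in
  ∃ A : Matrix (X → Fin q) (X → Fin q) ℂ, ∀ σ τ : Λ → Fin q,
    M σ τ = if ∀ x, x ∉ X → σ x = τ x then A (fun x => σ x) (fun x => τ x) else 0

/-- `X^{+r}`, the sites at distance at most `r` from `X`. -/
def nbhd [MetricSpace Λ] (X : Finset Λ) (r : ℝ) : Set Λ := {y | ∃ x ∈ X, dist x y ≤ r}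

/-- `M` is quasi-local around `X` with error profile `g`: for every `r ≥ 0` it is within `g r` of
an operator supported on `X^{+r}`. -/
def QuasiLocal [MetricSpace Λ] (X : Finset Λ) (g : ℝ → ℝ)
    (M : Matrix (Λ → Fin q) (Λ → Fin q) ℂ) : Prop :=
  ∀ r : ℝ, 0 ≤ r → ∃ M' : Matrix (Λ → Fin q) (Λ → Fin q) ℂ,
    SupportedOn (nbhd X r) M' ∧ ‖M - M'‖ ≤ g r

/-- Every closed ball of radius `r` has at most `G (1 + r)^D` sites. -/
def PolyGrowth (Λ : Type u) [Fintype Λ] [DecidableEq Λ] [MetricSpace Λ] (G : ℝ) (D : ℕ) : Prop :=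
  ∀ (x : Λ) (r : ℝ), 0 ≤ r → ((Metric.closedBall x r).ncard : ℝ) ≤ G * (1 + r) ^ D

/-- A geometrically local interaction of strength at most `J`: Hermitian terms `h_Z` supported on
`Z`, with `h_Z = 0` if `diam Z > 1`, and `∑_{Z ∋ x} |Z| ‖h_Z‖ ≤ J` for every site `x`. -/
structure GeomLocal [MetricSpace Λ] (J : ℝ)
    (h : Finset Λ → Matrix (Λ → Fin q) (Λ → Fin q) ℂ) : Prop where
  herm : ∀ Z : Finset Λ, (h Z).IsHermitian
  supported : ∀ Z : Finset Λ, SupportedOn (Z : Set Λ) (h Z)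
  range : ∀ Z : Finset Λ, 1 < Metric.diam (Z : Set Λ) → h Z = 0
  strength : ∀ x : Λ, ∑ Z ∈ (Finset.univ : Finset (Finset Λ)).filter (fun Z => x ∈ Z),
    (Z.card : ℝ) * ‖h Z‖ ≤ J

end Locality

end

end GibbsKraus

/-!
Let `𝒮^±` be the Schur multipliers with symbol `1/2 ± tanh (ν/4) / 2` in the eigenbasis of `H`.
They satisfy `𝒮^+[A] + 𝒮^-[A] = A`, and since the two symbols have ratio `exp (ν/2)`, conjugation
by `exp (-H/2)` exchanges them: `√ρ 𝒮^+[A] = 𝒮^-[A] √ρ`. Hence, if `N` is a Hermitian solution of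
`N = O + 𝒮^+[N] 𝒮^-[N]`, then `(1 - 𝒮^+[N]) (1 - 𝒮^-[N]) = 1 - O`, and
`((1 - 𝒮^-[N]) √ρ)² = √ρ (1 - O) √ρ`. If `‖𝒮^-[N]‖ < 1`, the operator `(1 - 𝒮^-[N]) √ρ` is
positive, so it is the square root that defines `K`, and `K = 1 - 𝒮^-[N]` (`krausOp_eq_one_sub`).
Iterating the quadratic equation gives `N = ∑ ∇^(k)[O]`. Norms along this recursion obey quadratic
convolution inequalities, and partial sums of such sequences stay below every supersolution of a
scalar quadratic equation (`sum_range_le_of_convolution`); this controls the series, its truncation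
after `log₂ (1/ε)` terms, and perturbations of `O` and of `𝒮^±` alike
(`norm_truncation_sub_krausOp_le`).

The sine transform of `1 / sinh (2πt)` is `tanh (ν/4) / 4` (`integral_sin_div_sinh`, by expanding
both sides), so `𝒮` is a time average of the Heisenberg evolution with a kernel that decays
exponentially and has a simple pole at the origin. As `‖A(t) - A(-t)‖ ≤ 4 |t| ‖H‖ ‖A‖`, short times
contribute little: this bounds `𝒮^±` by a logarithm of `‖H‖` (`superopNormLE_opSpm`) and justifies
the cut-off kernels (`superopNormLE_opSpm_sub_heisAverage_seed`). When `𝒮^±` is replaced by a time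
average, Fubini's theorem turns `S^-[∇^(k)[O]]` into the integral of the products
`O(t₁) ⋯ O(t_k)` against the kernel `f_k^-` (`heisIntegral_kernel`). The recursion for the
variation norms of the kernels is the one that the coefficients of `1 - √(1 - x)` satisfy with
equality (`coeffA_add_two`). Approximating the integrals by finite sums gives linear combinations of
products of evolved copies of `O` (`exists_isCombination_near_krausOp`).

For quasi-locality, `O` is replaced by an operator `O'` on `X^{+r/2}` and the evolution by the one
that the interaction inside `X^{+r}` generates, so that the linear combination is supported on
`X^{+r}`. The change of the evolution is estimated by Duhamel's formula and a Lieb-Robinson bound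
(`GeomLocal.norm_commutator_le`): the commutators `[B(t), h_Z]` are compared with
`‖h_Z‖ ∑_{x ∈ Z} exp (-dist (x, X)) exp (κt)`, which is propagated by the terms overlapping with `Z`.
With `ε = exp (-L)` the combination has `O(L)` factors, each of norm at most `L²`, and times up to
`O(L²)`, so that the error is of order `exp (O(L³) - r/4)`. Hence `L` may be taken of the order of
`r^(1/3)`, or of `r^α` if the tails of `O` decay more slowly.
-/

namespace GibbsKraus

noncomputable section

/-! ### Schur multipliers in the eigenbasis of the Hamiltonian -/

section SchurMultipliers

variable {n : Type u} [Fintype n] [DecidableEq n] {H : Matrix n n ℂ} (hH : H.IsHermitian)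

/-- The spectral function `g(H)`, for a function `g` on the real line. -/
def diagOp (g : ℝ → ℂ) : Matrix n n ℂ :=
  (hH.eigenvectorUnitary : Matrix n n ℂ) * Matrix.diagonal (fun i => g (hH.eigenvalues i)) *
    star (hH.eigenvectorUnitary : Matrix n n ℂ)

/-- The Schur multiplier with symbol `m`: in the eigenbasis of `H` the entry `(i, j)` is
multiplied by `m (E_i - E_j)`. -/
def mult (m : ℝ → ℂ) (A : Matrix n n ℂ) : Matrix n n ℂ :=
  (hH.eigenvectorUnitary : Matrix n n ℂ) *
    Matrix.of (fun i j => m (hH.eigenvalues i - hH.eigenvalues j) *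
      (star (hH.eigenvectorUnitary : Matrix n n ℂ) * A *
        (hH.eigenvectorUnitary : Matrix n n ℂ)) i j) *
    star (hH.eigenvectorUnitary : Matrix n n ℂ)

lemma star_mul_eigenvectorUnitary :
    star (hH.eigenvectorUnitary : Matrix n n ℂ) * (hH.eigenvectorUnitary : Matrix n n ℂ) = 1 :=
  Unitary.coe_star_mul_self _

lemma eigenvectorUnitary_mul_star :
    (hH.eigenvectorUnitary : Matrix n n ℂ) * star (hH.eigenvectorUnitary : Matrix n n ℂ) = 1 :=
  Unitary.coe_mul_star_self _

lemma conj_eigenvectorUnitary_conj (A : Matrix n n ℂ) :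
    (hH.eigenvectorUnitary : Matrix n n ℂ) * (star (hH.eigenvectorUnitary : Matrix n n ℂ) * A *
      (hH.eigenvectorUnitary : Matrix n n ℂ)) * star (hH.eigenvectorUnitary : Matrix n n ℂ)
      = A := by
  calc _ = ((hH.eigenvectorUnitary : Matrix n n ℂ) * star (hH.eigenvectorUnitary : Matrix n n ℂ))
        * A * ((hH.eigenvectorUnitary : Matrix n n ℂ) *
          star (hH.eigenvectorUnitary : Matrix n n ℂ)) := by noncomm_ring
    _ = A := by rw [eigenvectorUnitary_mul_star]; simp

lemma diagOp_mul (g₁ g₂ : ℝ → ℂ) :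
    diagOp hH g₁ * diagOp hH g₂ = diagOp hH (fun x => g₁ x * g₂ x) := by
  unfold diagOp
  rw [← Matrix.diagonal_mul_diagonal]
  calc _ = (hH.eigenvectorUnitary : Matrix n n ℂ) *
        Matrix.diagonal (fun i => g₁ (hH.eigenvalues i)) *
        (star (hH.eigenvectorUnitary : Matrix n n ℂ) * (hH.eigenvectorUnitary : Matrix n n ℂ)) *
        Matrix.diagonal (fun i => g₂ (hH.eigenvalues i)) *
        star (hH.eigenvectorUnitary : Matrix n n ℂ) := by noncomm_ring
    _ = _ := by rw [star_mul_eigenvectorUnitary]; noncomm_ring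

lemma diagOp_one : diagOp hH (fun _ => 1) = 1 := by
  simp [diagOp]

lemma star_diagOp (g : ℝ → ℂ) : star (diagOp hH g) = diagOp hH (fun x => star (g x)) := by
  simp only [diagOp, star_mul, Matrix.star_eq_conjTranspose,
    Matrix.diagonal_conjTranspose, Matrix.conjTranspose_conjTranspose]
  rw [mul_assoc]; rfl

lemma smul_diagOp (c : ℂ) (g : ℝ → ℂ) : c • diagOp hH g = diagOp hH (fun x => c * g x) := by
  have : Matrix.diagonal (fun i => c * g (hH.eigenvalues i))
      = c • Matrix.diagonal (fun i => g (hH.eigenvalues i)) := by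
    rw [← Matrix.diagonal_smul]; rfl
  simp only [diagOp, this, Matrix.mul_smul, Matrix.smul_mul]

lemma diagOp_id : diagOp hH (fun x => (x : ℂ)) = H := by
  conv_rhs => rw [hH.spectral_theorem, Unitary.conjStarAlgAut_apply]
  rfl

lemma trace_diagOp (g : ℝ → ℂ) : Matrix.trace (diagOp hH g) = ∑ i, g (hH.eigenvalues i) := by
  rw [diagOp, Matrix.trace_mul_comm, ← mul_assoc, star_mul_eigenvectorUnitary, one_mul,
    Matrix.trace_diagonal]

lemma exp_smul_eq_diagOp (c : ℂ) :
    NormedSpace.exp (c • H) = diagOp hH (fun x => Complex.exp (c * x)) := by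
  have h1 : c • H = (hH.eigenvectorUnitary : Matrix n n ℂ) *
      Matrix.diagonal (fun i => c * (hH.eigenvalues i : ℂ)) *
      (hH.eigenvectorUnitary : Matrix n n ℂ)⁻¹ := by
    conv_lhs => rw [← diagOp_id hH, smul_diagOp]
    rw [diagOp, Matrix.inv_eq_left_inv (star_mul_eigenvectorUnitary hH)]
  have hu : IsUnit (hH.eigenvectorUnitary : Matrix n n ℂ) :=
    IsUnit.of_mul_eq_one _ (eigenvectorUnitary_mul_star hH)
  rw [h1, Matrix.exp_conj _ _ hu, Matrix.exp_diagonal,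
    Matrix.inv_eq_left_inv (star_mul_eigenvectorUnitary hH), diagOp]
  congr 3
  funext i
  rw [Pi.coe_exp, Complex.exp_eq_exp_ℂ]

lemma mult_add_symbol (m₁ m₂ : ℝ → ℂ) (A : Matrix n n ℂ) :
    mult hH (fun x => m₁ x + m₂ x) A = mult hH m₁ A + mult hH m₂ A := by
  simp only [mult, ← mul_add, ← add_mul]
  congr 2
  ext i j
  simp [add_mul]

lemma mult_smul_symbol (c : ℂ) (m : ℝ → ℂ) (A : Matrix n n ℂ) :
    mult hH (fun x => c * m x) A = c • mult hH m A := by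
  rw [mult, mult, ← Matrix.smul_mul, ← Matrix.mul_smul]
  congr 2
  ext i j
  simp [mul_assoc]

lemma mult_add (m : ℝ → ℂ) (A B : Matrix n n ℂ) :
    mult hH m (A + B) = mult hH m A + mult hH m B := by
  simp only [mult, ← mul_add, ← add_mul]
  congr 2
  ext i j
  simp [mul_add, add_mul]

lemma mult_smul (m : ℝ → ℂ) (c : ℂ) (A : Matrix n n ℂ) :
    mult hH m (c • A) = c • mult hH m A := by
  rw [mult, mult, ← Matrix.smul_mul, ← Matrix.mul_smul]
  congr 2
  ext i j
  rw [Matrix.mul_smul, Matrix.smul_mul, Matrix.smul_apply, Matrix.of_apply, Matrix.of_apply,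
    Matrix.smul_apply, smul_eq_mul, smul_eq_mul]
  ring

/-- A Schur multiplier as a linear map. -/
def multLin (m : ℝ → ℂ) : Matrix n n ℂ →ₗ[ℂ] Matrix n n ℂ where
  toFun := mult hH m
  map_add' := mult_add hH m
  map_smul' := mult_smul hH m

lemma mult_one (A : Matrix n n ℂ) : mult hH (fun _ => 1) A = A := by
  simp only [mult, one_mul]
  exact conj_eigenvectorUnitary_conj hH A

lemma diagOp_mul_mult_mul_diagOp {g₁ g₂ m m' : ℝ → ℂ}
    (h : ∀ x y, g₁ x * m (x - y) * g₂ y = m' (x - y)) (A : Matrix n n ℂ) :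
    diagOp hH g₁ * mult hH m A * diagOp hH g₂ = mult hH m' A := by
  unfold diagOp mult
  set B := star (hH.eigenvectorUnitary : Matrix n n ℂ) * A *
        (hH.eigenvectorUnitary : Matrix n n ℂ)
  set U := (hH.eigenvectorUnitary : Matrix n n ℂ)
  have hU : star U * U = 1 := star_mul_eigenvectorUnitary hH
  calc _ = U * (Matrix.diagonal (fun i => g₁ (hH.eigenvalues i)) * (star U * U) *
          Matrix.of (fun i j => m (hH.eigenvalues i - hH.eigenvalues j) * B i j) * (star U * U) *
          Matrix.diagonal (fun i => g₂ (hH.eigenvalues i))) * star U := by noncomm_ring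
    _ = _ := by
      rw [hU, mul_one, mul_one]
      congr 2
      ext i j
      rw [Matrix.mul_diagonal, Matrix.diagonal_mul, Matrix.of_apply, Matrix.of_apply,
        ← h (hH.eigenvalues i) (hH.eigenvalues j)]
      ring

lemma star_mult (m : ℝ → ℂ) (A : Matrix n n ℂ) :
    star (mult hH m A) = mult hH (fun x => star (m (-x))) (star A) := by
  unfold mult
  rw [star_mul, star_mul, star_star, mul_assoc]
  rw [mul_assoc]
  congr 2
  ext i j
  have : (star (hH.eigenvectorUnitary : Matrix n n ℂ) * star A *
      (hH.eigenvectorUnitary : Matrix n n ℂ)) = star (star (hH.eigenvectorUnitary : Matrix n n ℂ) *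
      A * (hH.eigenvectorUnitary : Matrix n n ℂ)) := by
    simp [star_mul, mul_assoc]
  rw [this, Matrix.star_apply, Matrix.of_apply, Matrix.of_apply, Matrix.star_apply, star_mul']
  simp only [neg_sub, mul_assoc]

/-- The symbol `1/2 ± tanh (ν/4) / 2` of `𝒮^±`. -/
def symS (b : Bool) (ν : ℝ) : ℂ := 1 / 2 + sgn b * (((1 / 2) * Real.tanh (ν / 4) : ℝ) : ℂ)

lemma opS_eq_mult (A : Matrix n n ℂ) :
    opS hH A = mult hH (fun ν => (((1 / 2) * Real.tanh (ν / 4) : ℝ) : ℂ)) A := by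
  unfold opS bohrPart mult
  have h (c : ℂ) (B : Matrix n n ℂ) : c • ((hH.eigenvectorUnitary : Matrix n n ℂ) * B *
      star (hH.eigenvectorUnitary : Matrix n n ℂ)) = (hH.eigenvectorUnitary : Matrix n n ℂ) *
      (c • B) * star (hH.eigenvectorUnitary : Matrix n n ℂ) := by
    rw [← Matrix.smul_mul, ← Matrix.mul_smul]
  simp only [h]
  rw [← Finset.sum_mul, ← Finset.mul_sum]
  congr 2
  ext i j
  rw [Matrix.sum_apply]
  simp only [Matrix.smul_apply, Matrix.of_apply, smul_eq_mul, mul_ite, mul_zero]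
  rw [Finset.sum_ite_eq, if_pos]
  exact Finset.mem_image.2 ⟨(i, j), Finset.mem_univ _, rfl⟩

lemma opSpm_eq_mult (b : Bool) (A : Matrix n n ℂ) : opSpm hH b A = mult hH (symS b) A := by
  unfold opSpm symS
  rw [opS_eq_mult, mult_add_symbol, mult_smul_symbol]
  congr 1
  have := mult_smul_symbol hH (1 / 2) (fun _ => 1) A
  rw [mult_one] at this
  simpa using this.symm

lemma heis_eq_mult (t : ℝ) (A : Matrix n n ℂ) :
    heis H t A = mult hH (fun ν => Complex.exp (Complex.I * t * ν)) A := by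
  unfold heis
  rw [← neg_smul, exp_smul_eq_diagOp hH, exp_smul_eq_diagOp hH]
  conv_lhs => rw [← mult_one hH A]
  apply diagOp_mul_mult_mul_diagOp
  intro x y
  rw [mul_one, ← Complex.exp_add]
  congr 1
  push_cast
  ring

/-- `𝒮^±` as a linear map. -/
def opSpmLin (b : Bool) : Matrix n n ℂ →ₗ[ℂ] Matrix n n ℂ := multLin hH (symS b)

lemma opSpmLin_apply (b : Bool) (A : Matrix n n ℂ) : opSpmLin hH b A = opSpm hH b A :=
  (opSpm_eq_mult hH b A).symm

lemma opSpm_add_opSpm (A : Matrix n n ℂ) : opSpm hH true A + opSpm hH false A = A := by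
  simp only [opSpm, sgn]
  simp only [if_true, Bool.false_eq_true, if_false]
  module

lemma star_opSpm (b : Bool) (A : Matrix n n ℂ) :
    star (opSpm hH b A) = opSpm hH (!b) (star A) := by
  rw [opSpm_eq_mult, opSpm_eq_mult, star_mult]
  congr 1
  funext x
  cases b <;> simp [symS, sgn, neg_div, Real.tanh_neg, -Complex.ofReal_tanh]

lemma tanh_eq_one_sub (x : ℝ) : Real.tanh x = 1 - 2 / (1 + Real.exp (2 * x)) := by
  rw [Real.tanh_eq, two_mul, Real.exp_add, Real.exp_neg]
  field_simp
  ring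

lemma symS_false (ν : ℝ) : symS false ν = ((1 / (1 + Real.exp (ν / 2)) : ℝ) : ℂ) := by
  simp only [symS, sgn, Bool.false_eq_true, if_false]
  rw [tanh_eq_one_sub, show 2 * (ν / 4) = ν / 2 by ring]
  push_cast
  ring

lemma symS_true (ν : ℝ) :
    symS true ν = ((Real.exp (ν / 2) / (1 + Real.exp (ν / 2)) : ℝ) : ℂ) := by
  have h0 : (1 + Real.exp (ν / 2)) ≠ 0 := by positivity
  have h1 : Real.exp (ν / 2) / (1 + Real.exp (ν / 2)) = 1 - 1 / (1 + Real.exp (ν / 2)) := by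
    field_simp
    ring
  simp only [symS, sgn, if_true]
  rw [h1, tanh_eq_one_sub, show 2 * (ν / 4) = ν / 2 by ring]
  push_cast
  ring

end SchurMultipliers

/-! ### The quadratic equation behind the Kraus operator -/

section Factorization

variable {n : Type u} [Fintype n] [DecidableEq n] {H : Matrix n n ℂ} (hH : H.IsHermitian)

lemma isSelfAdjoint_diagOp_ofReal (g : ℝ → ℝ) :
    IsSelfAdjoint (diagOp hH (fun x => (g x : ℂ))) := by
  rw [IsSelfAdjoint, star_diagOp]
  congr 1
  funext x
  simp

lemma diagOp_nonneg {g : ℝ → ℝ} (hg : ∀ x, 0 ≤ g x) : 0 ≤ diagOp hH (fun x => (g x : ℂ)) := by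
  have h : diagOp hH (fun x => (g x : ℂ)) = star (diagOp hH (fun x => (√(g x) : ℂ))) *
      diagOp hH (fun x => (√(g x) : ℂ)) := by
    rw [(isSelfAdjoint_diagOp_ofReal hH _).star_eq, diagOp_mul]
    congr 1
    funext x
    rw [← Complex.ofReal_mul, Real.mul_self_sqrt (hg x)]
  rw [h]
  exact star_mul_self_nonneg _

/-- The square root of the Gibbs state is a positive multiple of `exp (-H/2)`. -/
lemma exists_sqrt_gibbs_eq_diagOp [Nonempty n] : ∃ r : ℝ, 0 < r ∧
    CFC.sqrt (gibbs H) = diagOp hH (fun x => ((r * Real.exp (-x / 2) : ℝ) : ℂ)) := by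
  have hexp : NormedSpace.exp (-H) = diagOp hH (fun x => ((Real.exp (-x) : ℝ) : ℂ)) := by
    have := exp_smul_eq_diagOp hH (-1)
    rw [neg_one_smul] at this
    rw [this]
    simp
  set Z : ℝ := ∑ i, Real.exp (-hH.eigenvalues i) with hZ
  have hZpos : 0 < Z := Finset.sum_pos (fun i _ => Real.exp_pos _) Finset.univ_nonempty
  refine ⟨√(Z⁻¹), by positivity, ?_⟩
  apply CFC.sqrt_unique
  · rw [diagOp_mul, gibbs, hexp, trace_diagOp, ← Complex.ofReal_sum, ← hZ, smul_diagOp]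
    congr 1
    funext x
    have h1 : √(Z⁻¹) * √(Z⁻¹) = Z⁻¹ := Real.mul_self_sqrt (by positivity)
    have h2 : Real.exp (-x / 2) * Real.exp (-x / 2) = Real.exp (-x) := by
      rw [← Real.exp_add]; ring_nf
    rw [← Complex.ofReal_inv, ← Complex.ofReal_mul, ← Complex.ofReal_mul, mul_mul_mul_comm, h1, h2]
  · exact diagOp_nonneg hH fun x => by positivity

/-- Detailed balance: `exp (-H/2)` intertwines `𝒮^+` and `𝒮^-`. -/
lemma diagOp_mul_opSpm (r : ℝ) (A : Matrix n n ℂ) :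
    diagOp hH (fun x => ((r * Real.exp (-x / 2) : ℝ) : ℂ)) * opSpm hH true A =
      opSpm hH false A * diagOp hH (fun x => ((r * Real.exp (-x / 2) : ℝ) : ℂ)) := by
  have h : opSpm hH true A = diagOp hH (fun x => ((Real.exp (x / 2) : ℝ) : ℂ)) *
      opSpm hH false A * diagOp hH (fun x => ((Real.exp (-x / 2) : ℝ) : ℂ)) := by
    rw [opSpm_eq_mult, opSpm_eq_mult]
    symm
    apply diagOp_mul_mult_mul_diagOp
    intro x y
    rw [symS_false, symS_true, ← Complex.ofReal_mul, ← Complex.ofReal_mul,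
      show (x - y) / 2 = x / 2 + -y / 2 by ring, Real.exp_add]
    ring_nf
  have h2 : diagOp hH (fun x => ((r * Real.exp (-x / 2) : ℝ) : ℂ)) =
      (r : ℂ) • diagOp hH (fun x => ((Real.exp (-x / 2) : ℝ) : ℂ)) := by
    rw [smul_diagOp]; simp
  have h3 : diagOp hH (fun x => ((Real.exp (-x / 2) : ℝ) : ℂ)) *
      diagOp hH (fun x => ((Real.exp (x / 2) : ℝ) : ℂ)) = 1 := by
    rw [diagOp_mul, ← diagOp_one hH]
    congr 1
    funext x
    rw [← Complex.ofReal_mul, ← Real.exp_add]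
    simp [neg_div]
  rw [h, h2, Matrix.smul_mul, Matrix.mul_smul, ← mul_assoc, ← mul_assoc, h3, one_mul]

/-- Conjugation by `exp (H/4)` symmetrizes `𝒮^-[N]`, which keeps its spectrum; hence
`1 - exp (H/4) 𝒮^-[N] exp (-H/4)` is positive as soon as `‖𝒮^-[N]‖ < 1`. -/
lemma one_sub_opSpm_mul_nonneg {N : Matrix n n ℂ} (hN : IsSelfAdjoint N) {r : ℝ} (hr : 0 < r)
    (hlt : ‖opSpm hH false N‖ < 1) :
    0 ≤ (1 - opSpm hH false N) * diagOp hH (fun x => ((r * Real.exp (-x / 2) : ℝ) : ℂ)) := by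
  rcases isEmpty_or_nonempty n with hn | hn
  · exact le_of_eq (Subsingleton.elim _ _)
  set Q := diagOp hH (fun x => ((√r * Real.exp (-x / 4) : ℝ) : ℂ)) with hQ
  set Qi := diagOp hH (fun x => (((√r)⁻¹ * Real.exp (x / 4) : ℝ) : ℂ)) with hQi
  have hr' : √r ≠ 0 := by positivity
  have hQQi : Q * Qi = 1 := by
    rw [hQ, hQi, diagOp_mul, ← diagOp_one hH]
    congr 1
    funext x
    rw [← Complex.ofReal_mul, show √r * Real.exp (-x / 4) * ((√r)⁻¹ * Real.exp (x / 4)) =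
      (√r * (√r)⁻¹) * (Real.exp (-x / 4) * Real.exp (x / 4)) by ring, ← Real.exp_add,
      mul_inv_cancel₀ hr']
    simp [neg_div]
  have hQiQ : Qi * Q = 1 := mul_eq_one_comm.1 hQQi
  have hQQ : Q * Q = diagOp hH (fun x => ((r * Real.exp (-x / 2) : ℝ) : ℂ)) := by
    rw [hQ, diagOp_mul]
    congr 1
    funext x
    rw [← Complex.ofReal_mul, show √r * Real.exp (-x / 4) * (√r * Real.exp (-x / 4)) =
      (√r * √r) * (Real.exp (-x / 4) * Real.exp (-x / 4)) by ring, ← Real.exp_add,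
      Real.mul_self_sqrt hr.le]
    ring_nf
  have hQs : star Q = Q := (isSelfAdjoint_diagOp_ofReal hH _).star_eq
  set W := Qi * opSpm hH false N * Q with hW
  have hWs : IsSelfAdjoint W := by
    have : W = mult hH
        (fun x => ((Real.exp (x / 4) / (1 + Real.exp (x / 2)) : ℝ) : ℂ)) N := by
      rw [hW, opSpm_eq_mult]
      apply diagOp_mul_mult_mul_diagOp
      intro x y
      rw [symS_false, ← Complex.ofReal_mul, ← Complex.ofReal_mul]
      congr 1
      rw [show (x - y) / 4 = x / 4 + -y / 4 by ring, Real.exp_add]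
      field_simp
    rw [this, IsSelfAdjoint, star_mult, hN.star_eq]
    congr 1
    funext x
    rw [Complex.star_def, Complex.conj_ofReal]
    congr 1
    have h1 : Real.exp (-x / 4) = Real.exp (x / 4) * Real.exp (-x / 2) := by
      rw [← Real.exp_add]; ring_nf
    have h2 : Real.exp (x / 2) * Real.exp (-x / 2) = 1 := by
      rw [← Real.exp_add]; simp [neg_div]
    have h3 : (1 + Real.exp (-x / 2)) ≠ 0 := by positivity
    have h4 : (1 + Real.exp (x / 2)) ≠ 0 := by positivity
    rw [h1, div_eq_div_iff h3 h4]
    linear_combination Real.exp (x / 4) * h2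
  have hspec : spectrum ℂ W = spectrum ℂ (opSpm hH false N) := by
    let u : (Matrix n n ℂ)ˣ := ⟨Qi, Q, hQiQ, hQQi⟩
    exact spectrum.units_conjugate (u := u)
  have hpos : 0 ≤ 1 - W := by
    rw [sub_nonneg, ← map_one (algebraMap ℝ (Matrix n n ℂ))]
    refine le_algebraMap_of_spectrum_le (fun x hx => ?_) hWs
    have hx' : (x : ℂ) ∈ spectrum ℂ W := by
      have := (spectrum.algebraMap_mem_iff (R := ℝ) ℂ (a := W) (r := x)).2 hx
      simpa using this
    rw [hspec] at hx'
    have := spectrum.norm_le_norm_of_mem hx'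
    rw [Complex.norm_real] at this
    exact (Real.le_norm_self x).trans (this.trans hlt.le)
  have hfin : (1 - opSpm hH false N) * (Q * Q) = star Q * (1 - W) * Q := by
    have : Q * W = opSpm hH false N * Q := by
      rw [hW, ← mul_assoc, ← mul_assoc, hQQi, one_mul]
    rw [hQs, mul_sub, this, mul_one, sub_mul, sub_mul, one_mul, mul_assoc]
  rw [← hQQ, hfin]
  exact star_left_conjugate_nonneg hpos Q

/-- The Kraus operator solves a quadratic equation: if `N` is a Hermitian solution of
`N = O + 𝒮^+[N] 𝒮^-[N]` with `‖𝒮^-[N]‖ < 1`, then `K = 1 - 𝒮^-[N]`. -/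
theorem krausOp_eq_one_sub {N O : Matrix n n ℂ} (hN : IsSelfAdjoint N)
    (hNO : N = O + opSpm hH true N * opSpm hH false N) (hlt : ‖opSpm hH false N‖ < 1) :
    krausOp H O = 1 - opSpm hH false N := by
  rcases isEmpty_or_nonempty n with hn | hn
  · exact Subsingleton.elim _ _
  obtain ⟨r, hr, hP⟩ := exists_sqrt_gibbs_eq_diagOp hH
  set P := diagOp hH (fun x => ((r * Real.exp (-x / 2) : ℝ) : ℂ)) with hPdef
  have hPs : star P = P := (isSelfAdjoint_diagOp_ofReal hH _).star_eq
  have hbal : P * opSpm hH true N = opSpm hH false N * P := diagOp_mul_opSpm hH r N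
  have hpos : 0 ≤ (1 - opSpm hH false N) * P := one_sub_opSpm_mul_nonneg hH hN hr hlt
  have hsq : ((1 - opSpm hH false N) * P) * ((1 - opSpm hH false N) * P) = P * (1 - O) * P := by
    have h1 : (1 - opSpm hH false N) * P = P * (1 - opSpm hH true N) := by
      rw [mul_sub, hbal, sub_mul, mul_one, one_mul]
    have h2 : (1 - opSpm hH true N) * (1 - opSpm hH false N) = 1 - O := by
      have h3 := opSpm_add_opSpm hH N
      calc _ = 1 - (opSpm hH true N + opSpm hH false N) + opSpm hH true N * opSpm hH false N := by
            noncomm_ring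
        _ = 1 - O := by rw [h3]; nth_rw 1 [hNO]; abel
    calc _ = (P * (1 - opSpm hH true N)) * ((1 - opSpm hH false N) * P) := by rw [← h1]
      _ = P * ((1 - opSpm hH true N) * (1 - opSpm hH false N)) * P := by noncomm_ring
      _ = _ := by rw [h2]
  have hPinv : P * diagOp hH (fun x => ((r⁻¹ * Real.exp (x / 2) : ℝ) : ℂ)) = 1 := by
    rw [hPdef, diagOp_mul, ← diagOp_one hH]
    congr 1
    funext x
    rw [← Complex.ofReal_mul, show r * Real.exp (-x / 2) * (r⁻¹ * Real.exp (x / 2)) =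
      (r * r⁻¹) * (Real.exp (-x / 2) * Real.exp (x / 2)) by ring, ← Real.exp_add,
      mul_inv_cancel₀ hr.ne']
    simp [neg_div]
  have hdet : IsUnit P.det := (Matrix.isUnit_iff_isUnit_det _).1 (IsUnit.of_mul_eq_one _ hPinv)
  rw [krausOp, hP, CFC.sqrt_unique hsq hpos, mul_assoc, Matrix.mul_nonsing_inv _ hdet, mul_one]

end Factorization

/-! ### Convolution recursions and the truncated series -/

section Recursion

open Finset

lemma sum_range_sum_antidiagonal_le {f g : ℕ → ℝ} (hf : ∀ k, 0 ≤ f k) (hg : ∀ k, 0 ≤ g k)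
    (K : ℕ) : ∑ k ∈ range K, ∑ p ∈ antidiagonal k, f p.1 * g p.2 ≤
      (∑ k ∈ range K, f k) * ∑ k ∈ range K, g k := by
  rw [Finset.sum_mul_sum, ← Finset.sum_product', ← Finset.sum_biUnion]
  · refine Finset.sum_le_sum_of_subset_of_nonneg (fun p hp => ?_)
      fun p _ _ => mul_nonneg (hf _) (hg _)
    obtain ⟨k, hk, hp⟩ := Finset.mem_biUnion.1 hp
    have h1 := HasAntidiagonal.mem_antidiagonal.1 hp
    have h2 := Finset.mem_range.1 hk
    exact Finset.mem_product.2 ⟨Finset.mem_range.2 (by omega), Finset.mem_range.2 (by omega)⟩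
  · intro i _ j _ hij
    refine Finset.disjoint_left.2 fun p hp hq => hij ?_
    rw [← HasAntidiagonal.mem_antidiagonal.1 hp, HasAntidiagonal.mem_antidiagonal.1 hq]

/-- Partial sums of a sequence obeying a quadratic convolution inequality stay below any
supersolution of the corresponding quadratic equation. -/
lemma sum_range_le_of_convolution {u : ℕ → ℝ} {a c g : ℝ} (hu : ∀ k, 0 ≤ u k) (h0 : u 0 ≤ a)
    (hs : ∀ k, u (k + 1) ≤ c * ∑ p ∈ antidiagonal k, u p.1 * u p.2) (hc : 0 ≤ c) (hg : 0 ≤ g)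
    (h : a + c * g ^ 2 ≤ g) (K : ℕ) : ∑ k ∈ range K, u k ≤ g := by
  induction K with
  | zero => simpa using hg
  | succ K ih =>
    rw [Finset.sum_range_succ']
    have h1 : ∑ k ∈ range K, u (k + 1) ≤ c * g ^ 2 := by
      calc _ ≤ ∑ k ∈ range K, c * ∑ p ∈ antidiagonal k, u p.1 * u p.2 :=
            Finset.sum_le_sum fun k _ => hs k
        _ = c * ∑ k ∈ range K, ∑ p ∈ antidiagonal k, u p.1 * u p.2 := by rw [Finset.mul_sum]
        _ ≤ c * ((∑ k ∈ range K, u k) * ∑ k ∈ range K, u k) := by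
            gcongr; exact sum_range_sum_antidiagonal_le hu hu K
        _ ≤ c * g ^ 2 := by
            rw [pow_two]
            have := Finset.sum_nonneg fun k (_ : k ∈ range K) => hu k
            gcongr
    linarith

/-- Partial sums of the errors `d`, given the partial sums of the two sequences `u` and `v`. -/
lemma sum_range_le_of_error_convolution {d u v : ℕ → ℝ} {ε : ℝ} (hε : 0 < ε) (hd : ∀ k, 0 ≤ d k)
    (hu : ∀ k, 0 ≤ u k) (hv : ∀ k, 0 ≤ v k) (h0 : d 0 ≤ ε / 16)
    (hs : ∀ k, d (k + 1) ≤ ∑ p ∈ antidiagonal k, (d p.1 + ε * v p.1) * u p.2 +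
      ∑ p ∈ antidiagonal k, (3 / 2 * v p.1) * (d p.2 + ε * v p.2))
    (hU : ∀ K, ∑ k ∈ range K, u k ≤ 1 / 14) (hV : ∀ K, ∑ k ∈ range K, v k ≤ 1 / 12) (K : ℕ) :
    ∑ k ∈ range K, d k ≤ ε / 10 := by
  induction K with
  | zero => simp; positivity
  | succ K ih =>
    rw [Finset.sum_range_succ']
    have hdv (k : ℕ) : 0 ≤ d k + ε * v k := add_nonneg (hd k) (mul_nonneg hε.le (hv k))
    have h1 := Finset.sum_le_sum fun k (_ : k ∈ range K) => hs k
    rw [Finset.sum_add_distrib] at h1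
    have h2 := sum_range_sum_antidiagonal_le hdv hu K
    have h3 := sum_range_sum_antidiagonal_le
      (fun k => mul_nonneg (by norm_num : (0 : ℝ) ≤ 3 / 2) (hv k)) hdv K
    have hU0 : 0 ≤ ∑ k ∈ range K, u k := Finset.sum_nonneg fun k _ => hu k
    have hDV0 : 0 ≤ ∑ k ∈ range K, (d k + ε * v k) := Finset.sum_nonneg fun k _ => hdv k
    have hDV : ∑ k ∈ range K, (d k + ε * v k) ≤ ε * (1 / 10 + 1 / 12) := by
      rw [Finset.sum_add_distrib, ← Finset.mul_sum]
      have := mul_le_mul_of_nonneg_left (hV K) hε.le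
      linarith
    rw [← Finset.mul_sum (range K) v] at h3
    have h2' := h2.trans (mul_le_mul hDV (hU K) hU0 (by positivity))
    have h3' := h3.trans (mul_le_mul (mul_le_mul_of_nonneg_left (hV K) (by norm_num)) hDV
      hDV0 (by norm_num))
    linarith

variable {n : Type u} [Fintype n] [DecidableEq n]

omit [DecidableEq n] in
lemma nabla_one (Sp Sm : Matrix n n ℂ → Matrix n n ℂ) (M : Matrix n n ℂ) :
    nabla Sp Sm M 1 = M := by
  rw [nabla]

omit [DecidableEq n] in
lemma nabla_add_two (Sp Sm : Matrix n n ℂ → Matrix n n ℂ) (M : Matrix n n ℂ) (k : ℕ) :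
    nabla Sp Sm M (k + 2) = ∑ p ∈ antidiagonal k,
      Sp (nabla Sp Sm M (p.1 + 1)) * Sm (nabla Sp Sm M (p.2 + 1)) := by
  rw [nabla, Finset.Nat.sum_antidiagonal_eq_sum_range_succ
    (fun i j => Sp (nabla Sp Sm M (i + 1)) * Sm (nabla Sp Sm M (j + 1))) k,
    ← Fin.sum_univ_eq_sum_range
      (fun i => Sp (nabla Sp Sm M (i + 1)) * Sm (nabla Sp Sm M (k - i + 1)))]
  refine Finset.sum_congr rfl fun p _ => ?_
  rw [show k + 1 - (p : ℕ) = k - p + 1 by omega]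

lemma norm_nabla_convolution {Sp Sm : Matrix n n ℂ → Matrix n n ℂ} {s : ℝ} (hs : 0 ≤ s)
    (hp : SuperopNormLE Sp s) (hm : SuperopNormLE Sm s) (M : Matrix n n ℂ) (k : ℕ) :
    ‖nabla Sp Sm M (k + 2)‖ ≤ s ^ 2 * ∑ p ∈ antidiagonal k,
      ‖nabla Sp Sm M (p.1 + 1)‖ * ‖nabla Sp Sm M (p.2 + 1)‖ := by
  rw [nabla_add_two, Finset.mul_sum]
  refine (norm_sum_le _ _).trans (Finset.sum_le_sum fun p _ => (norm_mul_le _ _).trans ?_)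
  calc _ ≤ (s * ‖nabla Sp Sm M (p.1 + 1)‖) * (s * ‖nabla Sp Sm M (p.2 + 1)‖) :=
        mul_le_mul (hp _) (hm _) (norm_nonneg _) (by positivity)
    _ = _ := by ring

lemma isSelfAdjoint_nabla {H : Matrix n n ℂ} (hH : H.IsHermitian) {O : Matrix n n ℂ}
    (hO : IsSelfAdjoint O) (k : ℕ) :
    IsSelfAdjoint (nabla (opSpm hH true) (opSpm hH false) O (k + 1)) := by
  induction k using Nat.strong_induction_on with
  | _ k ih =>
    rcases k with _ | k
    · rwa [zero_add, nabla_one]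
    rw [nabla_add_two, IsSelfAdjoint, star_sum, ← Finset.Nat.sum_antidiagonal_swap]
    refine Finset.sum_congr rfl fun p hp => ?_
    have hp' := HasAntidiagonal.mem_antidiagonal.1 hp
    rw [star_mul, star_opSpm, star_opSpm, Prod.fst_swap, Prod.snd_swap,
      (ih p.1 (by omega)).star_eq, (ih p.2 (by omega)).star_eq]
    rfl

end Recursion

/-! ### The series for the Kraus operator -/

section Existence

open Finset

variable {n : Type u} [Fintype n] [DecidableEq n] {H O : Matrix n n ℂ}

/-- The sums `∑ z^k s² ‖∇^(k+1)[M]‖` stay below every solution `g` of `a + z c g² ≤ g`, where `c`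
accounts for superoperators of norm `σ` larger than `s`. -/
lemma sq_mul_sum_norm_nabla_le {Sp Sm : Matrix n n ℂ → Matrix n n ℂ} {s σ c : ℝ}
    (hc : 0 ≤ c) (hσ : σ ^ 2 ≤ c * s ^ 2) (hσ0 : 0 ≤ σ)
    (hp : SuperopNormLE Sp σ) (hm : SuperopNormLE Sm σ) {a g z : ℝ} {M : Matrix n n ℂ}
    (hM : s ^ 2 * ‖M‖ ≤ a) (hg : 0 ≤ g) (hz : 0 ≤ z) (h : a + z * c * g ^ 2 ≤ g) (K : ℕ) :
    ∑ k ∈ range K, z ^ k * (s ^ 2 * ‖nabla Sp Sm M (k + 1)‖) ≤ g := by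
  apply sum_range_le_of_convolution (a := a) (c := z * c) _ _ _ (by positivity) hg h
  · intro k; positivity
  · simpa [nabla_one] using hM
  · intro k
    have h1 : z ^ (k + 1) * (s ^ 2 * ‖nabla Sp Sm M (k + 1 + 1)‖) ≤ z ^ (k + 1) * (s ^ 2 *
        (c * s ^ 2 * ∑ p ∈ antidiagonal k,
          ‖nabla Sp Sm M (p.1 + 1)‖ * ‖nabla Sp Sm M (p.2 + 1)‖)) := by
      gcongr
      refine (norm_nabla_convolution hσ0 hp hm M k).trans ?_
      gcongr
    refine h1.trans (le_of_eq ?_)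
    simp only [Finset.mul_sum]
    refine Finset.sum_congr rfl fun p hp' => ?_
    rw [← HasAntidiagonal.mem_antidiagonal.1 hp']
    ring

/-- Below the threshold `‖O‖ ≤ 1 / (16 s²)` the series `N = ∑ ∇^(k)[O]` converges and yields the
Kraus operator. -/
theorem exists_krausOp_eq (hH : H.IsHermitian) (hO : O.IsHermitian) {s : ℝ} (hs : 1 / 2 ≤ s)
    (hS : ∀ b, SuperopNormLE (opSpm hH b) s) (hOs : ‖O‖ ≤ 1 / (16 * s ^ 2)) :
    ∃ N : Matrix n n ℂ,
      HasSum (fun k => nabla (opSpm hH true) (opSpm hH false) O (k + 1)) N ∧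
      Summable (fun k => ‖nabla (opSpm hH true) (opSpm hH false) O (k + 1)‖) ∧
      s ^ 2 * ‖N‖ ≤ 1 / 14 ∧ krausOp H O = 1 - opSpm hH false N := by
  have hs0 : 0 < s := by linarith
  set ν := fun k => nabla (opSpm hH true) (opSpm hH false) O (k + 1) with hν
  have hO' : s ^ 2 * ‖O‖ ≤ 1 / 16 := by
    rw [le_div_iff₀ (by positivity)] at hOs
    linarith
  have hpart (K : ℕ) : ∑ k ∈ range K, ‖ν k‖ ≤ 1 / 14 / s ^ 2 := by
    have := sq_mul_sum_norm_nabla_le (c := 1) (z := 1) zero_le_one (by simp) hs0.le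
      (hS true) (hS false) hO' (g := 1 / 14) (by norm_num) zero_le_one (by norm_num) K
    simp only [one_pow, one_mul, ← Finset.mul_sum] at this
    rwa [le_div_iff₀ (by positivity), mul_comm]
  have hsum : Summable fun k => ‖ν k‖ :=
    summable_of_sum_range_le (fun k => norm_nonneg _) hpart
  have hsum' : Summable ν := hsum.of_norm
  have hNle : s ^ 2 * ‖∑' k, ν k‖ ≤ 1 / 14 := by
    have := (norm_tsum_le_tsum_norm hsum).trans
      (Real.tsum_le_of_sum_range_le (fun k => norm_nonneg _) hpart)
    rwa [le_div_iff₀ (by positivity), mul_comm] at this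
  have hlin (b : Bool) : HasSum (fun k => opSpm hH b (ν k)) (opSpm hH b (∑' k, ν k)) := by
    have hc : Continuous (opSpmLin hH b) := LinearMap.continuous_of_finiteDimensional _
    have := hsum'.hasSum.map (opSpmLin hH b) hc
    simpa only [Function.comp_def, opSpmLin_apply] using this
  have hlinN (b : Bool) : Summable fun k => ‖opSpm hH b (ν k)‖ :=
    Summable.of_nonneg_of_le (fun k => norm_nonneg _) (fun k => hS b _) (hsum.mul_left s)
  have hsa : IsSelfAdjoint (∑' k, ν k) := by
    rw [IsSelfAdjoint, tsum_star]
    congr 1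
    funext k
    exact (isSelfAdjoint_nabla hH hO.isSelfAdjoint k).star_eq
  refine ⟨∑' k, ν k, hsum'.hasSum, hsum, hNle, ?_⟩
  apply krausOp_eq_one_sub hH hsa
  · nth_rw 1 [hsum'.tsum_eq_zero_add]
    rw [← (hlin true).tsum_eq, ← (hlin false).tsum_eq,
      tsum_mul_tsum_eq_tsum_sum_antidiagonal_of_summable_norm (hlinN true) (hlinN false)]
    congr 1
    · simp [hν, nabla_one]
    · congr 1
      funext k
      simp only [hν]
      rw [nabla_add_two]
  · calc ‖opSpm hH false (∑' k, ν k)‖ ≤ s * ‖∑' k, ν k‖ := hS _ _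
      _ < 1 := by nlinarith [norm_nonneg (∑' k, ν k)]

lemma norm_opSpm_sub_le (hH : H.IsHermitian) {ε s : ℝ} {b : Bool}
    (hS : SuperopNormLE (opSpm hH b) s) {T : Matrix n n ℂ → Matrix n n ℂ}
    (hT : SuperopNormLE (fun A => opSpm hH b A - T A) (ε * s)) (A B : Matrix n n ℂ) :
    ‖opSpm hH b A - T B‖ ≤ s * (‖A - B‖ + ε * ‖B‖) := by
  have h1 : opSpm hH b A - T B = opSpm hH b (A - B) + (opSpm hH b B - T B) := by
    simp only [← opSpmLin_apply, map_sub]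
    abel
  rw [h1]
  refine (norm_add_le _ _).trans ?_
  have h2 := hS (A - B)
  have h3 : ‖opSpm hH b B - T B‖ ≤ ε * s * ‖B‖ := hT B
  linarith

lemma superopNormLE_of_opSpm_sub (hH : H.IsHermitian) {ε s : ℝ} {b : Bool} (hs : 0 ≤ s)
    (hε : ε ≤ 1 / 2) (hS : SuperopNormLE (opSpm hH b) s) {T : Matrix n n ℂ → Matrix n n ℂ}
    (hT : SuperopNormLE (fun A => opSpm hH b A - T A) (ε * s)) :
    SuperopNormLE T (3 / 2 * s) := by
  intro A
  have h1 : ‖opSpm hH b A - T A‖ ≤ ε * s * ‖A‖ := hT A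
  have h2 := hS A
  have h3 : ‖T A‖ ≤ ‖opSpm hH b A‖ + ‖opSpm hH b A - T A‖ := by
    have := norm_sub_le (opSpm hH b A) (opSpm hH b A - T A)
    simpa using this
  have h4 : ε * s * ‖A‖ ≤ 1 / 2 * s * ‖A‖ := by gcongr
  linarith

lemma sum_norm_perturbed_nabla_le (hH : H.IsHermitian) {O' : Matrix n n ℂ}
    {Sp Sm : Matrix n n ℂ → Matrix n n ℂ} {ε s : ℝ} (hε2 : ε ≤ 1 / 2) (hs0 : 0 < s)
    (hS : ∀ b, SuperopNormLE (opSpm hH b) s) (hOa' : s ^ 2 * ‖O'‖ ≤ 1 / 16)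
    (hp : SuperopNormLE (fun A => opSpm hH true A - Sp A) (ε * s))
    (hm : SuperopNormLE (fun A => opSpm hH false A - Sm A) (ε * s)) (K : ℕ) :
    ∑ k ∈ range K, s ^ 2 * ‖nabla Sp Sm O' (k + 1)‖ ≤ 1 / 12 := by
  have hnp := superopNormLE_of_opSpm_sub hH hs0.le hε2 (hS true) hp
  have hnm := superopNormLE_of_opSpm_sub hH hs0.le hε2 (hS false) hm
  have := sq_mul_sum_norm_nabla_le (c := 9 / 4) (z := 1) (by norm_num)
    (σ := 3 / 2 * s) (by nlinarith) (by positivity)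
    hnp hnm hOa' (g := 1 / 12) (by norm_num) zero_le_one (by norm_num) K
  simpa only [one_pow, one_mul] using this

/-- One step of the recursion for the distance between the exact and the perturbed terms. -/
lemma norm_nabla_sub_convolution (hH : H.IsHermitian) {O' : Matrix n n ℂ}
    {Sp Sm : Matrix n n ℂ → Matrix n n ℂ} {ε s : ℝ} (hε : 0 < ε) (hε2 : ε ≤ 1 / 2) (hs0 : 0 < s)
    (hS : ∀ b, SuperopNormLE (opSpm hH b) s)
    (hp : SuperopNormLE (fun A => opSpm hH true A - Sp A) (ε * s))
    (hm : SuperopNormLE (fun A => opSpm hH false A - Sm A) (ε * s)) (k : ℕ) :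
    let ν := fun k => nabla (opSpm hH true) (opSpm hH false) O (k + 1)
    let ν' := fun k => nabla Sp Sm O' (k + 1)
    s ^ 2 * ‖ν (k + 1) - ν' (k + 1)‖ ≤ ∑ p ∈ antidiagonal k,
      (s ^ 2 * ‖ν p.1 - ν' p.1‖ + ε * (s ^ 2 * ‖ν' p.1‖)) * (s ^ 2 * ‖ν p.2‖) +
      ∑ p ∈ antidiagonal k, (3 / 2 * (s ^ 2 * ‖ν' p.1‖)) *
        (s ^ 2 * ‖ν p.2 - ν' p.2‖ + ε * (s ^ 2 * ‖ν' p.2‖)) := by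
  intro ν ν'
  rw [← Finset.sum_add_distrib]
  change s ^ 2 * ‖nabla (opSpm hH true) (opSpm hH false) O (k + 2) - nabla Sp Sm O' (k + 2)‖ ≤ _
  rw [nabla_add_two, nabla_add_two, ← Finset.sum_sub_distrib]
  have := norm_sum_le (antidiagonal k) fun p => opSpm hH true (ν p.1) * opSpm hH false (ν p.2)
    - Sp (ν' p.1) * Sm (ν' p.2)
  refine (mul_le_mul_of_nonneg_left this (by positivity)).trans ?_
  rw [Finset.mul_sum]
  refine Finset.sum_le_sum fun p _ => ?_
  have e1 : opSpm hH true (ν p.1) * opSpm hH false (ν p.2) - Sp (ν' p.1) * Sm (ν' p.2) =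
      (opSpm hH true (ν p.1) - Sp (ν' p.1)) * opSpm hH false (ν p.2) +
      Sp (ν' p.1) * (opSpm hH false (ν p.2) - Sm (ν' p.2)) := by noncomm_ring
  have e2 : ‖opSpm hH true (ν p.1) * opSpm hH false (ν p.2) - Sp (ν' p.1) * Sm (ν' p.2)‖ ≤
      (s * (‖ν p.1 - ν' p.1‖ + ε * ‖ν' p.1‖)) * (s * ‖ν p.2‖) +
      (3 / 2 * s * ‖ν' p.1‖) * (s * (‖ν p.2 - ν' p.2‖ + ε * ‖ν' p.2‖)) := by
    rw [e1]
    refine (norm_add_le _ _).trans (add_le_add ?_ ?_)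
    · exact (norm_mul_le _ _).trans (mul_le_mul (norm_opSpm_sub_le hH (hS _) hp _ _) (hS _ _)
        (norm_nonneg _) (by positivity))
    · exact (norm_mul_le _ _).trans (mul_le_mul
        (superopNormLE_of_opSpm_sub hH hs0.le hε2 (hS _) hp _) (norm_opSpm_sub_le hH (hS _) hm _ _)
        (norm_nonneg _) (by positivity))
  calc _ ≤ s ^ 2 * _ := mul_le_mul_of_nonneg_left e2 (by positivity)
    _ = _ := by ring

/-- The exact and the perturbed terms differ by at most `ε / (10 s²)` in total. -/
lemma sum_norm_nabla_sub_le (hH : H.IsHermitian) {O' : Matrix n n ℂ}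
    {Sp Sm : Matrix n n ℂ → Matrix n n ℂ} {ε s : ℝ} (hε : 0 < ε) (hε2 : ε ≤ 1 / 2) (hs0 : 0 < s)
    (hS : ∀ b, SuperopNormLE (opSpm hH b) s)
    (hOa : s ^ 2 * ‖O‖ ≤ 1 / 16) (hOa' : s ^ 2 * ‖O'‖ ≤ 1 / 16) (hOd : s ^ 2 * ‖O - O'‖ ≤ ε / 16)
    (hp : SuperopNormLE (fun A => opSpm hH true A - Sp A) (ε * s))
    (hm : SuperopNormLE (fun A => opSpm hH false A - Sm A) (ε * s)) (K : ℕ) :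
    ∑ k ∈ range K, s ^ 2 * ‖nabla (opSpm hH true) (opSpm hH false) O (k + 1) -
      nabla Sp Sm O' (k + 1)‖ ≤ ε / 10 := by
  have hU (K : ℕ) : ∑ k ∈ range K, s ^ 2 *
      ‖nabla (opSpm hH true) (opSpm hH false) O (k + 1)‖ ≤ 1 / 14 := by
    have := sq_mul_sum_norm_nabla_le (c := 1) (z := 1) zero_le_one (by simp) hs0.le
      (hS true) (hS false) hOa (g := 1 / 14) (by norm_num) zero_le_one (by norm_num) K
    simpa only [one_pow, one_mul] using this
  have hV := sum_norm_perturbed_nabla_le hH hε2 hs0 hS hOa' hp hm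
  refine sum_range_le_of_error_convolution hε (fun k => by positivity) (fun k => by positivity)
    (fun k => by positivity) ?_
    (norm_nabla_sub_convolution hH hε hε2 hs0 hS (O := O) (O' := O') hp hm) hU hV K
  simpa [nabla_one] using hOd

lemma inv_two_pow_order_le {ε : ℝ} (hε : 0 < ε) : (2 : ℝ)⁻¹ ^ order ε ≤ 2 * ε := by
  set m := order ε with hmdef
  have h1 : Real.logb 2 (1 / ε) < m + 1 := Nat.lt_floor_add_one _
  rw [Real.logb_lt_iff_lt_rpow (by norm_num) (by positivity)] at h1
  have h2 : (2 : ℝ) ^ ((m : ℝ) + 1) = 2 ^ m * 2 := by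
    rw [Real.rpow_add (by norm_num), Real.rpow_natCast, Real.rpow_one]
  rw [h2, div_lt_iff₀ hε] at h1
  rw [inv_pow, inv_le_iff_one_le_mul₀ (by positivity)]
  linarith

/-- The truncated series built from perturbed superoperators and a perturbed `O` approximates the
Kraus operator. The perturbed superoperators are only assumed close to the exact ones: their norm
is then at most `(3/2) s`, for which the series still converges with room to spare. The bound
`9/10 ε` leaves room for discretizing the integrals later on. -/
theorem norm_truncation_sub_krausOp_le (hH : H.IsHermitian) (hO : O.IsHermitian)
    {O' : Matrix n n ℂ} {Sp Sm : Matrix n n ℂ → Matrix n n ℂ} {ε s : ℝ} (hε : 0 < ε)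
    (hε2 : ε ≤ 1 / 2) (hs : 1 / 2 ≤ s) (hS : ∀ b, SuperopNormLE (opSpm hH b) s)
    (hOs : ‖O‖ ≤ 1 / (16 * s ^ 2)) (hOs' : ‖O'‖ ≤ 1 / (16 * s ^ 2))
    (hOO : ‖O - O'‖ ≤ ε / (16 * s ^ 2))
    (hp : SuperopNormLE (fun A => opSpm hH true A - Sp A) (ε * s))
    (hm : SuperopNormLE (fun A => opSpm hH false A - Sm A) (ε * s)) :
    ‖1 - ∑ k ∈ Finset.Icc 1 (order ε), Sm (nabla Sp Sm O' k) - krausOp H O‖ ≤ 9 / 10 * ε := by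
  have hs0 : 0 < s := by linarith
  obtain ⟨N, hN, hNs, -, hK⟩ := exists_krausOp_eq hH hO hs hS hOs
  set ν := fun k => nabla (opSpm hH true) (opSpm hH false) O (k + 1) with hν
  set ν' := fun k => nabla Sp Sm O' (k + 1) with hν'
  have hOa : s ^ 2 * ‖O‖ ≤ 1 / 16 := by
    rw [le_div_iff₀ (by positivity)] at hOs
    linarith
  have hOa' : s ^ 2 * ‖O'‖ ≤ 1 / 16 := by
    rw [le_div_iff₀ (by positivity)] at hOs'
    linarith
  have hOd : s ^ 2 * ‖O - O'‖ ≤ ε / 16 := by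
    rw [le_div_iff₀ (by positivity)] at hOO
    linarith
  have hdiff := norm_opSpm_sub_le hH (hS false) hm
  have hV := sum_norm_perturbed_nabla_le hH hε2 hs0 hS hOa' hp hm
  have hD := sum_norm_nabla_sub_le hH hε hε2 hs0 hS hOa hOa' hOd hp hm
  -- `3/40` is a supersolution for `z = 2`: `1/16 + 2 (3/40)² ≤ 3/40`
  have hW (K : ℕ) : ∑ k ∈ range K, 2 ^ k * (s ^ 2 * ‖ν k‖) ≤ 3 / 40 :=
    sq_mul_sum_norm_nabla_le (c := 1) (z := 2) zero_le_one (by simp) hs0.le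
      (hS true) (hS false) hOa (g := 3 / 40) (by norm_num) zero_le_two (by norm_num) K
  -- the tail of the exact series is controlled by the weighted sum `∑ 2^k ‖ν k‖`
  set m := order ε with hmdef
  have hm2 : (2 : ℝ)⁻¹ ^ m ≤ 2 * ε := inv_two_pow_order_le hε
  have htail : s ^ 2 * ‖N - ∑ k ∈ range m, ν k‖ ≤ 3 / 20 * ε := by
    have hN' : HasSum (fun k => ν (k + m)) (N - ∑ k ∈ range m, ν k) :=
      (hasSum_nat_add_iff' m).2 hN
    have hb (K : ℕ) : ∑ k ∈ range K, ‖ν (k + m)‖ ≤ 3 / 20 * ε / s ^ 2 := by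
      rw [le_div_iff₀ (by positivity), mul_comm, Finset.mul_sum]
      calc ∑ k ∈ range K, s ^ 2 * ‖ν (k + m)‖
          ≤ ∑ k ∈ range K, (2 : ℝ)⁻¹ ^ m * (2 ^ (m + k) * (s ^ 2 * ‖ν (m + k)‖)) := by
            refine Finset.sum_le_sum fun k _ => ?_
            rw [pow_add, ← mul_assoc, ← mul_assoc ((2 : ℝ)⁻¹ ^ m), ← mul_pow, add_comm k m]
            have : (1 : ℝ) ≤ 2 ^ k := one_le_pow₀ (by norm_num)
            have h0 : 0 ≤ s ^ 2 * ‖ν (m + k)‖ := by positivity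
            norm_num
            nlinarith
        _ = (2 : ℝ)⁻¹ ^ m * ∑ k ∈ range K, 2 ^ (m + k) * (s ^ 2 * ‖ν (m + k)‖) := by
            rw [Finset.mul_sum]
        _ ≤ (2 : ℝ)⁻¹ ^ m * ∑ k ∈ range (m + K), 2 ^ k * (s ^ 2 * ‖ν k‖) := by
            gcongr
            rw [Finset.sum_range_add _ m K]
            have : 0 ≤ ∑ k ∈ range m, 2 ^ k * (s ^ 2 * ‖ν k‖) :=
              Finset.sum_nonneg fun k _ => by positivity
            linarith
        _ ≤ 2 * ε * (3 / 40) := by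
            apply mul_le_mul hm2 (hW _) (Finset.sum_nonneg fun k _ => by positivity)
              (by positivity)
        _ = _ := by ring
    have hsum : Summable fun k => ‖ν (k + m)‖ :=
      summable_of_sum_range_le (fun k => norm_nonneg _) hb
    have := (norm_tsum_le_tsum_norm hsum).trans
      (Real.tsum_le_of_sum_range_le (fun k => norm_nonneg _) hb)
    rwa [hN'.tsum_eq, le_div_iff₀ (by positivity), mul_comm] at this
  have hIcc : ∑ k ∈ Finset.Icc 1 m, Sm (nabla Sp Sm O' k) = ∑ k ∈ range m, Sm (ν' k) := by
    rw [Finset.range_eq_Ico, Finset.sum_Ico_add' (fun k => Sm (nabla Sp Sm O' k)) 0 m 1]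
    rfl
  rw [hK, hIcc]
  have hfin : 1 - ∑ k ∈ range m, Sm (ν' k) - (1 - opSpm hH false N) =
      opSpm hH false (N - ∑ k ∈ range m, ν k) +
        ∑ k ∈ range m, (opSpm hH false (ν k) - Sm (ν' k)) := by
    simp only [← opSpmLin_apply, map_sub, map_sum, Finset.sum_sub_distrib]
    abel
  rw [hfin]
  have hsum2 : ‖∑ k ∈ range m, (opSpm hH false (ν k) - Sm (ν' k))‖ ≤
      s * (∑ k ∈ range m, ‖ν k - ν' k‖ + ε * ∑ k ∈ range m, ‖ν' k‖) := by
    refine (norm_sum_le _ _).trans ?_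
    rw [Finset.mul_sum, ← Finset.sum_add_distrib, Finset.mul_sum]
    exact Finset.sum_le_sum fun k _ => hdiff _ _
  have hA := hS false (N - ∑ k ∈ range m, ν k)
  have hDm := hD m
  have hVm := hV m
  rw [← Finset.mul_sum] at hDm hVm
  have hX : s * (s * ‖N - ∑ k ∈ range m, ν k‖ +
      s * (∑ k ∈ range m, ‖ν k - ν' k‖ + ε * ∑ k ∈ range m, ‖ν' k‖)) ≤
      ε * (3 / 20 + 1 / 10 + 1 / 12) := by
    have := mul_le_mul_of_nonneg_left hVm hε.le
    nlinarith
  have hY := (norm_add_le _ _).trans (add_le_add hA hsum2)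
  refine hY.trans ?_
  set Y := s * ‖N - ∑ k ∈ range m, ν k‖ +
      s * (∑ k ∈ range m, ‖ν k - ν' k‖ + ε * ∑ k ∈ range m, ‖ν' k‖)
  have hY0 : 0 ≤ Y := (norm_nonneg _).trans hY
  nlinarith

end Existence

/-! ### The Fourier integral of the hyperbolic tangent -/

section Tanh

open MeasureTheory Set Filter Topology

lemma hasSum_of_eq {E : Type*} [AddCommMonoid E] [TopologicalSpace E] {f g : ℕ → E} {a : E}
    (h : ∀ k, f k = g k) (hg : HasSum g a) : HasSum f a :=
  (funext h : f = g) ▸ hg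

lemma hasSum_coth {y : ℝ} (hy : y ≠ 0) :
    HasSum (fun k : ℕ => 2 * y / (y ^ 2 + (k + 1) ^ 2))
      (Real.pi * (Real.cosh (Real.pi * y) / Real.sinh (Real.pi * y)) - 1 / y) := by
  have hx : (y : ℂ) * Complex.I ∈ Complex.integerComplement := by
    rintro ⟨n, hn⟩
    have h1 := congrArg Complex.im hn
    simp at h1
    exact absurd h1.symm hy
  have h1 := (summable_cotTerm hx).hasSum
  have h2 := cot_series_rep' hx
  have h3 : (∑' n, cotTerm ((y : ℂ) * Complex.I) n) =
      Real.pi * Complex.cot (Real.pi * (y * Complex.I)) - 1 / (y * Complex.I) := by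
    rw [h2]
  rw [h3] at h1
  have h4 := h1.mul_left Complex.I
  have hyc : (y : ℂ) ≠ 0 := by exact_mod_cast hy
  have hs : Real.sinh (Real.pi * y) ≠ 0 := by
    rw [Ne, Real.sinh_eq_zero]
    exact mul_ne_zero Real.pi_ne_zero hy
  have hval : Complex.I * (Real.pi * Complex.cot (Real.pi * (y * Complex.I))
      - 1 / (y * Complex.I)) = ((Real.pi * (Real.cosh (Real.pi * y) / Real.sinh (Real.pi * y))
        - 1 / y : ℝ) : ℂ) := by
    rw [Complex.cot_eq_cos_div_sin, ← mul_assoc, Complex.cos_mul_I, Complex.sin_mul_I]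
    have hs' : Complex.sinh (Real.pi * y) ≠ 0 := by exact_mod_cast hs
    push_cast
    field_simp
  rw [hval] at h4
  rw [← Complex.hasSum_ofReal]
  refine hasSum_of_eq (fun k => ?_) h4
  rw [cotTerm_identity hx]
  have h5 : ((y : ℂ) ^ 2 + (k + 1) ^ 2) ≠ 0 := by
    have : y ^ 2 + ((k : ℝ) + 1) ^ 2 ≠ 0 := by positivity
    exact_mod_cast this
  have h6 : ((y : ℂ) * Complex.I + (k + 1)) * (y * Complex.I - (k + 1)) =
      -((y : ℂ) ^ 2 + (k + 1) ^ 2) := by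
    linear_combination (y : ℂ) ^ 2 * Complex.I_sq
  rw [h6]
  push_cast
  field_simp
  linear_combination Complex.I_sq

lemma coth_two_mul_sub {u : ℝ} (hu : u ≠ 0) :
    Real.cosh (2 * u) / Real.sinh (2 * u) = (Real.cosh u / Real.sinh u + Real.tanh u) / 2 := by
  have hs : Real.sinh u ≠ 0 := by rwa [Ne, Real.sinh_eq_zero]
  have hc : Real.cosh u ≠ 0 := (Real.cosh_pos _).ne'
  rw [Real.sinh_two_mul, Real.cosh_two_mul, Real.tanh_eq_sinh_div_cosh]
  field_simp

lemma hasSum_coth_odd {y : ℝ} (hy0 : y ≠ 0) :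
    HasSum (fun k : ℕ => 2 * y / (y ^ 2 + (2 * k + 1) ^ 2))
      (Real.pi / 2 * Real.tanh (Real.pi * (y / 2))) := by
  have h1 := hasSum_coth hy0
  have h2 := (hasSum_coth (y := y / 2) (by positivity)).mul_left (1 / 2)
  have heven : HasSum (fun k : ℕ => 2 * y / (y ^ 2 + (((2 * k + 1 : ℕ) : ℝ) + 1) ^ 2))
      (1 / 2 * (Real.pi * (Real.cosh (Real.pi * (y / 2)) / Real.sinh (Real.pi * (y / 2)))
        - 1 / (y / 2))) := by
    refine hasSum_of_eq (fun k => ?_) h2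
    have h3 : y ^ 2 + ((2 * k + 1 : ℝ) + 1) ^ 2 = 4 * ((y / 2) ^ 2 + ((k : ℝ) + 1) ^ 2) := by ring
    have h4 : (y / 2) ^ 2 + ((k : ℝ) + 1) ^ 2 ≠ 0 := by positivity
    push_cast
    rw [h3]
    field_simp
    norm_num
  have hodd : Summable (fun k : ℕ => 2 * y / (y ^ 2 + (((2 * k : ℕ) : ℝ) + 1) ^ 2)) :=
    h1.summable.comp_injective (mul_right_injective₀ (two_ne_zero' ℕ))
  have h3 := (HasSum.even_add_odd (f := fun k : ℕ => 2 * y / (y ^ 2 + ((k : ℝ) + 1) ^ 2))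
    hodd.hasSum heven).unique h1
  have h4 := hodd.hasSum
  have h5 : Real.pi * y = 2 * (Real.pi * (y / 2)) := by ring
  have h6 := coth_two_mul_sub (u := Real.pi * (y / 2)) (by positivity)
  rw [eq_sub_of_add_eq h3, h5, h6] at h4
  have hval : Real.pi * ((Real.cosh (Real.pi * (y / 2)) / Real.sinh (Real.pi * (y / 2)) +
      Real.tanh (Real.pi * (y / 2))) / 2) - 1 / y - 1 / 2 * (Real.pi *
        (Real.cosh (Real.pi * (y / 2)) / Real.sinh (Real.pi * (y / 2))) - 1 / (y / 2)) =
      Real.pi / 2 * Real.tanh (Real.pi * (y / 2)) := by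
    generalize Real.cosh (Real.pi * (y / 2)) / Real.sinh (Real.pi * (y / 2)) = a
    generalize Real.tanh (Real.pi * (y / 2)) = b
    field_simp
    ring
  rw [hval] at h4
  exact hasSum_of_eq (fun k => by push_cast; ring) h4

/-- The Mittag-Leffler expansion of `tanh`. -/
lemma hasSum_tanh (ν : ℝ) :
    HasSum (fun k : ℕ => 2 * (ν / ((2 * Real.pi * (2 * k + 1)) ^ 2 + ν ^ 2)))
      (Real.tanh (ν / 4) / 4) := by
  rcases eq_or_ne ν 0 with rfl | hν
  · simp
  obtain ⟨y, rfl⟩ : ∃ y, ν = 2 * Real.pi * y :=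
    ⟨ν / (2 * Real.pi), by field_simp⟩
  have hy0 : y ≠ 0 := right_ne_zero_of_mul hν
  have h5 := (hasSum_coth_odd hy0).mul_left (1 / (2 * Real.pi))
  have hval : 1 / (2 * Real.pi) * (Real.pi / 2 * Real.tanh (Real.pi * (y / 2))) =
      Real.tanh (2 * Real.pi * y / 4) / 4 := by
    rw [show 2 * Real.pi * y / 4 = Real.pi * (y / 2) by ring]
    generalize Real.tanh (Real.pi * (y / 2)) = b
    field_simp
    ring
  rw [hval] at h5
  refine hasSum_of_eq (fun k => ?_) h5
  have h7 : y ^ 2 + ((2 * k : ℝ) + 1) ^ 2 ≠ 0 := by positivity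
  rw [show (2 * Real.pi * (2 * k + 1)) ^ 2 + (2 * Real.pi * y) ^ 2 =
    (2 * Real.pi) ^ 2 * (y ^ 2 + ((2 * k : ℝ) + 1) ^ 2) by ring]
  field_simp

lemma integral_sin_mul_exp (ν : ℝ) {c : ℝ} (hc : 0 < c) :
    ∫ t in Ioi (0 : ℝ), Real.sin (ν * t) * Real.exp (-(c * t)) = ν / (c ^ 2 + ν ^ 2) := by
  have ha : (-(c : ℂ) + ν * Complex.I).re < 0 := by simpa using hc
  have h1 := integral_exp_mul_complex_Ioi ha 0
  have h2 := integrableOn_exp_mul_complex_Ioi ha 0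
  have h3 := congrArg Complex.im h1
  have h4 : (∫ x : ℝ in Ioi 0, Complex.exp ((-(c : ℂ) + ν * Complex.I) * x)).im =
      ∫ x : ℝ in Ioi 0, (Complex.exp ((-(c : ℂ) + ν * Complex.I) * x)).im :=
    (integral_im h2).symm
  rw [h4] at h3
  have h5 (t : ℝ) : (Complex.exp ((-(c : ℂ) + ν * Complex.I) * t)).im =
      Real.sin (ν * t) * Real.exp (-(c * t)) := by
    rw [show (-(c : ℂ) + ν * Complex.I) * t = ((-(c * t) : ℝ) : ℂ) + ((ν * t : ℝ) : ℂ) * Complex.I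
      by push_cast; ring, Complex.exp_add_mul_I]
    simp [Complex.mul_im, ← Complex.ofReal_cos, ← Complex.ofReal_sin, ← Complex.ofReal_exp,
      -Complex.ofReal_neg, -Complex.ofReal_mul]
    ring
  simp only [h5] at h3
  rw [h3]
  simp [Complex.div_im, Complex.normSq_apply]
  field_simp

lemma integrableOn_mul_exp {c : ℝ} (hc : 0 < c) :
    IntegrableOn (fun t : ℝ => t * Real.exp (-(c * t))) (Ioi 0) := by
  have h := Real.integral_rpow_mul_exp_neg_mul_Ioi (a := 2) two_pos hc
  norm_num at h
  -- the integral would be zero if the integrand were not integrable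
  refine .of_integral_ne_zero ?_
  rw [h]
  positivity

lemma integral_mul_exp {c : ℝ} (hc : 0 < c) :
    ∫ t in Ioi (0 : ℝ), t * Real.exp (-(c * t)) = 1 / c ^ 2 := by
  have h := Real.integral_rpow_mul_exp_neg_mul_Ioi (a := 2) two_pos hc
  norm_num at h
  rw [h, one_div]

lemma hasSum_inv_sinh {x : ℝ} (hx : 0 < x) :
    HasSum (fun k : ℕ => 2 * Real.exp (-((2 * k + 1) * x))) (1 / Real.sinh x) := by
  have h1 : HasSum (fun k : ℕ => Real.exp (-(2 * x)) ^ k) (1 - Real.exp (-(2 * x)))⁻¹ :=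
    hasSum_geometric_of_lt_one (Real.exp_pos _).le (by rw [Real.exp_lt_one_iff]; linarith)
  have h2 := h1.mul_left (2 * Real.exp (-x))
  have h3 : 2 * Real.exp (-x) * (1 - Real.exp (-(2 * x)))⁻¹ = 1 / Real.sinh x := by
    have hs : 0 < Real.sinh x := Real.sinh_pos_iff.2 hx
    have h4 : Real.exp (-(2 * x)) = Real.exp (-x) * Real.exp (-x) := by
      rw [← Real.exp_add]; ring_nf
    have h5 : 1 - Real.exp (-(2 * x)) = 2 * Real.exp (-x) * Real.sinh x := by
      have h6 : Real.exp (-x) * Real.exp x = 1 := by rw [← Real.exp_add]; simp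
      rw [h4, Real.sinh_eq]
      linear_combination -h6
    rw [h5]
    have := Real.exp_pos (-x)
    field_simp
  rw [h3] at h2
  refine hasSum_of_eq (fun k => ?_) h2
  rw [← Real.exp_nat_mul, mul_assoc, ← Real.exp_add]
  ring_nf

/-- The Fourier sine transform of `1 / sinh (2πt)`. -/
theorem integral_sin_div_sinh (ν : ℝ) :
    ∫ t in Ioi (0 : ℝ), Real.sin (ν * t) / Real.sinh (2 * Real.pi * t) = Real.tanh (ν / 4) / 4 := by
  set F : ℕ → ℝ → ℝ := fun k t =>
    2 * (Real.sin (ν * t) * Real.exp (-((2 * Real.pi * (2 * k + 1)) * t))) with hF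
  have hc (k : ℕ) : 0 < 2 * Real.pi * (2 * k + 1) := by positivity
  have hbound (k : ℕ) (t : ℝ) (ht : t ∈ Ioi (0 : ℝ)) : ‖F k t‖ ≤
      2 * |ν| * (t * Real.exp (-((2 * Real.pi * (2 * k + 1)) * t))) := by
    have h1 : |Real.sin (ν * t)| ≤ |ν| * t := by
      have := Real.abs_sin_le_abs (x := ν * t)
      rwa [abs_mul, abs_of_pos (mem_Ioi.1 ht)] at this
    simp only [hF, norm_mul, Real.norm_eq_abs, Real.abs_exp, abs_two]
    have := Real.exp_pos (-((2 * Real.pi * (2 * k + 1)) * t))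
    nlinarith
  have hint (k : ℕ) : IntegrableOn (F k) (Ioi 0) := by
    refine Integrable.mono' ((integrableOn_mul_exp (hc k)).const_mul (2 * |ν|)) ?_ ?_
    · exact (by fun_prop : Continuous (F k)).aestronglyMeasurable
    · exact (ae_restrict_iff' measurableSet_Ioi).2 (ae_of_all _ (hbound k))
  have hsum : Summable fun k : ℕ => ∫ t in Ioi (0 : ℝ), ‖F k t‖ := by
    have h1 : Summable fun k : ℕ => 2 * |ν| * (1 / (2 * Real.pi * (2 * (k : ℝ) + 1)) ^ 2) := by
      have h2 : Summable fun k : ℕ => 1 / ((k + 1 : ℕ) : ℝ) ^ 2 :=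
        (summable_nat_add_iff 1).2 (Real.summable_one_div_nat_pow.2 one_lt_two)
      refine Summable.mul_left _ (Summable.of_nonneg_of_le (fun k => by positivity)
        (fun k => ?_) h2)
      apply one_div_le_one_div_of_le (by positivity)
      apply pow_le_pow_left₀ (by positivity)
      push_cast
      nlinarith [Real.pi_gt_three, (Nat.cast_nonneg k : (0 : ℝ) ≤ k)]
    refine Summable.of_nonneg_of_le (fun k => integral_nonneg fun t => norm_nonneg _)
      (fun k => ?_) h1
    rw [← integral_mul_exp (hc k), ← integral_const_mul]
    exact setIntegral_mono_on (hint k).norm ((integrableOn_mul_exp (hc k)).const_mul _)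
      measurableSet_Ioi (hbound k)
  have h1 := hasSum_integral_of_summable_integral_norm hint hsum
  have h2 : ∫ t in Ioi (0 : ℝ), ∑' k, F k t =
      ∫ t in Ioi (0 : ℝ), Real.sin (ν * t) / Real.sinh (2 * Real.pi * t) := by
    refine setIntegral_congr_fun measurableSet_Ioi fun t ht => ?_
    have h3 := (hasSum_inv_sinh (x := 2 * Real.pi * t)
      (mul_pos Real.two_pi_pos ht)).mul_left (Real.sin (ν * t))
    rw [mul_one_div] at h3
    rw [← h3.tsum_eq]
    congr 1
    funext k
    simp only [hF]
    ring_nf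
  have h3 (k : ℕ) : ∫ t in Ioi (0 : ℝ), F k t =
      2 * (ν / ((2 * Real.pi * (2 * k + 1)) ^ 2 + ν ^ 2)) := by
    rw [← integral_sin_mul_exp ν (hc k), ← integral_const_mul]
  simp only [h3, h2] at h1
  exact h1.unique (hasSum_tanh ν)

/-- The primitive `log (tanh (πt)) / (2π)` of `1 / sinh (2πt)`. -/
def primSinh (t : ℝ) : ℝ :=
  (Real.log (Real.sinh (Real.pi * t)) - Real.log (Real.cosh (Real.pi * t))) / (2 * Real.pi)

lemma hasDerivAt_primSinh {t : ℝ} (ht : 0 < t) :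
    HasDerivAt primSinh (1 / Real.sinh (2 * Real.pi * t)) t := by
  have hs : 0 < Real.sinh (Real.pi * t) := Real.sinh_pos_iff.2 (by positivity)
  have hc : 0 < Real.cosh (Real.pi * t) := Real.cosh_pos _
  have hm : HasDerivAt (fun t : ℝ => Real.pi * t) Real.pi t := by
    simpa using (hasDerivAt_id t).const_mul Real.pi
  have h1 := ((hm.sinh.log hs.ne').sub (hm.cosh.log hc.ne')).div_const (2 * Real.pi)
  convert! h1 using 1
  rw [mul_assoc, Real.sinh_two_mul]
  have := Real.cosh_sq (Real.pi * t)
  field_simp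
  linear_combination -this

lemma tendsto_primSinh : Tendsto primSinh atTop (𝓝 0) := by
  have h1 : Tendsto (fun x : ℝ => (Real.log (1 - Real.exp (-(2 * x)))
      - Real.log (1 + Real.exp (-(2 * x)))) / (2 * Real.pi)) atTop (𝓝 0) := by
    have h2 : Tendsto (fun x : ℝ => Real.exp (-(2 * x))) atTop (𝓝 0) :=
      Real.tendsto_exp_neg_atTop_nhds_zero.comp (tendsto_id.const_mul_atTop two_pos)
    have h3 := ((h2.const_sub 1).log (by norm_num)).sub ((h2.const_add 1).log (by norm_num))
    simpa using h3.div_const (2 * Real.pi)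
  have h2 := h1.comp (tendsto_id.const_mul_atTop Real.pi_pos)
  refine h2.congr' ?_
  filter_upwards [eventually_gt_atTop 0] with t ht
  have hx : 0 < Real.pi * t := by positivity
  have he : Real.exp (Real.pi * t) ≠ 0 := (Real.exp_pos _).ne'
  have hee : Real.exp (-(2 * (Real.pi * t))) = (Real.exp (Real.pi * t))⁻¹ ^ 2 := by
    rw [← Real.exp_neg, ← Real.exp_nat_mul]; push_cast; ring_nf
  have hlt : Real.exp (-(2 * (Real.pi * t))) < 1 := by rw [Real.exp_lt_one_iff]; linarith
  have h3 : Real.sinh (Real.pi * t) =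
      Real.exp (Real.pi * t) / 2 * (1 - Real.exp (-(2 * (Real.pi * t)))) := by
    rw [Real.sinh_eq, hee, Real.exp_neg]; field_simp
  have h4 : Real.cosh (Real.pi * t) =
      Real.exp (Real.pi * t) / 2 * (1 + Real.exp (-(2 * (Real.pi * t)))) := by
    rw [Real.cosh_eq, hee, Real.exp_neg]; field_simp
  simp only [Function.comp, id, primSinh]
  rw [h3, h4, Real.log_mul (by positivity) (by linarith), Real.log_mul (by positivity)
    (by positivity)]
  ring

lemma one_div_sinh_nonneg {t : ℝ} (ht : 0 ≤ t) : 0 ≤ 1 / Real.sinh (2 * Real.pi * t) :=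
  one_div_nonneg.2 (Real.sinh_nonneg_iff.2 (by positivity))

lemma integrableOn_one_div_sinh {η : ℝ} (hη : 0 < η) :
    IntegrableOn (fun t => 1 / Real.sinh (2 * Real.pi * t)) (Ioi η) :=
  integrableOn_Ioi_deriv_of_nonneg' (fun _ ht => hasDerivAt_primSinh (hη.trans_le ht))
    (fun _ ht => one_div_sinh_nonneg (hη.trans ht).le) tendsto_primSinh

lemma integral_one_div_sinh {η : ℝ} (hη : 0 < η) :
    ∫ t in Ioi η, 1 / Real.sinh (2 * Real.pi * t) =
      Real.log (Real.cosh (Real.pi * η) / Real.sinh (Real.pi * η)) / (2 * Real.pi) := by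
  rw [integral_Ioi_of_hasDerivAt_of_tendsto' (fun _ ht => hasDerivAt_primSinh (hη.trans_le ht))
    (integrableOn_one_div_sinh hη) tendsto_primSinh, primSinh,
    Real.log_div (Real.cosh_pos _).ne' (Real.sinh_pos_iff.2 (by positivity)).ne']
  ring

lemma coth_eq {y : ℝ} (hy : 0 < y) :
    Real.cosh y / Real.sinh y = 1 + 2 / (Real.exp (2 * y) - 1) := by
  have h1 : 1 < Real.exp (2 * y) := Real.one_lt_exp_iff.2 (by linarith)
  have hs : 0 < Real.sinh y := Real.sinh_pos_iff.2 hy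
  have he := Real.exp_pos y
  have h2 : Real.exp (2 * y) = Real.exp y ^ 2 := by rw [← Real.exp_nat_mul]; simp
  have h3 : Real.exp y ^ 2 - 1 ≠ 0 := by rw [← h2]; linarith
  have h4 : Real.sinh y = (Real.exp y ^ 2 - 1) / (2 * Real.exp y) := by
    rw [Real.sinh_eq, Real.exp_neg]; field_simp
  have h5 : Real.cosh y = (Real.exp y ^ 2 + 1) / (2 * Real.exp y) := by
    rw [Real.cosh_eq, Real.exp_neg]; field_simp
  rw [h2, h4, h5]
  field_simp
  ring

lemma integral_one_div_sinh_le {η : ℝ} (hη : 0 < η) :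
    ∫ t in Ioi η, 1 / Real.sinh (2 * Real.pi * t) ≤
      Real.log (1 + 1 / (Real.pi * η)) / (2 * Real.pi) := by
  have hy : 0 < Real.pi * η := by positivity
  rw [integral_one_div_sinh hη, coth_eq hy]
  have h1 : 2 * (Real.pi * η) ≤ Real.exp (2 * (Real.pi * η)) - 1 := by
    linarith [Real.add_one_le_exp (2 * (Real.pi * η))]
  have h2 : 2 / (Real.exp (2 * (Real.pi * η)) - 1) ≤ 1 / (Real.pi * η) := by
    rw [div_le_div_iff₀ (by linarith) hy]; linarith
  have h3 : 0 ≤ 2 / (Real.exp (2 * (Real.pi * η)) - 1) := div_nonneg (by norm_num) (by linarith)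
  gcongr

lemma integral_one_div_sinh_cutoff_le {ε : ℝ} (hε : 0 < ε) (hε2 : ε ≤ 1 / 2) :
    ∫ t in Ioi (cutoff ε), 1 / Real.sinh (2 * Real.pi * t) ≤ 2 * ε / (7 * Real.pi) := by
  have h4 : 1 < 4 / ε := by rw [lt_div_iff₀ hε]; linarith
  have hτ : 0 < cutoff ε := div_pos (Real.log_pos h4) Real.two_pi_pos
  have hy : 0 < Real.pi * cutoff ε := by positivity
  have h2 : 2 * (Real.pi * cutoff ε) = Real.log (4 / ε) := by
    rw [cutoff]; field_simp
  rw [integral_one_div_sinh hτ, coth_eq hy, h2, Real.exp_log (by linarith)]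
  have h5 : 0 ≤ 2 / (4 / ε - 1) := div_nonneg (by norm_num) (by linarith)
  have h6 := Real.log_le_sub_one_of_pos (by linarith : 0 < 1 + 2 / (4 / ε - 1))
  have h7 : 2 / (4 / ε - 1) ≤ 4 * ε / 7 := by
    rw [div_le_div_iff₀ (by linarith) (by norm_num), mul_sub, mul_assoc, mul_div_cancel₀ _ hε.ne']
    linarith
  rw [div_le_div_iff₀ Real.two_pi_pos (by positivity)]
  have := mul_le_mul_of_nonneg_right (h6.trans (by linarith : _ ≤ 4 * ε / 7)) Real.pi_pos.le
  linarith

end Tanh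

/-! ### Heisenberg evolution and the superoperators as time integrals -/

section Heisenberg

open MeasureTheory Set Filter Topology

variable {n : Type u} [Fintype n] [DecidableEq n] {H : Matrix n n ℂ}

/-- The unitary `exp (i t H)`. -/
def evol (H : Matrix n n ℂ) (t : ℝ) : Matrix n n ℂ := NormedSpace.exp ((Complex.I * (t : ℂ)) • H)

lemma heis_eq (H : Matrix n n ℂ) (t : ℝ) (A : Matrix n n ℂ) :
    heis H t A = evol H t * A * evol H (-t) := by
  simp only [heis, evol, ← neg_smul, Complex.ofReal_neg, mul_neg]

lemma evol_eq_exp (H : Matrix n n ℂ) (t : ℝ) :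
    evol H t = NormedSpace.exp (t • (Complex.I • H)) := by
  rw [evol, mul_comm, mul_smul]; rfl

lemma evol_add (H : Matrix n n ℂ) (s t : ℝ) : evol H (s + t) = evol H s * evol H t := by
  rw [evol_eq_exp, evol_eq_exp, evol_eq_exp, add_smul]
  exact Matrix.exp_add_of_commute _ _ (((Commute.refl _).smul_left _).smul_right _)

lemma evol_zero (H : Matrix n n ℂ) : evol H 0 = 1 := by
  rw [evol_eq_exp, zero_smul, NormedSpace.exp_zero]

lemma evol_mul_evol_neg (H : Matrix n n ℂ) (t : ℝ) : evol H t * evol H (-t) = 1 := by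
  rw [← evol_add, add_neg_cancel, evol_zero]

lemma evol_neg_mul_evol (H : Matrix n n ℂ) (t : ℝ) : evol H (-t) * evol H t = 1 := by
  rw [← evol_add, neg_add_cancel, evol_zero]

lemma star_evol (hH : H.IsHermitian) (t : ℝ) : star (evol H t) = evol H (-t) := by
  rw [evol, evol, NormedSpace.star_exp, star_smul, hH.isSelfAdjoint.star_eq]
  simp

lemma evol_mem_unitary (hH : H.IsHermitian) (t : ℝ) : evol H t ∈ unitary (Matrix n n ℂ) := by
  rw [Unitary.mem_iff, star_evol hH]
  exact ⟨evol_neg_mul_evol H t, evol_mul_evol_neg H t⟩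

lemma norm_evol_mul (hH : H.IsHermitian) (t : ℝ) (A : Matrix n n ℂ) : ‖evol H t * A‖ = ‖A‖ :=
  CStarRing.norm_mem_unitary_mul A (evol_mem_unitary hH t)

lemma norm_mul_evol (hH : H.IsHermitian) (t : ℝ) (A : Matrix n n ℂ) : ‖A * evol H t‖ = ‖A‖ :=
  CStarRing.norm_mul_mem_unitary A (evol_mem_unitary hH t)

lemma norm_heis (hH : H.IsHermitian) (t : ℝ) (A : Matrix n n ℂ) : ‖heis H t A‖ = ‖A‖ := by
  rw [heis_eq, norm_mul_evol hH, norm_evol_mul hH]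

lemma heis_zero (H A : Matrix n n ℂ) : heis H 0 A = A := by
  rw [heis_eq, neg_zero, evol_zero, one_mul, mul_one]

lemma heis_add_time (H : Matrix n n ℂ) (s t : ℝ) (A : Matrix n n ℂ) :
    heis H (s + t) A = heis H s (heis H t A) := by
  rw [heis_eq, heis_eq, heis_eq, evol_add, show -(s + t) = -t + -s by ring, evol_add]
  noncomm_ring

lemma heis_mul (H : Matrix n n ℂ) (t : ℝ) (A B : Matrix n n ℂ) :
    heis H t (A * B) = heis H t A * heis H t B := by
  rw [heis_eq, heis_eq, heis_eq]
  calc _ = evol H t * A * 1 * B * evol H (-t) := by noncomm_ring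
    _ = _ := by rw [← evol_neg_mul_evol H t]; noncomm_ring

lemma heis_one (H : Matrix n n ℂ) (t : ℝ) : heis H t 1 = 1 := by
  rw [heis_eq, mul_one, evol_mul_evol_neg]

/-- Heisenberg evolution by time `t`, as a linear map. -/
def heisLin (H : Matrix n n ℂ) (t : ℝ) : Matrix n n ℂ →ₗ[ℂ] Matrix n n ℂ where
  toFun := heis H t
  map_add' A B := by simp only [heis_eq]; noncomm_ring
  map_smul' c A := by simp [heis_eq]

lemma heisLin_apply (H : Matrix n n ℂ) (t : ℝ) (A : Matrix n n ℂ) :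
    heisLin H t A = heis H t A := rfl

lemma hasDerivAt_evol (H : Matrix n n ℂ) (t : ℝ) :
    HasDerivAt (evol H) (Complex.I • (H * evol H t)) t := by
  have := hasDerivAt_exp_smul_const' (𝕂 := ℝ) (Complex.I • H) t
  rw [← evol_eq_exp, Matrix.smul_mul] at this
  exact this.congr_of_eventuallyEq (Eventually.of_forall fun s => evol_eq_exp H s)

lemma commute_evol (H : Matrix n n ℂ) (t : ℝ) : H * evol H t = evol H t * H := by
  have : Commute H (t • (Complex.I • H)) := ((Commute.refl H).smul_right _).smul_right _
  rw [evol_eq_exp]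
  exact this.exp_right

lemma hasDerivAt_heis (H : Matrix n n ℂ) (A : Matrix n n ℂ) (t : ℝ) :
    HasDerivAt (fun t => heis H t A) (Complex.I • (H * heis H t A - heis H t A * H)) t := by
  have h1 := hasDerivAt_evol H t
  have h2 : HasDerivAt (fun t => evol H (-t)) (-(Complex.I • (H * evol H (-t)))) t := by
    exact ((hasDerivAt_evol H (-t)).scomp t (hasDerivAt_neg t)).congr_deriv (neg_one_smul _ _)
  have h3 := (h1.mul_const A).mul h2
  refine (h3.congr_of_eventuallyEq (Eventually.of_forall fun s => heis_eq H s A)).congr_deriv ?_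
  rw [heis_eq, commute_evol H (-t)]
  simp only [Matrix.smul_mul, Matrix.mul_smul, mul_neg, smul_sub, mul_assoc]
  abel

lemma continuous_heis (H A : Matrix n n ℂ) : Continuous fun t => heis H t A :=
  continuous_iff_continuousAt.2 fun t => (hasDerivAt_heis H A t).continuousAt

lemma norm_commutator_le (A B : Matrix n n ℂ) : ‖A * B - B * A‖ ≤ 2 * ‖A‖ * ‖B‖ := by
  have h1 := norm_mul_le A B
  have h2 := norm_mul_le B A
  have h3 := norm_sub_le (A * B) (B * A)
  nlinarith

lemma norm_heis_sub_heis_neg_le (hH : H.IsHermitian) {t : ℝ} (ht : 0 ≤ t) (A : Matrix n n ℂ) :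
    ‖heis H t A - heis H (-t) A‖ ≤ 4 * t * ‖H‖ * ‖A‖ := by
  have h := Convex.norm_image_sub_le_of_norm_hasDerivWithin_le (s := univ) (x := -t) (y := t)
    (C := 2 * ‖H‖ * ‖A‖)
    (fun x _ => (hasDerivAt_heis H A x).hasDerivWithinAt) (fun x _ => ?_) convex_univ
    (mem_univ _) (mem_univ _)
  · refine h.trans (le_of_eq ?_)
    rw [Real.norm_eq_abs, show t - -t = 2 * t by ring, abs_of_nonneg (by positivity)]
    ring
  · rw [norm_smul, Complex.norm_I, one_mul]
    refine (norm_commutator_le _ _).trans ?_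
    rw [norm_heis hH]

lemma mult_eq_sum (hH : H.IsHermitian) (m : ℝ → ℂ) (A : Matrix n n ℂ) :
    mult hH m A = ∑ i, ∑ j, m (hH.eigenvalues i - hH.eigenvalues j) •
      ((hH.eigenvectorUnitary : Matrix n n ℂ) * Matrix.single i j
        ((star (hH.eigenvectorUnitary : Matrix n n ℂ) * A *
          (hH.eigenvectorUnitary : Matrix n n ℂ)) i j) *
        star (hH.eigenvectorUnitary : Matrix n n ℂ)) := by
  have h (c : ℂ) (B : Matrix n n ℂ) : c • ((hH.eigenvectorUnitary : Matrix n n ℂ) * B *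
      star (hH.eigenvectorUnitary : Matrix n n ℂ)) = (hH.eigenvectorUnitary : Matrix n n ℂ) *
      (c • B) * star (hH.eigenvectorUnitary : Matrix n n ℂ) := by
    rw [← Matrix.smul_mul, ← Matrix.mul_smul]
  simp only [h, ← Finset.sum_mul, ← Finset.mul_sum, Matrix.smul_single, smul_eq_mul]
  rw [mult]
  congr 2
  exact Matrix.matrix_eq_sum_single _

lemma integrable_mult (hH : H.IsHermitian) {X : Type*} [MeasurableSpace X] {μ : Measure X}
    {m : X → ℝ → ℂ} (hm : ∀ ν, Integrable (fun t => m t ν) μ) (A : Matrix n n ℂ) :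
    Integrable (fun t => mult hH (m t) A) μ := by
  simp only [mult_eq_sum]
  exact integrable_finsetSum _ fun i _ => integrable_finsetSum _ fun j _ =>
    (hm _).smul_const _

lemma integral_mult (hH : H.IsHermitian) {X : Type*} [MeasurableSpace X] {μ : Measure X}
    {m : X → ℝ → ℂ} (hm : ∀ ν, Integrable (fun t => m t ν) μ) (A : Matrix n n ℂ) :
    ∫ t, mult hH (m t) A ∂μ = mult hH (fun ν => ∫ t, m t ν ∂μ) A := by
  simp only [mult_eq_sum]
  rw [integral_finsetSum _ fun i _ => integrable_finsetSum _ fun j _ => (hm _).smul_const _]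
  refine Finset.sum_congr rfl fun i _ => ?_
  rw [integral_finsetSum _ fun j _ => (hm _).smul_const _]
  exact Finset.sum_congr rfl fun j _ => integral_smul_const _ _

/-- The integrand of `𝒮[A] = ∫ (-i / sinh (2πt)) (A(t) - A(-t)) dt` over `t > 0`. -/
def sinhKernel (H : Matrix n n ℂ) (A : Matrix n n ℂ) (t : ℝ) : Matrix n n ℂ :=
  (-Complex.I * ((1 / Real.sinh (2 * Real.pi * t) : ℝ) : ℂ)) • (heis H t A - heis H (-t) A)

lemma sinhKernel_eq_mult (hH : H.IsHermitian) (A : Matrix n n ℂ) (t : ℝ) :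
    sinhKernel H A t =
      mult hH (fun ν => ((2 * (Real.sin (ν * t) / Real.sinh (2 * Real.pi * t)) : ℝ) : ℂ)) A := by
  have h1 : heis H t A - heis H (-t) A = mult hH (fun ν => Complex.exp (Complex.I * t * ν) +
      (-1) * Complex.exp (Complex.I * (-t : ℝ) * ν)) A := by
    rw [mult_add_symbol, mult_smul_symbol, heis_eq_mult hH, heis_eq_mult hH, neg_one_smul,
      sub_eq_add_neg]
  rw [sinhKernel, h1, ← mult_smul_symbol]
  congr 1
  funext ν
  have h2 : Complex.exp (Complex.I * t * ν) + (-1) * Complex.exp (Complex.I * (-t : ℝ) * ν) =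
      2 * Complex.I * (Real.sin (ν * t) : ℂ) := by
    rw [Complex.ofReal_sin, Complex.sin]
    push_cast
    rw [show Complex.I * t * ν = ν * t * Complex.I by ring,
      show Complex.I * -(t : ℂ) * ν = -(ν * t) * Complex.I by ring]
    linear_combination (Complex.exp (ν * t * Complex.I) - Complex.exp (-(ν * t) * Complex.I)) *
      Complex.I_sq
  rw [h2]
  push_cast
  linear_combination (-2 * Complex.sin (ν * t) / Complex.sinh (2 * Real.pi * t)) * Complex.I_sq

lemma integrableOn_sin_div_sinh (ν : ℝ) :
    IntegrableOn (fun t => Real.sin (ν * t) / Real.sinh (2 * Real.pi * t)) (Ioi 0) := by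
  rcases eq_or_ne ν 0 with rfl | hν
  · simp
  -- the integral would be zero if the integrand were not integrable
  · refine .of_integral_ne_zero ?_
    rw [integral_sin_div_sinh, Real.tanh_eq_sinh_div_cosh]
    have h1 : Real.sinh (ν / 4) ≠ 0 := by rw [Ne, Real.sinh_eq_zero]; positivity
    have h2 : Real.cosh (ν / 4) ≠ 0 := (Real.cosh_pos _).ne'
    positivity

lemma integrableOn_sinhKernel (hH : H.IsHermitian) (A : Matrix n n ℂ) :
    IntegrableOn (sinhKernel H A) (Ioi 0) := by
  rw [IntegrableOn, show sinhKernel H A = fun t => _ from funext (sinhKernel_eq_mult hH A)]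
  exact integrable_mult hH (fun ν => ((integrableOn_sin_div_sinh ν).const_mul 2).ofReal) A

/-- The superoperator `𝒮` is a time average of the Heisenberg evolution. -/
theorem opS_eq_integral (hH : H.IsHermitian) (A : Matrix n n ℂ) :
    opS hH A = ∫ t in Ioi (0 : ℝ), sinhKernel H A t := by
  simp only [sinhKernel_eq_mult hH]
  refine .trans ?_ (integral_mult hH (m := fun t ν =>
    ((2 * (Real.sin (ν * t) / Real.sinh (2 * Real.pi * t)) : ℝ) : ℂ))
    (fun ν => ((integrableOn_sin_div_sinh ν).const_mul 2).ofReal) A).symm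
  rw [opS_eq_mult]
  congr 1
  funext ν
  rw [integral_complex_ofReal, integral_const_mul, integral_sin_div_sinh]
  congr 1
  ring

lemma norm_sinhKernel_le (hH : H.IsHermitian) (A : Matrix n n ℂ) {t : ℝ} (ht : 0 < t) :
    ‖sinhKernel H A t‖ ≤ 2 * ‖H‖ / Real.pi * ‖A‖ ∧
      ‖sinhKernel H A t‖ ≤ 2 * ‖A‖ * (1 / Real.sinh (2 * Real.pi * t)) := by
  have hx : 0 < 2 * Real.pi * t := by positivity
  have hs : 0 < Real.sinh (2 * Real.pi * t) := Real.sinh_pos_iff.2 hx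
  have h0 : ‖sinhKernel H A t‖ =
      1 / Real.sinh (2 * Real.pi * t) * ‖heis H t A - heis H (-t) A‖ := by
    rw [sinhKernel, norm_smul, norm_mul, norm_neg, Complex.norm_I, one_mul, Complex.norm_real,
      Real.norm_of_nonneg (by positivity)]
  constructor
  · have h1 : 2 * Real.pi * t ≤ Real.sinh (2 * Real.pi * t) := Real.self_le_sinh_iff.2 hx.le
    rw [h0]
    calc _ ≤ 1 / (2 * Real.pi * t) * (4 * t * ‖H‖ * ‖A‖) := by
          gcongr
          exact norm_heis_sub_heis_neg_le hH ht.le A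
      _ = _ := by field_simp; norm_num
  · have h1 := norm_sub_le (heis H t A) (heis H (-t) A)
    rw [norm_heis hH, norm_heis hH] at h1
    rw [h0, mul_comm]
    gcongr
    linarith

/-- Over times that are either short or long the integral representing `𝒮[A]` is small. -/
lemma norm_setIntegral_sinhKernel_le (hH : H.IsHermitian) (A : Matrix n n ℂ) {B : Set ℝ}
    (hB : MeasurableSet B) {η τ : ℝ} (hη : 0 ≤ η) (hτ : 0 < τ) (hsub : B ⊆ Ioc 0 η ∪ Ioi τ) :
    ‖∫ t in B, sinhKernel H A t‖ ≤
      (2 * ‖H‖ / Real.pi * η + 2 * ∫ t in Ioi τ, 1 / Real.sinh (2 * Real.pi * t)) * ‖A‖ := by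
  set b : ℝ → ℝ := fun t => (Ioc 0 η).indicator (fun _ => 2 * ‖H‖ / Real.pi * ‖A‖) t +
    (Ioi τ).indicator (fun t => 2 * ‖A‖ * (1 / Real.sinh (2 * Real.pi * t))) t with hb
  have hi1 : Integrable ((Ioc 0 η).indicator (fun _ => 2 * ‖H‖ / Real.pi * ‖A‖)) :=
    (integrable_indicator_iff measurableSet_Ioc).2 (integrableOn_const (by simp))
  have hi2 : Integrable
      ((Ioi τ).indicator (fun t => 2 * ‖A‖ * (1 / Real.sinh (2 * Real.pi * t)))) :=
    (integrable_indicator_iff measurableSet_Ioi).2 ((integrableOn_one_div_sinh hτ).const_mul _)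
  have hbi : Integrable b := hi1.add hi2
  have hb1 (t : ℝ) : 0 ≤ (Ioc 0 η).indicator (fun _ => 2 * ‖H‖ / Real.pi * ‖A‖) t :=
    indicator_nonneg (fun _ _ => by positivity) t
  have hb2 (t : ℝ) : 0 ≤
      (Ioi τ).indicator (fun t => 2 * ‖A‖ * (1 / Real.sinh (2 * Real.pi * t))) t :=
    indicator_nonneg (fun t ht => mul_nonneg (by positivity)
      (one_div_sinh_nonneg (hτ.trans ht).le)) t
  have hle (t : ℝ) (ht : t ∈ B) : ‖sinhKernel H A t‖ ≤ b t := by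
    rcases hsub ht with h | h
    · refine ((norm_sinhKernel_le hH A h.1).1).trans ?_
      have := hb2 t
      simp only [hb]
      rw [indicator_of_mem h]
      linarith
    · refine ((norm_sinhKernel_le hH A (hτ.trans h)).2).trans ?_
      have := hb1 t
      simp only [hb]
      rw [indicator_of_mem h]
      linarith
  calc ‖∫ t in B, sinhKernel H A t‖ ≤ ∫ t in B, b t :=
        norm_integral_le_of_norm_le hbi.integrableOn
          ((ae_restrict_iff' hB).2 (ae_of_all _ hle))
    _ ≤ ∫ t, b t := setIntegral_le_integral hbi (ae_of_all _ fun t => add_nonneg (hb1 t) (hb2 t))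
    _ = _ := by
        simp only [hb]
        rw [integral_add hi1 hi2, integral_indicator measurableSet_Ioc,
          integral_indicator measurableSet_Ioi, setIntegral_const, integral_const_mul,
          Real.volume_real_Ioc_of_le hη, smul_eq_mul]
        ring

/-- The superoperators `𝒮^±` are bounded by the logarithm of `‖H‖`. -/
theorem superopNormLE_opSpm (hH : H.IsHermitian) (b : Bool) :
    SuperopNormLE (opSpm hH b) (1 + 1 / Real.pi * Real.log (1 + ‖H‖ / 2)) := by
  intro A
  have hπ := Real.pi_gt_three
  have hS : ‖opS hH A‖ ≤ (1 / 2 + 1 / Real.pi * Real.log (1 + ‖H‖ / 2)) * ‖A‖ := by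
    rw [opS_eq_integral]
    rcases (norm_nonneg H).eq_or_lt with h0 | h0
    · have h1 : ∀ t, sinhKernel H A t = 0 := fun t => by
        have : H = 0 := norm_eq_zero.1 h0.symm
        simp [sinhKernel, this, heis]
      simp only [h1]
      simp [← h0]
    · have hη : 0 < 2 / (Real.pi * ‖H‖) := by positivity
      refine (norm_setIntegral_sinhKernel_le hH A measurableSet_Ioi hη.le hη ?_).trans ?_
      · rw [Ioc_union_Ioi_eq_Ioi hη.le]
      · refine mul_le_mul_of_nonneg_right ?_ (norm_nonneg _)
        have h1 := integral_one_div_sinh_le hη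
        have h2 : 1 / (Real.pi * (2 / (Real.pi * ‖H‖))) = ‖H‖ / 2 := by field_simp
        rw [h2] at h1
        have h3 : 2 * ‖H‖ / Real.pi * (2 / (Real.pi * ‖H‖)) ≤ 1 / 2 := by
          rw [show 2 * ‖H‖ / Real.pi * (2 / (Real.pi * ‖H‖)) = 4 / Real.pi ^ 2 by
              field_simp; norm_num,
            div_le_div_iff₀ (by positivity) (by norm_num)]
          nlinarith
        have h4 : 2 * (Real.log (1 + ‖H‖ / 2) / (2 * Real.pi)) =
            1 / Real.pi * Real.log (1 + ‖H‖ / 2) := by field_simp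
        linarith
  have h1 : ‖opSpm hH b A‖ ≤ 1 / 2 * ‖A‖ + ‖opS hH A‖ := by
    refine (norm_add_le _ _).trans (add_le_add ?_ ?_)
    · rw [norm_smul]; norm_num
    · rw [norm_smul]; cases b <;> simp [sgn]
  linarith

end Heisenberg

/-! ### Integration against complex measures -/

section ComplexIntegral

set_option linter.unusedSectionVars false

open MeasureTheory Set Filter Topology

instance isFiniteMeasure_variation {X : Type*} [MeasurableSpace X] (F : ComplexMeasure X) :
    IsFiniteMeasure F.variation := by
  refine isFiniteMeasure_of_le
    ((ComplexMeasure.re F).totalVariation + (ComplexMeasure.im F).totalVariation)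
    (VectorMeasure.variation_le_of_forall_enorm_le fun s hs => ?_)
  have h1 : ‖F s‖ₑ ≤ ‖(F s).re‖ₑ + ‖(F s).im‖ₑ := by
    have h : ‖F s‖₊ ≤ ‖(F s).re‖₊ + ‖(F s).im‖₊ := by
      rw [← NNReal.coe_le_coe]
      push_cast
      exact Complex.norm_le_abs_re_add_abs_im (F s)
    simpa only [enorm_eq_nnnorm, ← ENNReal.coe_add, ENNReal.coe_le_coe] using h
  exact h1.trans (add_le_add (SignedMeasure.enorm_le_totalVariation (ComplexMeasure.re F) s)
    (SignedMeasure.enorm_le_totalVariation (ComplexMeasure.im F) s))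

variable {X Y E E' : Type*} [MeasurableSpace X] [MeasurableSpace Y] [NormedAddCommGroup E]
  [NormedSpace ℂ E] [NormedAddCommGroup E'] [NormedSpace ℂ E']

/-- Bounded strongly measurable functions: the class on which `cintegral` is used. -/
def BddMeas (φ : X → E) : Prop := StronglyMeasurable φ ∧ ∃ C, ∀ x, ‖φ x‖ ≤ C

lemma BddMeas.add {φ ψ : X → E} (hφ : BddMeas φ) (hψ : BddMeas ψ) :
    BddMeas fun x => φ x + ψ x := by
  obtain ⟨h1, C, hC⟩ := hφ
  obtain ⟨h2, D, hD⟩ := hψ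
  exact ⟨h1.add h2, C + D, fun x => (norm_add_le _ _).trans (add_le_add (hC x) (hD x))⟩

lemma BddMeas.clm_comp (L : E →L[ℂ] E') {φ : X → E} (hφ : BddMeas φ) :
    BddMeas fun x => L (φ x) := by
  obtain ⟨h1, C, hC⟩ := hφ
  refine ⟨L.continuous.comp_stronglyMeasurable h1, ‖L‖ * C, fun x => (L.le_opNorm _).trans ?_⟩
  gcongr
  exact hC x

lemma BddMeas.comp {φ : X → E} (hφ : BddMeas φ) {g : Y → X} (hg : Measurable g) :
    BddMeas fun y => φ (g y) := by
  obtain ⟨h1, C, hC⟩ := hφ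
  exact ⟨h1.comp_measurable hg, C, fun x => hC _⟩

lemma BddMeas.integrable {φ : X → E} (hφ : BddMeas φ) (μ : Measure X) [IsFiniteMeasure μ] :
    Integrable φ μ := by
  obtain ⟨h1, C, hC⟩ := hφ
  exact .of_bound h1.aestronglyMeasurable C (ae_of_all _ hC)

lemma BddMeas.indicator_const (c : E) {s : Set X} (hs : MeasurableSet s) :
    BddMeas (s.indicator fun _ => c) := by
  refine ⟨stronglyMeasurable_const.indicator hs, ‖c‖, fun x => ?_⟩
  rw [norm_indicator_eq_indicator_norm]
  exact indicator_le_self' (fun _ _ => norm_nonneg _) x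

/-- Bounded strongly measurable functions are generated by indicators under sums and bounded
pointwise limits of sequences. -/
theorem BddMeas.induction {P : (X → E) → Prop}
    (ind : ∀ (c : E) (s : Set X), MeasurableSet s → P (s.indicator fun _ => c))
    (add : ∀ f g : X → E, BddMeas f → BddMeas g → P f → P g → P fun x => f x + g x)
    (lim : ∀ (fs : ℕ → X → E) (f : X → E) (C : ℝ), (∀ n, StronglyMeasurable (fs n)) →
      (∀ n x, ‖fs n x‖ ≤ C) → BddMeas f → (∀ x, Tendsto (fun n => fs n x) atTop (𝓝 (f x))) →
      (∀ n, P (fs n)) → P f) {f : X → E} (hf : BddMeas f) : P f := by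
  classical
  let : NormedSpace ℝ E := NormedSpace.complexToReal
  obtain ⟨hm, C, hC⟩ := hf
  have hs (g : SimpleFunc X E) : P g := by
    refine SimpleFunc.induction (fun c s hs => ?_) (fun f g _ hf hg => ?_) g
    · have := ind c s hs
      rwa [SimpleFunc.coe_piecewise, SimpleFunc.coe_const, SimpleFunc.coe_const,
        show Function.const X (0 : E) = 0 from rfl, piecewise_eq_indicator]
    · exact add f g ⟨f.stronglyMeasurable, f.exists_forall_norm_le⟩
        ⟨g.stronglyMeasurable, g.exists_forall_norm_le⟩ hf hg
  by_cases hne : Nonempty X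
  · have hC0 : 0 ≤ C := (norm_nonneg _).trans (hC hne.some)
    exact lim (fun n => hm.approxBounded C n) f C
      (fun n => (hm.approxBounded C n).stronglyMeasurable)
      (fun n x => hm.norm_approxBounded_le hC0 n x) ⟨hm, C, hC⟩
      (fun x => hm.tendsto_approxBounded_of_norm_le (hC x)) fun n => hs _
  · rw [not_nonempty_iff] at hne
    rw [show f = (∅ : Set X).indicator fun _ => 0 from Subsingleton.elim _ _]
    exact ind _ _ .empty

section

variable {F G : ComplexMeasure X} {φ ψ : X → E}

lemma cintegral_add (hφ : BddMeas φ) (hψ : BddMeas ψ) :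
    cintegral F (fun x => φ x + ψ x) = cintegral F φ + cintegral F ψ :=
  VectorMeasure.integral_fun_add (hφ.integrable _) (hψ.integrable _)

lemma cintegral_indicator_const [CompleteSpace E] (c : E) {s : Set X} (hs : MeasurableSet s) :
    cintegral F (s.indicator fun _ => c) = F s • c := by
  rw [cintegral, VectorMeasure.integral_indicator_const _ hs]
  rfl

lemma cintegral_tendsto {fs : ℕ → X → E} {C : ℝ} (hm : ∀ n, StronglyMeasurable (fs n))
    (hC : ∀ n x, ‖fs n x‖ ≤ C) (hlim : ∀ x, Tendsto (fun n => fs n x) atTop (𝓝 (φ x))) :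
    Tendsto (fun n => cintegral F (fs n)) atTop (𝓝 (cintegral F φ)) :=
  VectorMeasure.tendsto_integral_of_dominated_convergence (fun _ => C)
    (fun n => (hm n).aestronglyMeasurable) (integrable_const _) (fun n => ae_of_all _ (hC n))
    (ae_of_all _ hlim)

lemma norm_cintegral_le {C : ℝ} (hC : ∀ x, ‖φ x‖ ≤ C) :
    ‖cintegral F φ‖ ≤ C * (l1norm F).toReal := by
  rcases isEmpty_or_nonempty X with hX | ⟨⟨x⟩⟩
  · rw [cintegral, VectorMeasure.integral_of_isEmpty, l1norm, univ_eq_empty_iff.2 hX]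
    simp
  · have hC0 : 0 ≤ C := (norm_nonneg _).trans (hC x)
    refine (VectorMeasure.norm_integral_le_of_norm_le_const (ae_of_all _ hC)).trans ?_
    rw [l1norm]
    refine mul_le_mul_of_nonneg_right (mul_le_of_le_one_right hC0 ?_) ENNReal.toReal_nonneg
    rw [ContinuousLinearMap.opNorm_flip]
    exact ContinuousLinearMap.opNorm_lsmul_le

lemma cintegral_sub_measure (hφ : BddMeas φ) :
    cintegral (F - G) φ = cintegral F φ - cintegral G φ :=
  VectorMeasure.integral_sub_vectorMeasure (hφ.integrable _) (hφ.integrable _)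

lemma cintegral_sum_measure {ι : Type*} (s : Finset ι) (F : ι → ComplexMeasure X)
    (hφ : BddMeas φ) : cintegral (∑ i ∈ s, F i) φ = ∑ i ∈ s, cintegral (F i) φ :=
  VectorMeasure.integral_finsetSum_vectorMeasure fun _ _ => hφ.integrable _

lemma cintegral_map {g : X → Y} (hg : Measurable g) {φ : Y → E} (hφ : BddMeas φ) :
    cintegral (F.map g) φ = cintegral F fun x => φ (g x) :=
  VectorMeasure.integral_map hg hφ.1.aestronglyMeasurable ((hφ.comp hg).integrable _)

lemma cintegral_dirac [MeasurableSingletonClass X] [CompleteSpace E] (a : X) (c : ℂ) :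
    cintegral (VectorMeasure.dirac a c) φ = c • φ a := by
  rw [cintegral, VectorMeasure.integral_dirac]
  rfl

lemma clm_cintegral [CompleteSpace E] [CompleteSpace E'] (L : E →L[ℂ] E') (hφ : BddMeas φ) :
    L (cintegral F φ) = cintegral F fun x => L (φ x) := by
  refine BddMeas.induction (P := fun φ => L (cintegral F φ) = cintegral F fun x => L (φ x))
    (fun c s hs => ?_) (fun f g hf hg h1 h2 => ?_) (fun fs f C hm hC hf hl h => ?_) hφ
  · have : (fun x => L (s.indicator (fun _ => c) x)) = s.indicator fun _ => L c := by
      ext x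
      by_cases hx : x ∈ s <;> simp [hx]
    rw [this, cintegral_indicator_const c hs, cintegral_indicator_const _ hs, map_smul]
  · simp only [map_add]
    rw [cintegral_add hf hg, cintegral_add (hf.clm_comp L) (hg.clm_comp L), map_add, h1, h2]
  · refine tendsto_nhds_unique ((L.continuous.tendsto _).comp (cintegral_tendsto hm hC hl)) ?_
    have := cintegral_tendsto (F := F) (fs := fun n x => L (fs n x)) (C := ‖L‖ * C)
      (φ := fun x => L (f x))
      (fun n => L.continuous.comp_stronglyMeasurable (hm n))
      (fun n x => (L.le_opNorm _).trans (by gcongr; exact hC n x))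
      (fun x => (L.continuous.tendsto _).comp (hl x))
    exact this.congr fun n => (h n).symm

lemma cintegral_withDensityᵥ [CompleteSpace E] {μ : Measure X} {g : X → ℂ}
    (hg : Integrable g μ) (hφ : BddMeas φ) :
    cintegral (μ.withDensityᵥ g) φ = ∫ x, g x • φ x ∂μ := by
  refine BddMeas.induction (P := fun φ => cintegral (μ.withDensityᵥ g) φ = ∫ x, g x • φ x ∂μ)
    (fun c s hs => ?_) (fun f k hf hk h1 h2 => ?_) (fun fs f C hm hC hf hl h => ?_) hφ
  · rw [cintegral_indicator_const c hs, withDensityᵥ_apply hg hs, ← integral_smul_const,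
      ← integral_indicator hs]
    congr 1
    ext x
    by_cases hx : x ∈ s <;> simp [hx]
  · have hi {f : X → E} (hf : BddMeas f) : Integrable (fun x => g x • f x) μ := by
      obtain ⟨h1, C, hC⟩ := hf
      refine (hg.norm.mul_const C).mono' (hg.aestronglyMeasurable.smul h1.aestronglyMeasurable)
        (ae_of_all _ fun x => ?_)
      rw [norm_smul]
      gcongr
      exact hC x
    rw [cintegral_add hf hk, h1, h2, ← integral_add (hi hf) (hi hk)]
    simp only [smul_add]
  · refine tendsto_nhds_unique (cintegral_tendsto hm hC hl) ?_
    simp only [h]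
    refine tendsto_integral_of_dominated_convergence (fun x => ‖g x‖ * C)
      (fun n => hg.aestronglyMeasurable.smul (hm n).aestronglyMeasurable) (hg.norm.mul_const C)
      (fun n => ae_of_all _ fun x => ?_) (ae_of_all _ fun x => (hl x).const_smul _)
    rw [norm_smul]
    gcongr
    exact hC n x

/-- Fubini's theorem for the product of two complex measures. -/
lemma cintegral_prod [CompleteSpace E] (G : ComplexMeasure Y) {φ : X × Y → E}
    (hφ : BddMeas φ) :
    (BddMeas fun x => cintegral G fun y => φ (x, y)) ∧
      cintegral (F.prod G (ContinuousLinearMap.mul ℝ ℂ)) φ =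
        cintegral F fun x => cintegral G fun y => φ (x, y) := by
  refine BddMeas.induction (P := fun φ => (BddMeas fun x => cintegral G fun y => φ (x, y)) ∧
      cintegral (F.prod G (ContinuousLinearMap.mul ℝ ℂ)) φ =
        cintegral F fun x => cintegral G fun y => φ (x, y))
    (fun c s hs => ?_) (fun f k hf hk h1 h2 => ?_) (fun fs f C hm hC hf hl h => ?_) hφ
  · have h1 : (fun x => cintegral G fun y => s.indicator (fun _ => c) (x, y)) =
        fun x => G (Prod.mk x ⁻¹' s) • c := by
      funext x
      exact cintegral_indicator_const c (hs.preimage measurable_prodMk_left)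
    have h2 : BddMeas fun x => G (Prod.mk x ⁻¹' s) :=
      ⟨VectorMeasure.stronglyMeasurable_vectorMeasure_prodMk_left hs, G.bound,
        fun x => VectorMeasure.norm_apply_le_bound⟩
    have h3 := h2.clm_comp ((ContinuousLinearMap.id ℂ ℂ).smulRight c)
    refine ⟨by rw [h1]; exact h3, ?_⟩
    rw [h1, cintegral_indicator_const c hs, VectorMeasure.prod_apply_eq_integral hs]
    have h4 := clm_cintegral (F := F) ((ContinuousLinearMap.id ℂ ℂ).smulRight c) h2
    refine .trans ?_ h4
    simp only [ContinuousLinearMap.smulRight_apply, ContinuousLinearMap.coe_id', id_eq]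
    congr 2
  · have h3 (x : X) : (cintegral G fun y => f (x, y) + k (x, y)) =
        (cintegral G fun y => f (x, y)) + cintegral G fun y => k (x, y) :=
      cintegral_add (hf.comp measurable_prodMk_left) (hk.comp measurable_prodMk_left)
    simp only [h3]
    exact ⟨h1.1.add h2.1, by rw [cintegral_add hf hk, cintegral_add h1.1 h2.1, h1.2, h2.2]⟩
  · have h1 (x : X) : Tendsto (fun n => cintegral G fun y => fs n (x, y)) atTop
        (𝓝 (cintegral G fun y => f (x, y))) :=
      cintegral_tendsto (fun n => (hm n).comp_measurable measurable_prodMk_left)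
        (fun n y => hC n _) fun y => hl _
    have h2 (n : ℕ) (x : X) : ‖cintegral G fun y => fs n (x, y)‖ ≤ C * (l1norm G).toReal :=
      norm_cintegral_le fun y => hC n _
    have h3 : BddMeas fun x => cintegral G fun y => f (x, y) :=
      ⟨stronglyMeasurable_of_tendsto _ (fun n => (h n).1.1) (tendsto_pi_nhds.2 h1),
        C * (l1norm G).toReal, fun x => le_of_tendsto (h1 x).norm
          (Eventually.of_forall fun n => h2 n x)⟩
    refine ⟨h3, tendsto_nhds_unique (cintegral_tendsto hm hC hl) ?_⟩
    exact (cintegral_tendsto (fun n => (h n).1.1) h2 h1).congr fun n => (h n).2.symm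

end

end ComplexIntegral

/-! ### The iterated kernels -/

section KernelRecursion

open MeasureTheory Set Filter Topology
open Finset.HasAntidiagonal (antidiagonal)

lemma coeffA_one : coeffA 1 = 1 / 2 := by
  rw [coeffA, Ring.choose_one_right]
  norm_num

/-- Comparing coefficients in `(1 - ∑ a_k x^k)² = 1 - x`. -/
lemma coeffA_add_two (k : ℕ) :
    coeffA (k + 2) = 1 / 2 * ∑ p ∈ antidiagonal k, coeffA (p.1 + 1) * coeffA (p.2 + 1) := by
  have h := Ring.add_choose_eq (r := (1 / 2 : ℝ)) (s := 1 / 2) (k + 2) (Commute.all _ _)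
  have h1 : Ring.choose ((1 : ℝ) / 2 + 1 / 2) (k + 2) = 0 := by
    rw [show (1 : ℝ) / 2 + 1 / 2 = ((1 : ℕ) : ℝ) by norm_num, Ring.choose_natCast,
      Nat.choose_eq_zero_of_lt (by omega), Nat.cast_zero]
  rw [h1, Finset.Nat.sum_antidiagonal_succ, Finset.Nat.sum_antidiagonal_succ'] at h
  have h2 : ∑ p ∈ antidiagonal k, coeffA (p.1 + 1) * coeffA (p.2 + 1) = (-1) ^ k *
      ∑ p ∈ antidiagonal k,
        Ring.choose (1 / 2 : ℝ) (p.1 + 1) * Ring.choose (1 / 2 : ℝ) (p.2 + 1) := by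
    rw [Finset.mul_sum]
    refine Finset.sum_congr rfl fun p hp => ?_
    rw [← Finset.HasAntidiagonal.mem_antidiagonal.1 hp, coeffA, coeffA]
    have h3 : ((-1 : ℝ)) ^ (p.1 + 1 + 1) = (-1) ^ p.1 := by rw [pow_add, pow_add]; norm_num
    have h4 : ((-1 : ℝ)) ^ (p.2 + 1 + 1) = (-1) ^ p.2 := by rw [pow_add, pow_add]; norm_num
    rw [h3, h4, pow_add]
    ring
  rw [h2, coeffA]
  simp only [Ring.choose_zero_right, one_mul, mul_one] at h
  rw [pow_add, pow_add]
  have h5 : ((-1 : ℝ) ^ k) * (2 * Ring.choose (1 / 2 : ℝ) (k + 2) + ∑ p ∈ antidiagonal k,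
      Ring.choose (1 / 2 : ℝ) (p.1 + 1) * Ring.choose (1 / 2 : ℝ) (p.2 + 1)) = 0 := by
    rw [show 2 * Ring.choose (1 / 2 : ℝ) (k + 2) + ∑ p ∈ antidiagonal k,
      Ring.choose (1 / 2 : ℝ) (p.1 + 1) * Ring.choose (1 / 2 : ℝ) (p.2 + 1) = 0 by linarith,
      mul_zero]
  linarith

lemma coeffA_nonneg (k : ℕ) : 0 ≤ coeffA (k + 1) := by
  induction k using Nat.strong_induction_on with
  | _ k ih =>
    rcases k with _ | k
    · rw [zero_add, coeffA_one]; norm_num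
    · rw [coeffA_add_two]
      refine mul_nonneg (by norm_num) (Finset.sum_nonneg fun p hp => ?_)
      have := Finset.HasAntidiagonal.mem_antidiagonal.1 hp
      exact mul_nonneg (ih _ (by omega)) (ih _ (by omega))

lemma sum_coeffA_le_one (K : ℕ) : ∑ k ∈ Finset.range K, coeffA (k + 1) ≤ 1 :=
  sum_range_le_of_convolution coeffA_nonneg (coeffA_one.le) (fun k => (coeffA_add_two k).le)
    (by norm_num) zero_le_one (by norm_num) K

lemma measurable_shift {k p q : ℕ} (hk : k = p + q) :
    Measurable fun (w : ℝ × (Fin p → ℝ) × (Fin q → ℝ)) (i : Fin k) =>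
      Fin.append w.2.1 w.2.2 (Fin.cast hk i) + w.1 := by
  subst hk
  refine measurable_pi_lambda _ fun i => ?_
  simp only [Fin.cast_eq_self]
  refine Measurable.add ?_ measurable_fst
  induction i using Fin.addCases with
  | left i => simp only [Fin.append_left]; fun_prop
  | right i => simp only [Fin.append_right]; fun_prop

lemma enorm_mul_le_one : ‖ContinuousLinearMap.mul ℝ ℂ‖ₑ ≤ 1 := by
  rw [← ofReal_norm, ← ENNReal.ofReal_one]
  exact ENNReal.ofReal_le_ofReal (ContinuousLinearMap.opNorm_mul_le ℝ ℂ)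

lemma variation_prod_mul_le {X Y : Type*} [MeasurableSpace X] [MeasurableSpace Y]
    (F : ComplexMeasure X) (G : ComplexMeasure Y) :
    (F.prod G (ContinuousLinearMap.mul ℝ ℂ)).variation ≤ F.variation.prod G.variation := by
  refine VectorMeasure.variation_prod_le.trans fun s => ?_
  rw [Measure.smul_apply, smul_eq_mul]
  exact mul_le_of_le_one_left zero_le enorm_mul_le_one

lemma l1norm_prod_le {X Y : Type*} [MeasurableSpace X] [MeasurableSpace Y]
    (F : ComplexMeasure X) (G : ComplexMeasure Y) :
    l1norm (F.prod G (ContinuousLinearMap.mul ℝ ℂ)) ≤ l1norm F * l1norm G := by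
  refine (variation_prod_mul_le F G _).trans ?_
  rw [← univ_prod_univ, Measure.prod_prod]
  rfl

lemma l1norm_map_le {X Y : Type*} [MeasurableSpace X] [MeasurableSpace Y]
    (F : ComplexMeasure X) {g : X → Y} (hg : Measurable g) : l1norm (F.map g) ≤ l1norm F := by
  refine (VectorMeasure.variation_map_le _).trans ?_
  rw [Measure.map_apply hg .univ]
  rfl

lemma l1norm_sum_le {X ι : Type*} [MeasurableSpace X] (s : Finset ι) (F : ι → ComplexMeasure X) :
    l1norm (∑ i ∈ s, F i) ≤ ∑ i ∈ s, l1norm (F i) := by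
  refine (VectorMeasure.variation_finsetSum_le _ _ _).trans ?_
  rw [Measure.finsetSum_apply]
  rfl

lemma l1norm_shiftConv_le {k p q : ℕ} (hk : k = p + q) (f : ComplexMeasure ℝ)
    (g : ComplexMeasure (Fin p → ℝ)) (h : ComplexMeasure (Fin q → ℝ)) :
    l1norm (shiftConv hk f g h) ≤ l1norm f * (l1norm g * l1norm h) :=
  (l1norm_map_le _ (measurable_shift hk)).trans ((l1norm_prod_le _ _).trans
    (mul_le_mul_right (l1norm_prod_le _ _) _))

/-- The variation norms obey the recursion of the coefficients `a_k`, because shifts and products do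
not increase the variation. -/
theorem l1norm_kernel_le {f : Bool → ComplexMeasure ℝ}
    (hf : ∀ b, l1norm (f b) ≤ ENNReal.ofReal (1 / 2)) (k : ℕ) (b : Bool) :
    l1norm (kernel f (k + 1) b) ≤ ENNReal.ofReal (coeffA (k + 1)) := by
  induction k using Nat.strong_induction_on generalizing b with
  | _ k ih =>
    rcases k with _ | k
    · rw [kernel, coeffA_one]
      exact (l1norm_map_le _ (by fun_prop)).trans (hf b)
    · rw [kernel, coeffA_add_two, Finset.Nat.sum_antidiagonal_eq_sum_range_succ
        (fun i j => coeffA (i + 1) * coeffA (j + 1)) k, ← Fin.sum_univ_eq_sum_range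
        (fun i => coeffA (i + 1) * coeffA (k - i + 1)), Finset.mul_sum,
        ENNReal.ofReal_sum_of_nonneg fun i _ =>
          mul_nonneg (by norm_num) (mul_nonneg (coeffA_nonneg _) (coeffA_nonneg _))]
      refine (l1norm_sum_le _ _).trans (Finset.sum_le_sum fun p _ => ?_)
      refine (l1norm_shiftConv_le _ _ _ _).trans ?_
      rw [ENNReal.ofReal_mul (by norm_num), ENNReal.ofReal_mul (coeffA_nonneg _)]
      have h2 (q : ℕ) (hq : q = k - p + 1) :
          l1norm (kernel f q false) ≤ ENNReal.ofReal (coeffA (k - p + 1)) := by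
        subst hq
        exact ih _ (by omega) _
      exact mul_le_mul' (hf b) (mul_le_mul' (ih _ (by omega) _) (h2 _ (by omega)))

/-- The hypothesis `hd` only has to hold for `0 ≤ a`, because for `a < 0` the measure `f` vanishes.
-/
lemma ae_shiftConv {k p q : ℕ} (hk : k = p + q) {f : ComplexMeasure ℝ}
    {g : ComplexMeasure (Fin p → ℝ)} {h : ComplexMeasure (Fin q → ℝ)} {a b c d : ℝ}
    (hf : ∀ᵐ t ∂f.variation, |t| ≤ a) (hg : ∀ᵐ t ∂g.variation, ∀ i, |t i| ≤ b)
    (hh : ∀ᵐ t ∂h.variation, ∀ i, |t i| ≤ c) (hd : 0 ≤ a → b + a ≤ d ∧ c + a ≤ d) :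
    ∀ᵐ t ∂(shiftConv hk f g h).variation, ∀ i, |t i| ≤ d := by
  have hms : MeasurableSet {t : Fin k → ℝ | ∀ i, |t i| ≤ d} := by
    rw [Set.ofPred_forall]
    exact .iInter fun i => measurableSet_le (by fun_prop) measurable_const
  refine (Measure.absolutelyContinuous_of_le VectorMeasure.variation_map_le).ae_le ?_
  refine (ae_map_iff (measurable_shift hk).aemeasurable hms).2 ?_
  have h1 : (f.prod (g.prod h (ContinuousLinearMap.mul ℝ ℂ))
      (ContinuousLinearMap.mul ℝ ℂ)).variation ≪
      f.variation.prod (g.prod h (ContinuousLinearMap.mul ℝ ℂ)).variation :=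
    Measure.absolutelyContinuous_of_le (variation_prod_mul_le _ _)
  have h2 : (g.prod h (ContinuousLinearMap.mul ℝ ℂ)).variation ≪ g.variation.prod h.variation :=
    Measure.absolutelyContinuous_of_le (variation_prod_mul_le _ _)
  refine h1.ae_le ?_
  have h3 := Measure.quasiMeasurePreserving_fst (μ := f.variation)
    (ν := (g.prod h (ContinuousLinearMap.mul ℝ ℂ)).variation) |>.ae hf
  have h4 := Measure.quasiMeasurePreserving_snd (μ := f.variation)
    (ν := (g.prod h (ContinuousLinearMap.mul ℝ ℂ)).variation) |>.ae
    (h2.ae_le (Measure.quasiMeasurePreserving_fst.ae hg))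
  have h5 := Measure.quasiMeasurePreserving_snd (μ := f.variation)
    (ν := (g.prod h (ContinuousLinearMap.mul ℝ ℂ)).variation) |>.ae
    (h2.ae_le (Measure.quasiMeasurePreserving_snd.ae hh))
  filter_upwards [h3, h4, h5] with w w1 w2 w3 i
  have hd' := hd ((abs_nonneg _).trans w1)
  refine (abs_add_le _ _).trans ?_
  induction Fin.cast hk i using Fin.addCases with
  | left i => rw [Fin.append_left]; linarith [w2 i]
  | right i => rw [Fin.append_right]; linarith [w3 i]

lemma ae_variation_sum {X ι : Type*} [MeasurableSpace X] (s : Finset ι)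
    {F : ι → ComplexMeasure X} {P : X → Prop} (h : ∀ i ∈ s, ∀ᵐ x ∂(F i).variation, P x) :
    ∀ᵐ x ∂(∑ i ∈ s, F i).variation, P x := by
  refine (Measure.absolutelyContinuous_of_le (VectorMeasure.variation_finsetSum_le _ _)).ae_le ?_
  change (∑ i ∈ s, (F i).variation) {x | P x}ᶜ = 0
  rw [Measure.finsetSum_apply]
  exact Finset.sum_eq_zero h

lemma ae_kernel {f : Bool → ComplexMeasure ℝ} {r : ℝ}
    (hf : ∀ b, ∀ᵐ t ∂(f b).variation, |t| ≤ r) (k : ℕ) (b : Bool) :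
    ∀ᵐ t ∂(kernel f (k + 1) b).variation, ∀ i, |t i| ≤ (k + 1 : ℕ) * r := by
  induction k using Nat.strong_induction_on generalizing b with
  | _ k ih =>
    rcases k with _ | k
    · rw [kernel]
      refine (Measure.absolutelyContinuous_of_le VectorMeasure.variation_map_le).ae_le ?_
      refine ae_map_iff (by fun_prop) ?_ |>.2 ?_
      · rw [Set.ofPred_forall]
        exact .iInter fun i => measurableSet_le (by fun_prop) measurable_const
      · filter_upwards [hf b] with t ht i
        simpa using ht
    · rw [kernel]
      refine ae_variation_sum _ fun p _ => ?_
      have h2 (q : ℕ) (hq : q = k - p + 1) :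
          ∀ᵐ t ∂(kernel f q false).variation, ∀ i, |t i| ≤ (k - p + 1 : ℕ) * r := by
        subst hq
        exact ih _ (by omega) _
      refine ae_shiftConv _ (hf b) (ih _ (by omega) _) (h2 _ (by omega)) fun hr => ?_
      have h3 : (p : ℕ) ≤ k := by omega
      have h4 : ((k - p : ℕ) : ℝ) ≤ k := by exact_mod_cast Nat.sub_le _ _
      have h5 : ((p : ℕ) : ℝ) ≤ k := by exact_mod_cast h3
      push_cast
      constructor <;> nlinarith

lemma ae_mem_supp {X : Type*} [MeasurableSpace X] [TopologicalSpace X]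
    [HereditarilyLindelofSpace X] (F : ComplexMeasure X) : ∀ᵐ x ∂F.variation, x ∈ supp F :=
  Measure.support_mem_ae

lemma supp_kernel_subset_of_supp_subset_Icc {f : Bool → ComplexMeasure ℝ} {r : ℝ}
    (hf : ∀ b, supp (f b) ⊆ Icc (-r) r) (k : ℕ) (b : Bool) :
    supp (kernel f (k + 1) b) ⊆
      univ.pi fun _ => Icc (-((k + 1 : ℕ) * r)) ((k + 1 : ℕ) * r) := by
  refine Measure.support_subset_of_isClosed (isClosed_set_pi fun _ _ => isClosed_Icc) ?_
  filter_upwards [ae_kernel (r := r) (fun b => (ae_mem_supp (f b)).mono fun t ht =>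
    abs_le.2 (hf b ht)) k b] with t ht i _
  exact abs_le.1 (ht i)

/-- A closed subset of a symmetric interval `I` lies in a symmetric closed interval contained in
`I`, unless it is unbounded, in which case `I = ℝ`. -/
lemma exists_Icc_of_isClosed {I K : Set ℝ} (hI : I.OrdConnected) (hs : ∀ t ∈ I, -t ∈ I)
    (hK : IsClosed K) (hKI : K ⊆ I) :
    I = univ ∨ ∃ r, K ⊆ Icc (-r) r ∧ Icc (-r) r ⊆ I := by
  by_cases hb : Bornology.IsBounded K
  · right
    rcases K.eq_empty_or_nonempty with rfl | hne
    · exact ⟨-1, empty_subset _, by simp⟩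
    · obtain ⟨t, ht, hmax⟩ := (Metric.isCompact_of_isClosed_isBounded hK hb).exists_isMaxOn hne
        (f := fun t => |t|) (by fun_prop)
      have h1 : |t| ∈ I := by
        rcases abs_choice t with h | h <;> rw [h]
        exacts [hKI ht, hs _ (hKI ht)]
      exact ⟨|t|, fun x hx => abs_le.1 (hmax hx), hI.out (hs _ h1) h1⟩
  · left
    refine eq_univ_of_forall fun x => ?_
    have h1 : ∃ t ∈ K, |x| < |t| := by
      by_contra! h
      exact hb (isBounded_iff_forall_norm_le.2 ⟨|x|, h⟩)
    obtain ⟨t, ht, hxt⟩ := h1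
    have h2 : |t| ∈ I := by
      rcases abs_choice t with h | h <;> rw [h]
      exacts [hKI ht, hs _ (hKI ht)]
    exact hI.out (hs _ h2) h2 (abs_le.1 hxt.le)

/-- The interval `I` need not be closed; the closed supports allow its replacement by a closed
interval inside `I`. -/
theorem supp_kernel_subset {f : Bool → ComplexMeasure ℝ} {I : Set ℝ} (hI : I.OrdConnected)
    (hs : ∀ t ∈ I, -t ∈ I) (hf : ∀ b, supp (f b) ⊆ I) (k : ℕ) (b : Bool) :
    supp (kernel f (k + 1) b) ⊆ univ.pi fun _ => (fun t => ((k + 1 : ℕ) : ℝ) * t) '' I := by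
  have hk : (0 : ℝ) < (k + 1 : ℕ) := by positivity
  obtain rfl | ⟨r, h1, h2⟩ := exists_Icc_of_isClosed hI hs
    (isClosed_iUnion_of_finite fun b => Measure.isClosed_support (μ := (f b).variation))
    (iUnion_subset hf)
  · exact fun w _ i _ => ⟨w i / (k + 1 : ℕ), mem_univ _, by field_simp⟩
  · refine (supp_kernel_subset_of_supp_subset_Icc (fun b => (subset_iUnion _ b).trans h1) k
      b).trans (pi_mono fun _ _ x hx => ⟨x / (k + 1 : ℕ), h2 ⟨?_, ?_⟩, by field_simp⟩)
    · rw [le_div_iff₀ hk]; linarith [hx.1]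
    · rw [div_le_iff₀ hk]; linarith [hx.2]

end KernelRecursion

/-! ### Integrals of products of evolved operators -/

section HeisIntegral

open MeasureTheory Set Filter Topology
open Finset.HasAntidiagonal (antidiagonal)

variable {n : Type u} [Fintype n] [DecidableEq n] {H : Matrix n n ℂ}

lemma norm_prod_ofFn_le {k : ℕ} {g : Fin k → Matrix n n ℂ} {c : ℝ} (hg : ∀ i, ‖g i‖ ≤ c) :
    ‖(List.ofFn g).prod‖ ≤ ‖(1 : Matrix n n ℂ)‖ * c ^ k := by
  induction k with
  | zero => simp
  | succ k ih =>
    rw [List.ofFn_succ, List.prod_cons, pow_succ]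
    calc _ ≤ ‖g 0‖ * ‖(List.ofFn fun i => g (Fin.succ i)).prod‖ := norm_mul_le _ _
      _ ≤ c * (‖(1 : Matrix n n ℂ)‖ * c ^ k) :=
          mul_le_mul (hg 0) (ih fun i => hg _) (norm_nonneg _) ((norm_nonneg _).trans (hg 0))
      _ = _ := by ring

lemma continuous_prod_heis (H A : Matrix n n ℂ) (k : ℕ) :
    Continuous fun t : Fin k → ℝ => (List.ofFn fun i => heis H (t i) A).prod := by
  induction k with
  | zero => simp only [List.ofFn_zero]; exact continuous_const
  | succ k ih =>
    simp only [List.ofFn_succ, List.prod_cons]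
    exact ((continuous_heis H A).comp (continuous_apply _)).mul
      (ih.comp (continuous_pi fun i => continuous_apply _))

lemma norm_prod_heis_le (hH : H.IsHermitian) (A : Matrix n n ℂ) {k : ℕ} (t : Fin k → ℝ) :
    ‖(List.ofFn fun i => heis H (t i) A).prod‖ ≤ ‖(1 : Matrix n n ℂ)‖ * ‖A‖ ^ k :=
  norm_prod_ofFn_le fun _ => (norm_heis hH _ _).le

lemma bddMeas_prod_heis (hH : H.IsHermitian) (A : Matrix n n ℂ) (k : ℕ) :
    BddMeas fun t : Fin k → ℝ => (List.ofFn fun i => heis H (t i) A).prod :=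
  ⟨(continuous_prod_heis H A k).stronglyMeasurable, _, norm_prod_heis_le hH A⟩

lemma bddMeas_heis (hH : H.IsHermitian) (A : Matrix n n ℂ) : BddMeas fun t => heis H t A :=
  ⟨(continuous_heis H A).stronglyMeasurable, ‖A‖, fun t => (norm_heis hH t A).le⟩

lemma heis_list_prod (t : ℝ) (l : List (Matrix n n ℂ)) :
    heis H t l.prod = (l.map (heis H t)).prod := by
  induction l with
  | nil => simp [heis_one]
  | cons a l ih => rw [List.prod_cons, heis_mul, ih, List.map_cons, List.prod_cons]

lemma prod_heis_append {k p q : ℕ} (hk : k = p + q) (A : Matrix n n ℂ) (t : ℝ)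
    (v : Fin p → ℝ) (w : Fin q → ℝ) :
    (List.ofFn fun i : Fin k => heis H (Fin.append v w (Fin.cast hk i) + t) A).prod =
      heis H t ((List.ofFn fun i => heis H (v i) A).prod *
        (List.ofFn fun i => heis H (w i) A).prod) := by
  subst hk
  rw [← List.prod_append, ← List.ofFn_fin_append, heis_list_prod, List.map_ofFn]
  congr 2
  funext i
  rw [Fin.cast_eq_self, Function.comp_apply, add_comm, heis_add_time]
  congr 1
  induction i using Fin.addCases with
  | left i => simp only [Fin.append_left]
  | right i => simp only [Fin.append_right]

/-- Left multiplication, right multiplication and Heisenberg evolution as continuous maps. -/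
def heisMulCLM (H : Matrix n n ℂ) (t : ℝ) (B C : Matrix n n ℂ) :
    Matrix n n ℂ →L[ℂ] Matrix n n ℂ :=
  LinearMap.toContinuousLinearMap
    (heisLin H t ∘ₗ LinearMap.mulLeft ℂ B ∘ₗ LinearMap.mulRight ℂ C)

lemma heisMulCLM_apply (H : Matrix n n ℂ) (t : ℝ) (B C A : Matrix n n ℂ) :
    heisMulCLM H t B C A = heis H t (B * (A * C)) := rfl

lemma heisIntegral_shiftConv (hH : H.IsHermitian) {k p q : ℕ} (hk : k = p + q)
    (f : ComplexMeasure ℝ) (g : ComplexMeasure (Fin p → ℝ)) (h : ComplexMeasure (Fin q → ℝ))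
    (A : Matrix n n ℂ) :
    heisIntegral H (shiftConv hk f g h) A =
      heisAverage H f (heisIntegral H g A * heisIntegral H h A) := by
  have hb := (bddMeas_prod_heis hH A k).comp (measurable_shift hk)
  rw [heisIntegral, shiftConv, cintegral_map (measurable_shift hk) (bddMeas_prod_heis hH A k),
    (cintegral_prod _ hb).2, heisAverage]
  congr 1
  funext t
  rw [(cintegral_prod h (hb.comp measurable_prodMk_left)).2]
  simp only [prod_heis_append hk]
  have h1 (v : Fin p → ℝ) : (cintegral h fun w => heis H t
      ((List.ofFn fun i => heis H (v i) A).prod * (List.ofFn fun i => heis H (w i) A).prod)) =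
      heis H t ((List.ofFn fun i => heis H (v i) A).prod * heisIntegral H h A) := by
    have := clm_cintegral (F := h) (heisMulCLM H t (List.ofFn fun i => heis H (v i) A).prod 1)
      (bddMeas_prod_heis hH A q)
    simp only [heisMulCLM_apply, mul_one] at this
    exact this.symm
  simp only [h1]
  have := clm_cintegral (F := g) (heisMulCLM H t 1 (heisIntegral H h A))
    (bddMeas_prod_heis hH A p)
  simp only [heisMulCLM_apply, one_mul] at this
  exact this.symm

lemma heisAverage_add (hH : H.IsHermitian) (f : ComplexMeasure ℝ) (A B : Matrix n n ℂ) :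
    heisAverage H f (A + B) = heisAverage H f A + heisAverage H f B := by
  rw [heisAverage, heisAverage, heisAverage,
    ← cintegral_add (bddMeas_heis hH A) (bddMeas_heis hH B)]
  simp only [← heisLin_apply, map_add]

lemma heisAverage_smul (hH : H.IsHermitian) (f : ComplexMeasure ℝ) (c : ℂ) (A : Matrix n n ℂ) :
    heisAverage H f (c • A) = c • heisAverage H f A := by
  have := clm_cintegral (F := f) (c • ContinuousLinearMap.id ℂ (Matrix n n ℂ)) (bddMeas_heis hH A)
  simp only [_root_.smul_apply, ContinuousLinearMap.id_apply] at this
  rw [heisAverage, heisAverage, this]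
  simp only [← heisLin_apply, map_smul]

/-- Averaging the Heisenberg evolution against a complex measure, as a linear map. -/
def heisAverageLin (hH : H.IsHermitian) (f : ComplexMeasure ℝ) :
    Matrix n n ℂ →ₗ[ℂ] Matrix n n ℂ where
  toFun := heisAverage H f
  map_add' := heisAverage_add hH f
  map_smul' := heisAverage_smul hH f

/-- Fubini's theorem turns the recursion of the kernels into that of `∇^(k)`, with the
superoperators replaced by time averages. -/
theorem heisIntegral_kernel (hH : H.IsHermitian) (f : Bool → ComplexMeasure ℝ)
    (A : Matrix n n ℂ) (k : ℕ) (b : Bool) :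
    heisIntegral H (kernel f (k + 1) b) A = heisAverage H (f b)
      (nabla (heisAverage H (f true)) (heisAverage H (f false)) A (k + 1)) := by
  induction k using Nat.strong_induction_on generalizing b with
  | _ k ih =>
    rcases k with _ | k
    · rw [zero_add, nabla_one, kernel, heisIntegral, cintegral_map (by fun_prop)
        (bddMeas_prod_heis hH A 1), heisAverage]
      simp
    · rw [nabla, kernel, heisIntegral, cintegral_sum_measure _ _ (bddMeas_prod_heis hH A _)]
      have h1 : heisAverage H (f b) = heisAverageLin hH (f b) := rfl
      rw [h1, map_sum, ← h1]
      refine Finset.sum_congr rfl fun p _ => ?_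
      have h2 (q : ℕ) (hq : q = k - p + 1) : heisIntegral H (kernel f q false) A =
          heisAverage H (f false)
            (nabla (heisAverage H (f true)) (heisAverage H (f false)) A q) := by
        subst hq
        exact ih _ (by omega) _
      have h3 := heisIntegral_shiftConv hH (show k + 2 = (p + 1) + (k + 1 - p) by omega) (f b)
        (kernel f (p + 1) true) (kernel f (k + 1 - p) false) A
      rw [ih _ (by omega), h2 _ (by omega)] at h3
      exact h3

omit [DecidableEq n] in
lemma nabla_sq_smul (Sp Sm : Matrix n n ℂ →ₗ[ℂ] Matrix n n ℂ) (s : ℂ) (A : Matrix n n ℂ) (k : ℕ) :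
    nabla Sp Sm (s ^ 2 • A) (k + 1) = s ^ 2 • nabla ⇑(s • Sp) ⇑(s • Sm) A (k + 1) := by
  induction k using Nat.strong_induction_on with
  | _ k ih =>
    rcases k with _ | k
    · rw [zero_add, nabla_one, nabla_one]
    · rw [nabla_add_two, nabla_add_two, Finset.smul_sum]
      refine Finset.sum_congr rfl fun p hp => ?_
      have := Finset.HasAntidiagonal.mem_antidiagonal.1 hp
      rw [ih p.1 (by omega), ih p.2 (by omega)]
      simp only [map_smul, LinearMap.smul_apply, Matrix.smul_mul, Matrix.mul_smul, smul_smul]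
      congr 1
      ring

/-- The iterated integrals are the terms `S^-[∇^(k)[O]]` for the averaged superoperators. -/
lemma smul_sum_heisIntegral (hH : H.IsHermitian) (f : Bool → ComplexMeasure ℝ) {s : ℝ}
    (hs : s ≠ 0) (A : Matrix n n ℂ) (K : ℕ) :
    (1 / s) • ∑ k ∈ Finset.Icc 1 K, heisIntegral H (kernel f k false) (s ^ 2 • A) =
      ∑ k ∈ Finset.Icc 1 K, ((s : ℂ) • heisAverageLin hH (f false))
        (nabla ⇑((s : ℂ) • heisAverageLin hH (f true)) ⇑((s : ℂ) • heisAverageLin hH (f false))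
          A k) := by
  rw [Finset.smul_sum]
  refine Finset.sum_congr rfl fun k hk => ?_
  obtain ⟨k, rfl⟩ := Nat.exists_eq_add_of_le' (Finset.mem_Icc.1 hk).1
  rw [heisIntegral_kernel hH]
  have h := nabla_sq_smul (heisAverageLin hH (f true)) (heisAverageLin hH (f false)) s A k
  have h1 : (s ^ 2) • A = (s : ℂ) ^ 2 • A := by
    rw [← Complex.ofReal_pow, Complex.coe_smul]
  rw [h1]
  change (1 / s) • heisAverageLin hH (f false) (nabla (heisAverageLin hH (f true))
    (heisAverageLin hH (f false)) ((s : ℂ) ^ 2 • A) (k + 1)) = _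
  rw [h, map_smul, ← Complex.coe_smul, smul_smul, LinearMap.smul_apply]
  congr 1
  push_cast
  have : (s : ℂ) ≠ 0 := by exact_mod_cast hs
  field_simp

/-- The iterated integrals of the kernels generated by an approximate integral representation of
the superoperators approximate the Kraus operator. -/
theorem norm_krausOp_sub_one_add_sum_heisIntegral_le (hH : H.IsHermitian) {O O' : Matrix n n ℂ}
    (hO : O.IsHermitian) (f : Bool → ComplexMeasure ℝ) {ε s s' : ℝ} (hε : 0 < ε)
    (hε2 : ε ≤ 1 / 2) (hs' : 1 + 1 / Real.pi * Real.log (1 + ‖H‖ / 2) ≤ s') (hs : s ≠ 0)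
    (hf : ∀ b, SuperopNormLE (fun A => opSpm hH b A - s • heisAverage H (f b) A) (ε * s'))
    (hOs : ‖O‖ ≤ 1 / (16 * s' ^ 2)) (hOs' : ‖O'‖ ≤ 1 / (16 * s' ^ 2))
    (hOO : ‖O - O'‖ ≤ ε / (16 * s' ^ 2)) :
    ‖krausOp H O - 1 + (1 / s) • ∑ k ∈ Finset.Icc 1 (order ε),
      heisIntegral H (kernel f k false) (s ^ 2 • O')‖ ≤ 9 / 10 * ε := by
  have h1 : 1 / 2 ≤ s' := by
    have : 0 ≤ 1 / Real.pi * Real.log (1 + ‖H‖ / 2) :=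
      mul_nonneg (by positivity) (Real.log_nonneg (by linarith [norm_nonneg H]))
    linarith
  have hS (b : Bool) : SuperopNormLE (opSpm hH b) s' := fun A =>
    (superopNormLE_opSpm hH b A).trans (by gcongr)
  have hf' (b : Bool) : SuperopNormLE
      (fun A => opSpm hH b A - ((s : ℂ) • heisAverageLin hH (f b)) A) (ε * s') := by
    intro A
    have h : ‖opSpm hH b A - s • heisAverage H (f b) A‖ ≤ ε * s' * ‖A‖ := hf b A
    rwa [← Complex.coe_smul] at h
  have := norm_truncation_sub_krausOp_le hH hO hε hε2 h1 hS hOs hOs' hOO (hf' true) (hf' false)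
  rw [← norm_neg, smul_sum_heisIntegral hH f hs]
  refine (le_of_eq ?_).trans this
  congr 1
  abel

end HeisIntegral

/-! ### The short-time kernels -/

section Seed

open MeasureTheory Set Filter Topology

variable {h ε : ℝ}

lemma one_le_normS (hh : 0 ≤ h) (hε : 0 < ε) : 1 ≤ normS h ε := by
  have : 0 ≤ 2 / Real.pi * Real.log (1 + 2 * h / (ε * Real.pi)) :=
    mul_nonneg (by positivity) (Real.log_nonneg (by
      have : 0 ≤ 2 * h / (ε * Real.pi) := by positivity
      linarith))
  rw [normS]
  linarith

lemma cutoff_pos (hε : 0 < ε) (hε2 : ε ≤ 1 / 2) : 0 < cutoff ε := by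
  have h4 : 1 < 4 / ε := by rw [lt_div_iff₀ hε]; linarith
  exact div_pos (Real.log_pos h4) Real.two_pi_pos

lemma measurableSet_window (h ε : ℝ) : MeasurableSet (window h ε) :=
  (measurableSet_le (f := fun t : ℝ => |t|) (by fun_prop) measurable_const).inter
    (measurableSet_le (g := fun t : ℝ => 2 * h * |t|) measurable_const (by fun_prop))

lemma neg_mem_window {t : ℝ} : -t ∈ window h ε ↔ t ∈ window h ε := by
  simp [window]

/-- The density of the absolutely continuous part of the short-time kernels. -/
def seedDensity (h ε : ℝ) : ℝ → ℂ := (window h ε).indicator fun t : ℝ =>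
  Complex.I / ((normS h ε : ℂ) * (Real.sinh (2 * Real.pi * t) : ℂ))

lemma pos_of_mem_window (hε : 0 < ε) (hh : 0 ≤ h) {t : ℝ} (ht : t ∈ window h ε) :
    0 < h ∧ ε / (2 * h) ≤ |t| := by
  have h1 : 0 < h := by
    refine hh.lt_of_ne fun h0 => ?_
    have := ht.2
    rw [← h0] at this
    linarith
  exact ⟨h1, by rw [div_le_iff₀ (by positivity)]; linarith [ht.2]⟩

lemma norm_seedDensity (hh : 0 ≤ h) (hε : 0 < ε) {t : ℝ} (ht : t ∈ window h ε) :
    ‖seedDensity h ε t‖ = 1 / normS h ε * (1 / Real.sinh (2 * Real.pi * |t|)) := by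
  have hs := one_le_normS hh hε
  rw [seedDensity, indicator_of_mem ht, norm_div, norm_mul, Complex.norm_I, Complex.norm_real,
    Complex.norm_real, Real.norm_eq_abs, Real.norm_eq_abs, Real.abs_sinh, abs_mul,
    abs_of_pos Real.two_pi_pos, abs_of_nonneg (by linarith), one_div_mul_one_div]

lemma norm_seedDensity_le (hh : 0 ≤ h) (hε : 0 < ε) {t : ℝ} (ht : 0 < t) :
    ‖seedDensity h ε t‖ ≤ 1 / normS h ε *
      (Ici (ε / (2 * h))).indicator (fun t => 1 / Real.sinh (2 * Real.pi * t)) t := by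
  have hs := one_le_normS hh hε
  by_cases hw : t ∈ window h ε
  · rw [norm_seedDensity hh hε hw, abs_of_pos ht, indicator_of_mem]
    have := (pos_of_mem_window hε hh hw).2
    rwa [abs_of_pos ht] at this
  · rw [seedDensity, indicator_of_notMem hw, norm_zero]
    refine mul_nonneg (by positivity) (indicator_nonneg (fun x hx => one_div_sinh_nonneg ?_) t)
    exact (by positivity : 0 ≤ ε / (2 * h)).trans hx

lemma measurable_seedDensity (h ε : ℝ) : Measurable (seedDensity h ε) :=
  Measurable.indicator (by fun_prop) (measurableSet_window h ε)

lemma integrable_seedDensity (hh : 0 ≤ h) (hε : 0 < ε) : Integrable (seedDensity h ε) := by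
  have hs := one_le_normS hh hε
  refine (integrable_indicator_iff (measurableSet_window h ε)).2 ?_
  refine (Measure.integrableOn_of_bounded (s := window h ε) (f := seedDensity h ε)
    (M := 1 / normS h ε * (1 / Real.sinh (2 * Real.pi * (ε / (2 * h))))) ?_
    (measurable_seedDensity h ε).aestronglyMeasurable
    ((ae_restrict_iff' (measurableSet_window h ε)).2 (ae_of_all _ fun t ht => ?_))).congr_fun
    (fun t ht => indicator_of_mem ht _) (measurableSet_window h ε)
  · refine ((measure_mono fun t ht => ?_).trans_lt
      (measure_Icc_lt_top (a := -cutoff ε) (b := cutoff ε))).ne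
    exact abs_le.1 ht.1
  · obtain ⟨h1, h2⟩ := pos_of_mem_window hε hh ht
    rw [norm_seedDensity hh hε ht]
    have h3 : 0 < Real.sinh (2 * Real.pi * (ε / (2 * h))) := Real.sinh_pos_iff.2 (by positivity)
    have h4 : Real.sinh (2 * Real.pi * (ε / (2 * h))) ≤ Real.sinh (2 * Real.pi * |t|) :=
      Real.sinh_le_sinh.2 (by gcongr)
    gcongr

lemma integral_eq_integral_Ioi_add_neg {E : Type*} [NormedAddCommGroup E] [NormedSpace ℝ E]
    {F : ℝ → E} (hF : Integrable F) : ∫ t, F t = ∫ t in Ioi 0, (F t + F (-t)) := by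
  rw [integral_add hF.integrableOn hF.comp_neg.integrableOn, integral_comp_neg_Ioi, neg_zero,
    add_comm, intervalIntegral.integral_Iic_add_Ioi hF.integrableOn hF.integrableOn]

lemma norm_seedDensity_neg (hh : 0 ≤ h) (hε : 0 < ε) (t : ℝ) :
    ‖seedDensity h ε (-t)‖ = ‖seedDensity h ε t‖ := by
  by_cases hw : t ∈ window h ε
  · rw [norm_seedDensity hh hε hw, norm_seedDensity hh hε (neg_mem_window.2 hw), abs_neg]
  · rw [seedDensity, indicator_of_notMem hw, indicator_of_notMem (neg_mem_window.not.2 hw)]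

lemma integral_norm_seedDensity_le (hh : 0 ≤ h) (hε : 0 < ε) :
    ∫ t, ‖seedDensity h ε t‖ ≤
      1 / normS h ε * (1 / Real.pi * Real.log (1 + 2 * h / (ε * Real.pi))) := by
  have hs := one_le_normS hh hε
  rcases hh.eq_or_lt with h0 | h0
  · have : ∀ t, seedDensity h ε t = 0 := fun t => indicator_of_notMem (fun ht => by
      have := (pos_of_mem_window hε hh ht).1
      linarith) _
    simp only [this]
    simp [← h0]
  have hη : 0 < ε / (2 * h) := by positivity
  have hi := (integrable_seedDensity hh hε).norm
  have hj : IntegrableOn (fun t => 1 / Real.sinh (2 * Real.pi * t)) (Ici (ε / (2 * h))) :=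
    (integrableOn_Ici_iff_integrableOn_Ioi (by finiteness)).2 (integrableOn_one_div_sinh hη)
  have h1 : ∫ t in Ioi 0, ‖seedDensity h ε t‖ ≤
      1 / normS h ε * ∫ t in Ioi (ε / (2 * h)), 1 / Real.sinh (2 * Real.pi * t) := by
    calc _ ≤ ∫ t in Ioi 0, 1 / normS h ε *
          (Ici (ε / (2 * h))).indicator (fun t => 1 / Real.sinh (2 * Real.pi * t)) t :=
        setIntegral_mono_on hi.integrableOn
          (((integrable_indicator_iff measurableSet_Ici).2 hj).const_mul _).integrableOn
          measurableSet_Ioi fun t ht => norm_seedDensity_le hh hε ht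
      _ = _ := by
        rw [integral_const_mul, setIntegral_indicator measurableSet_Ici,
          inter_eq_self_of_subset_right (Ici_subset_Ioi.2 hη), integral_Ici_eq_integral_Ioi]
  have h2 := integral_one_div_sinh_le hη
  rw [integral_eq_integral_Ioi_add_neg hi]
  simp only [norm_seedDensity_neg hh hε]
  rw [integral_add hi.integrableOn hi.integrableOn]
  have h3 : 1 / (Real.pi * (ε / (2 * h))) = 2 * h / (ε * Real.pi) := by field_simp
  rw [h3] at h2
  have h4 := mul_le_mul_of_nonneg_left h2 (by positivity : 0 ≤ 1 / normS h ε)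
  have h5 : Real.log (1 + 2 * h / (ε * Real.pi)) / (2 * Real.pi) =
      1 / 2 * (1 / Real.pi * Real.log (1 + 2 * h / (ε * Real.pi))) := by
    field_simp
  rw [h5] at h4
  linarith

lemma seed_eq (h ε : ℝ) (b : Bool) : seed h ε b =
    VectorMeasure.dirac 0 (1 / (2 * (normS h ε : ℂ))) -
      volume.withDensityᵥ (sgn b • seedDensity h ε) := by
  rw [withDensityᵥ_smul]
  rfl

lemma norm_sgn (b : Bool) : ‖sgn b‖ = 1 := by cases b <;> simp [sgn]

lemma variation_seed_le (hh : 0 ≤ h) (hε : 0 < ε) (b : Bool) :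
    (seed h ε b).variation ≤ ‖1 / (2 * (normS h ε : ℂ))‖ₑ • Measure.dirac 0 +
      volume.withDensity fun t => ‖seedDensity h ε t‖ₑ := by
  rw [seed_eq]
  refine VectorMeasure.variation_sub_le.trans ?_
  rw [VectorMeasure.variation_dirac, Measure.variation_withDensityᵥ
    ((integrable_seedDensity hh hε).smul _)]
  refine le_of_eq ?_
  congr 2
  funext t
  rw [Pi.smul_apply, ← ofReal_norm, ← ofReal_norm, norm_smul, norm_sgn, one_mul]

/-- The normalization `normS` is chosen such that the Dirac mass and the density add up to `1/2`. -/
theorem l1norm_seed_le (hh : 0 ≤ h) (hε : 0 < ε) (b : Bool) :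
    l1norm (seed h ε b) ≤ ENNReal.ofReal (1 / 2) := by
  have hs := one_le_normS hh hε
  have hs0 : 0 < normS h ε := by linarith
  refine (variation_seed_le hh hε b univ).trans ?_
  rw [Measure.add_apply, Measure.smul_apply, measure_univ, smul_eq_mul, mul_one,
    withDensity_apply _ .univ, Measure.restrict_univ,
    ← ofReal_integral_norm_eq_lintegral_enorm (integrable_seedDensity hh hε), ← ofReal_norm,
    ← ENNReal.ofReal_add (norm_nonneg _) (by positivity)]
  refine ENNReal.ofReal_le_ofReal ?_
  have h1 : ‖1 / (2 * (normS h ε : ℂ))‖ = 1 / normS h ε * (1 / 2) := by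
    rw [norm_div, norm_mul, Complex.norm_real, Real.norm_of_nonneg hs0.le]
    norm_num
  have h2 := integral_norm_seedDensity_le hh hε
  have h3 : 1 / normS h ε * (1 / 2) +
      1 / normS h ε * (1 / Real.pi * Real.log (1 + 2 * h / (ε * Real.pi))) = 1 / 2 := by
    have : 1 / 2 + 1 / Real.pi * Real.log (1 + 2 * h / (ε * Real.pi)) = normS h ε / 2 := by
      rw [normS]; ring
    rw [← mul_add, this]
    field_simp
  rw [h1]
  linarith

theorem supp_seed_subset (hh : 0 ≤ h) (hε : 0 < ε) (hε2 : ε ≤ 1 / 2) (b : Bool) :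
    supp (seed h ε b) ⊆ Icc (-cutoff ε) (cutoff ε) := by
  have hτ := cutoff_pos hε hε2
  refine Measure.support_subset_of_isClosed isClosed_Icc ?_
  refine (Measure.absolutelyContinuous_of_le (variation_seed_le hh hε b)).ae_le ?_
  change _ = 0
  rw [Measure.add_apply, Measure.smul_apply, Measure.dirac_apply' _ measurableSet_Icc.compl,
    indicator_of_notMem (by simp [hτ.le]), smul_zero, zero_add,
    withDensity_apply _ measurableSet_Icc.compl]
  refine setLIntegral_eq_zero measurableSet_Icc.compl fun t ht => ?_
  rw [seedDensity, indicator_of_notMem, enorm_zero]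
  · rfl
  · exact fun hw => ht (abs_le.1 hw.1)

variable {n : Type u} [Fintype n] [DecidableEq n] {H : Matrix n n ℂ}

/-- The two halves of the window contribute opposite values of the odd kernel, so that the
short-time average is the integral for `𝒮^±` with the times outside the window left out. -/
lemma smul_heisAverage_seed (hH : H.IsHermitian) (hε : 0 < ε) (b : Bool) (A : Matrix n n ℂ) :
    normS ‖H‖ ε • heisAverage H (seed ‖H‖ ε b) A =
      (1 / 2 : ℂ) • A + sgn b • ∫ t in Ioi 0 ∩ window ‖H‖ ε, sinhKernel H A t := by
  have hh := norm_nonneg H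
  have hs := one_le_normS hh hε
  have hs0 : (normS ‖H‖ ε : ℂ) ≠ 0 := by
    have : normS ‖H‖ ε ≠ 0 := by positivity
    exact_mod_cast this
  have hsd := (integrable_seedDensity hh hε).smul (sgn b)
  have hb := bddMeas_heis hH A
  have hi : Integrable fun t => (sgn b • seedDensity ‖H‖ ε) t • heis H t A := by
    refine (hsd.norm.mul_const ‖A‖).mono' (hsd.aestronglyMeasurable.smul hb.1.aestronglyMeasurable)
      (ae_of_all _ fun t => ?_)
    rw [norm_smul, norm_heis hH]
  have h1 (t : ℝ) : (sgn b • seedDensity ‖H‖ ε) t • heis H t A +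
      (sgn b • seedDensity ‖H‖ ε) (-t) • heis H (-t) A =
      (-(sgn b / (normS ‖H‖ ε : ℂ))) • (window ‖H‖ ε).indicator (sinhKernel H A) t := by
    rw [Pi.smul_apply, Pi.smul_apply, seedDensity]
    by_cases hw : t ∈ window ‖H‖ ε
    · rw [indicator_of_mem hw, indicator_of_mem hw, indicator_of_mem (neg_mem_window.2 hw),
        sinhKernel, mul_neg, Real.sinh_neg]
      simp only [smul_eq_mul, smul_smul]
      push_cast
      rw [mul_neg, div_neg, mul_neg, neg_smul, ← sub_eq_add_neg, ← smul_sub]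
      congr 1
      ring
    · rw [indicator_of_notMem hw, indicator_of_notMem hw,
        indicator_of_notMem (neg_mem_window.not.2 hw)]
      simp
  rw [heisAverage, seed_eq, cintegral_sub_measure hb, cintegral_dirac, heis_zero,
    cintegral_withDensityᵥ hsd hb, integral_eq_integral_Ioi_add_neg hi]
  simp only [h1]
  rw [integral_smul, setIntegral_indicator (measurableSet_window _ _), ← Complex.coe_smul,
    smul_sub, smul_smul, smul_smul, sub_eq_add_neg, ← neg_smul]
  congr 2 <;> field_simp

/-- The short-time kernels represent `𝒮^±` up to an error `ε`. -/
theorem superopNormLE_opSpm_sub_heisAverage_seed (hH : H.IsHermitian) (hε : 0 < ε)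
    (hε2 : ε ≤ 1 / 2) (b : Bool) : SuperopNormLE
      (fun A => opSpm hH b A - normS ‖H‖ ε • heisAverage H (seed ‖H‖ ε b) A) ε := by
  intro A
  have hπ := Real.pi_gt_three
  have hτ := cutoff_pos hε hε2
  have hW := measurableSet_window ‖H‖ ε
  have h1 : opS hH A = (∫ t in Ioi 0 ∩ window ‖H‖ ε, sinhKernel H A t) +
      ∫ t in Ioi 0 \ window ‖H‖ ε, sinhKernel H A t := by
    rw [opS_eq_integral, integral_inter_add_sdiff hW (integrableOn_sinhKernel hH A)]
  have h2 : opSpm hH b A - normS ‖H‖ ε • heisAverage H (seed ‖H‖ ε b) A =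
      sgn b • ∫ t in Ioi 0 \ window ‖H‖ ε, sinhKernel H A t := by
    rw [smul_heisAverage_seed hH hε, opSpm, h1, smul_add]
    abel
  change ‖opSpm hH b A - normS ‖H‖ ε • heisAverage H (seed ‖H‖ ε b) A‖ ≤ _
  rw [h2, norm_smul, norm_sgn, one_mul]
  obtain ⟨η, hη, hη1, hη2⟩ : ∃ η : ℝ, 0 ≤ η ∧ 2 * ‖H‖ * η ≤ ε ∧
      Ioi 0 \ window ‖H‖ ε ⊆ Ioc 0 η ∪ Ioi (cutoff ε) := by
    rcases (norm_nonneg H).eq_or_lt with h0 | h0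
    · refine ⟨cutoff ε, hτ.le, by rw [← h0]; linarith, fun t ht => ?_⟩
      rw [Ioc_union_Ioi_eq_Ioi hτ.le]
      exact ht.1
    · refine ⟨ε / (2 * ‖H‖), by positivity, by field_simp; exact le_rfl, fun t ht => ?_⟩
      have ht0 : 0 < t := ht.1
      rcases le_or_gt t (cutoff ε) with h3 | h3
      · left
        refine ⟨ht0, ?_⟩
        rw [le_div_iff₀ (by positivity)]
        by_contra! h4
        exact ht.2 ⟨by rwa [abs_of_pos ht0], by rw [abs_of_pos ht0]; linarith⟩
      · exact Or.inr h3
  refine (norm_setIntegral_sinhKernel_le hH A (measurableSet_Ioi.diff hW) hη hτ hη2).trans ?_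
  refine mul_le_mul_of_nonneg_right ?_ (norm_nonneg _)
  have h3 := integral_one_div_sinh_cutoff_le hε hε2
  have h4 : 2 * ‖H‖ / Real.pi * η ≤ ε / 3 := by
    calc _ = 2 * ‖H‖ * η / Real.pi := by ring
      _ ≤ ε / 3 := by gcongr
  have h5 : 2 * ε / (7 * Real.pi) ≤ 2 * ε / (7 * 3) := by gcongr
  linarith

end Seed

/-! ### Linear combinations of products of evolved operators -/

section Combination

open MeasureTheory Set Filter Topology

variable {n : Type u} [Fintype n] [DecidableEq n] {H M : Matrix n n ℂ}

/-- An integral against a complex measure concentrated on `K` is a limit of sums of values at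
points of `K`, with weights bounded by the total variation. -/
lemma exists_sum_near_cintegral {X E : Type*} [MeasurableSpace X] [PseudoEMetricSpace X]
    [OpensMeasurableSpace X] [SecondCountableTopology X] [NormedAddCommGroup E] [NormedSpace ℂ E]
    [CompleteSpace E] {F : ComplexMeasure X} {φ : X → E} (hφ : BddMeas φ) (hc : Continuous φ)
    {K : Set X} (hK : K.Nonempty) (hF : ∀ᵐ x ∂F.variation, x ∈ K) {δ : ℝ} (hδ : 0 < δ) :
    ∃ (s : Finset X) (w : X → ℂ), ↑s ⊆ K ∧ ∑ x ∈ s, ‖w x‖ ≤ (l1norm F).toReal ∧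
      ‖cintegral F φ - ∑ x ∈ s, w x • φ x‖ ≤ δ := by
  obtain ⟨x₀, hx₀⟩ := hK
  obtain ⟨hm, C, hC⟩ := hφ
  set ψ := SimpleFunc.approxOn (id : X → X) measurable_id K x₀ hx₀
  have hlim : Tendsto (fun k => cintegral F fun x => φ (ψ k x)) atTop (𝓝 (cintegral F φ)) := by
    refine VectorMeasure.tendsto_integral_of_dominated_convergence (fun _ => C)
      (fun k => (hm.comp_measurable (ψ k).measurable).aestronglyMeasurable) (integrable_const _)
      (fun k => ae_of_all _ fun x => hC _) ?_
    filter_upwards [hF] with x hx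
    exact (hc.tendsto _).comp (SimpleFunc.tendsto_approxOn measurable_id hx₀ (subset_closure hx))
  obtain ⟨k, hk⟩ := (hlim.eventually (Metric.closedBall_mem_nhds _ hδ)).exists
  have h1 : (fun x => φ (ψ k x)) = fun x => ∑ y ∈ (ψ k).range,
      (ψ k ⁻¹' {y}).indicator (fun _ => φ y) x := by
    funext x
    rw [Finset.sum_eq_single (ψ k x)]
    · simp
    · exact fun y _ hy => indicator_of_notMem (s := ψ k ⁻¹' {y})
        (fun h => hy (mem_singleton_iff.1 h).symm) _
    · exact fun h => absurd (SimpleFunc.mem_range_self _ _) h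
  have h2 : cintegral F (fun x => φ (ψ k x)) =
      ∑ y ∈ (ψ k).range, F (ψ k ⁻¹' {y}) • φ y := by
    rw [h1, cintegral, VectorMeasure.integral_finsetSum _ fun y _ =>
      (BddMeas.indicator_const (φ y) (SimpleFunc.measurableSet_fiber _ _)).integrable _]
    exact Finset.sum_congr rfl fun y _ =>
      cintegral_indicator_const (φ y) (SimpleFunc.measurableSet_fiber _ _)
  refine ⟨(ψ k).range, fun y => F (ψ k ⁻¹' {y}), fun y hy => ?_, ?_, ?_⟩
  · obtain ⟨x, rfl⟩ := SimpleFunc.mem_range.1 hy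
    exact SimpleFunc.approxOn_mem measurable_id hx₀ k x
  · calc _ ≤ ∑ y ∈ (ψ k).range, (F.variation (ψ k ⁻¹' {y})).toReal :=
          Finset.sum_le_sum fun y _ => VectorMeasure.norm_measure_le_variation
      _ = _ := by
        rw [← ENNReal.toReal_sum fun y _ => measure_ne_top _ _,
          SimpleFunc.sum_range_measure_preimage_singleton, l1norm]
  · rw [← h2, ← dist_eq_norm, dist_comm]
    exact hk

/-- `B` is a finite linear combination, with weights of total size at most `W`, of products of at
most `m` evolved copies of `M`, the times in a product of `k` factors being at most `k τ`. -/
def IsCombination (H M : Matrix n n ℂ) (m : ℕ) (τ W : ℝ) (B : Matrix n n ℂ) : Prop :=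
  ∃ (ι : Type) (_ : Fintype ι) (w : ι → ℂ) (k : ι → ℕ) (t : (j : ι) → Fin (k j) → ℝ),
    ∑ j, ‖w j‖ ≤ W ∧ (∀ j, k j ≤ m) ∧ (∀ j i, |t j i| ≤ k j * τ) ∧
    B = ∑ j, w j • (List.ofFn fun i => heis H (t j i) M).prod

lemma IsCombination.add {m : ℕ} {τ W V : ℝ} {A B : Matrix n n ℂ}
    (hA : IsCombination H M m τ W A) (hB : IsCombination H M m τ V B) :
    IsCombination H M m τ (W + V) (A + B) := by
  obtain ⟨ι, _, w, k, t, h1, h2, h3, rfl⟩ := hA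
  obtain ⟨κ, _, w', k', t', h1', h2', h3', rfl⟩ := hB
  refine ⟨ι ⊕ κ, inferInstance, Sum.elim w w', Sum.elim k k', Sum.rec t t', ?_, ?_, ?_, ?_⟩
  · simpa [Fintype.sum_sum_type] using add_le_add h1 h1'
  · rintro (j | j)
    exacts [h2 j, h2' j]
  · rintro (j | j)
    exacts [h3 j, h3' j]
  · simp [Fintype.sum_sum_type]

lemma IsCombination.smul {m : ℕ} {τ W : ℝ} {B : Matrix n n ℂ}
    (hB : IsCombination H M m τ W B) (c : ℂ) : IsCombination H M m τ (‖c‖ * W) (c • B) := by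
  obtain ⟨ι, _, w, k, t, h1, h2, h3, rfl⟩ := hB
  refine ⟨ι, inferInstance, fun j => c * w j, k, t, ?_, h2, h3, ?_⟩
  · simp only [norm_mul, ← Finset.mul_sum]
    gcongr
  · simp only [Finset.smul_sum, smul_smul]

lemma IsCombination.mono {m : ℕ} {τ W V : ℝ} {B : Matrix n n ℂ}
    (hB : IsCombination H M m τ W B) (h : W ≤ V) : IsCombination H M m τ V B := by
  obtain ⟨ι, _, w, k, t, h1, h2⟩ := hB
  exact ⟨ι, inferInstance, w, k, t, h1.trans h, h2⟩

lemma isCombination_zero (H M : Matrix n n ℂ) (m : ℕ) (τ : ℝ) : IsCombination H M m τ 0 0 :=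
  ⟨Empty, inferInstance, Empty.rec, Empty.rec, fun j => j.elim, by simp, by simp, by simp, by simp⟩

lemma isCombination_one (H M : Matrix n n ℂ) (m : ℕ) (τ : ℝ) : IsCombination H M m τ 1 1 :=
  ⟨Unit, inferInstance, fun _ => 1, fun _ => 0, fun _ i => i.elim0, by simp, by simp,
    fun _ i => i.elim0, by simp⟩

lemma exists_isCombination_near_heisIntegral (hH : H.IsHermitian) {k m : ℕ} (hk : k ≤ m)
    {τ W : ℝ} (hτ : 0 ≤ τ) {F : ComplexMeasure (Fin k → ℝ)} (hW : (l1norm F).toReal ≤ W)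
    (hF : supp F ⊆ univ.pi fun _ => Icc (-(k * τ)) (k * τ)) {δ : ℝ} (hδ : 0 < δ) :
    ∃ B, IsCombination H M m τ W B ∧ ‖heisIntegral H F M - B‖ ≤ δ := by
  obtain ⟨s, w, h1, h2, h3⟩ := exists_sum_near_cintegral (F := F) (bddMeas_prod_heis hH M k)
    (continuous_prod_heis H M k) (K := univ.pi fun _ => Icc (-(k * τ)) (k * τ))
    ⟨fun _ => 0, fun _ _ => ⟨by simp; positivity, by positivity⟩⟩
    ((ae_mem_supp F).mono fun x hx => hF hx) hδ
  refine ⟨_, ⟨s, inferInstance, fun x => w x, fun _ => k, fun x => x, ?_, fun _ => hk,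
    fun x i => abs_le.2 (h1 x.2 i (mem_univ _)), rfl⟩, ?_⟩
  · rw [Finset.sum_coe_sort s fun x => ‖w x‖]
    exact h2.trans hW
  · rwa [Finset.sum_coe_sort s fun x => w x • (List.ofFn fun i => heis H (x i) M).prod]

lemma exists_isCombination_near_sum (hH : H.IsHermitian) {m : ℕ} {τ : ℝ} (hτ : 0 ≤ τ)
    {F : (k : ℕ) → ComplexMeasure (Fin k → ℝ)} {a : ℕ → ℝ}
    (ha : ∀ k, (l1norm (F (k + 1))).toReal ≤ a k)
    (hF : ∀ k, supp (F (k + 1)) ⊆ univ.pi fun _ => Icc (-((k + 1 : ℕ) * τ)) ((k + 1 : ℕ) * τ))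
    {K : ℕ} (hK : K ≤ m) {δ : ℝ} (hδ : 0 < δ) :
    ∃ B, IsCombination H M m τ (∑ k ∈ Finset.range K, a k) B ∧
      ‖∑ k ∈ Finset.range K, heisIntegral H (F (k + 1)) M - B‖ ≤ δ := by
  induction K generalizing δ with
  | zero => exact ⟨0, by simpa using isCombination_zero H M m τ, by simpa using hδ.le⟩
  | succ K ih =>
    obtain ⟨B, hB, hB'⟩ := ih (by omega) (half_pos hδ)
    obtain ⟨C, hC, hC'⟩ := exists_isCombination_near_heisIntegral (M := M) hH hK hτ (ha K) (hF K)
      (half_pos hδ)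
    refine ⟨B + C, ?_, ?_⟩
    · rw [Finset.sum_range_succ]
      exact hB.add hC
    · rw [Finset.sum_range_succ, add_sub_add_comm]
      exact (norm_add_le _ _).trans (by linarith)

variable {O O' : Matrix n n ℂ} {ε : ℝ}

/-- The bound `1 + ln (1 + h / 2) / π` on the norm of `𝒮^±`; here `h` is `‖H‖`. -/
def superopBound (h : ℝ) : ℝ := 1 + 1 / Real.pi * Real.log (1 + h / 2)

lemma one_le_superopBound {h : ℝ} (hh : 0 ≤ h) : 1 ≤ superopBound h := by
  have : 0 ≤ 1 / Real.pi * Real.log (1 + h / 2) :=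
    mul_nonneg (by positivity) (Real.log_nonneg (by linarith))
  rw [superopBound]
  linarith

/-- The short-time representation of the Kraus operator, with `O` replaced by an approximation `O'`.
-/
theorem norm_krausOp_sub_one_add_sum_seed_le (hH : H.IsHermitian) (hO : O.IsHermitian)
    (hε : 0 < ε) (hε2 : ε ≤ 1 / 2) (hOs : ‖O‖ ≤ 1 / (16 * superopBound ‖H‖ ^ 2))
    (hOs' : ‖O'‖ ≤ 1 / (16 * superopBound ‖H‖ ^ 2))
    (hOO : ‖O - O'‖ ≤ ε / (16 * superopBound ‖H‖ ^ 2)) :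
    ‖krausOp H O - 1 + (1 / normS ‖H‖ ε) • ∑ k ∈ Finset.Icc 1 (order ε),
      heisIntegral H (kernel (seed ‖H‖ ε) k false) (normS ‖H‖ ε ^ 2 • O')‖ ≤ 9 / 10 * ε := by
  have hs := one_le_normS (norm_nonneg H) hε
  have hb := one_le_superopBound (norm_nonneg H)
  refine norm_krausOp_sub_one_add_sum_heisIntegral_le hH hO _ hε hε2
    (s' := superopBound ‖H‖) le_rfl (by linarith) (fun b A => ?_) hOs hOs' hOO
  refine (superopNormLE_opSpm_sub_heisAverage_seed hH hε hε2 b A).trans ?_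
  gcongr
  exact le_mul_of_one_le_right hε.le hb

/-- The Kraus operator is close to a finite linear combination of products of evolved operators: the
term `1` and the discretized kernels have weight at most `1` each. -/
theorem exists_isCombination_near_krausOp (hH : H.IsHermitian) (hO : O.IsHermitian)
    (hε : 0 < ε) (hε2 : ε ≤ 1 / 2) (hOs : ‖O‖ ≤ 1 / (16 * superopBound ‖H‖ ^ 2))
    (hOs' : ‖O'‖ ≤ 1 / (16 * superopBound ‖H‖ ^ 2))
    (hOO : ‖O - O'‖ ≤ ε / (16 * superopBound ‖H‖ ^ 2)) :
    ∃ B, IsCombination H (normS ‖H‖ ε ^ 2 • O') (order ε) (cutoff ε) 2 B ∧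
      ‖krausOp H O - B‖ ≤ ε := by
  have hh := norm_nonneg H
  have hs := one_le_normS hh hε
  have hs0 : 0 < normS ‖H‖ ε := by linarith
  set M := normS ‖H‖ ε ^ 2 • O'
  have h1 := norm_krausOp_sub_one_add_sum_seed_le hH hO hε hε2 hOs hOs' hOO
  obtain ⟨B, hB, hB'⟩ := exists_isCombination_near_sum (M := M) hH (cutoff_pos hε hε2).le
    (F := fun k => kernel (seed ‖H‖ ε) k false) (a := fun k => coeffA (k + 1))
    (fun k => ENNReal.toReal_le_of_le_ofReal (coeffA_nonneg k)
      (l1norm_kernel_le (l1norm_seed_le hh hε) k false))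
    (fun k => supp_kernel_subset_of_supp_subset_Icc (supp_seed_subset hh hε hε2) k false)
    (le_refl (order ε)) (δ := ε / 10) (by positivity)
  have h2 : ∑ k ∈ Finset.Icc 1 (order ε), heisIntegral H (kernel (seed ‖H‖ ε) k false) M =
      ∑ k ∈ Finset.range (order ε), heisIntegral H (kernel (seed ‖H‖ ε) (k + 1) false) M := by
    rw [Finset.range_eq_Ico, Finset.sum_Ico_add'
      (fun k => heisIntegral H (kernel (seed ‖H‖ ε) k false) M), zero_add,
      Finset.Ico_add_one_right_eq_Icc]
  rw [h2] at h1
  set T := ∑ k ∈ Finset.range (order ε), heisIntegral H (kernel (seed ‖H‖ ε) (k + 1) false) M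
  refine ⟨1 + (-(1 / normS ‖H‖ ε : ℝ) : ℂ) • B, ?_, ?_⟩
  · refine ((isCombination_one _ _ _ _).add (hB.smul _)).mono ?_
    have h3 := sum_coeffA_le_one (order ε)
    have h4 : ‖(-(1 / normS ‖H‖ ε : ℝ) : ℂ)‖ ≤ 1 := by
      rw [norm_neg, Complex.norm_real, Real.norm_of_nonneg (by positivity)]
      exact (div_le_one hs0).2 hs
    have h5 : 0 ≤ ∑ k ∈ Finset.range (order ε), coeffA (k + 1) :=
      Finset.sum_nonneg fun k _ => coeffA_nonneg k
    nlinarith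
  · have h3 : krausOp H O - (1 + (-(1 / normS ‖H‖ ε : ℝ) : ℂ) • B) =
        (krausOp H O - 1 + (1 / normS ‖H‖ ε) • T) - (1 / normS ‖H‖ ε) • (T - B) := by
      rw [neg_smul, Complex.coe_smul, smul_sub]
      abel
    rw [h3]
    refine (norm_sub_le _ _).trans ?_
    have h4 : ‖(1 / normS ‖H‖ ε) • (T - B)‖ ≤ 1 * (ε / 10) := by
      rw [norm_smul, Real.norm_of_nonneg (by positivity)]
      exact mul_le_mul ((div_le_one hs0).2 hs) hB' (norm_nonneg _) zero_le_one
    linarith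

lemma IsCombination.exists_fin {m : ℕ} {τ W : ℝ} {B : Matrix n n ℂ}
    (hB : IsCombination H M m τ W B) :
    ∃ (N : ℕ) (w : Fin N → ℂ) (k : Fin N → ℕ) (t : (j : Fin N) → Fin (k j) → ℝ),
      ∑ j, ‖w j‖ ≤ W ∧ (∀ j, k j ≤ m) ∧ (∀ j i, |t j i| ≤ k j * τ) ∧
      B = ∑ j, w j • (List.ofFn fun i => heis H (t j i) M).prod := by
  obtain ⟨ι, _, w, k, t, h1, h2, h3, rfl⟩ := hB
  refine ⟨Fintype.card ι, fun j => w ((Fintype.equivFin ι).symm j),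
    fun j => k ((Fintype.equivFin ι).symm j), fun j => t ((Fintype.equivFin ι).symm j), ?_,
    fun j => h2 _, fun j => h3 _, ?_⟩
  · rwa [Equiv.sum_comp (Fintype.equivFin ι).symm fun j => ‖w j‖]
  · exact (Equiv.sum_comp (Fintype.equivFin ι).symm
      fun j => w j • (List.ofFn fun i => heis H (t j i) M).prod).symm

lemma superopBound_le {h : ℝ} (hh : 0 ≤ h) : superopBound h ≤ 2 * Real.log (h + 2) := by
  have hπ := Real.pi_gt_three
  have h1 : Real.log 2 ≤ Real.log (h + 2) := Real.log_le_log (by norm_num) (by linarith)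
  have h2 : Real.log (1 + h / 2) ≤ Real.log (h + 2) :=
    Real.log_le_log (by linarith) (by linarith)
  have h3 : 0 ≤ Real.log (1 + h / 2) := Real.log_nonneg (by linarith)
  have h4 : 1 / Real.pi * Real.log (1 + h / 2) ≤ 1 / 3 * Real.log (h + 2) := by
    gcongr
  have := Real.log_two_gt_d9
  rw [superopBound]
  linarith

lemma norm_le_of_norm_le_div_log_sq {h x : ℝ} (hh : 0 ≤ h)
    (hx : x ≤ 1 / 128 / Real.log (h + 2) ^ 2) : x ≤ 1 / (32 * superopBound h ^ 2) := by
  have h0 := one_le_superopBound hh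
  have h1 := superopBound_le hh
  refine hx.trans ?_
  rw [div_div]
  refine one_div_le_one_div_of_le (by positivity) ?_
  nlinarith

/-- The superoperator `𝒮^+` maps `1` to `1/2`. -/
lemma one_half_le_of_superopNormLE [Nonempty n] (hH : H.IsHermitian) {s : ℝ}
    (hS : SuperopNormLE (opSpm hH true) s) : 1 / 2 ≤ s := by
  have h0 : ∀ t, sinhKernel H 1 t = 0 := fun t => by simp [sinhKernel, heis_one]
  have h1 : opSpm hH true 1 = (1 / 2 : ℂ) • 1 := by
    rw [opSpm, opS_eq_integral]
    simp [h0]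
  have h2 := hS 1
  rw [h1, norm_smul, norm_one, mul_one, mul_one] at h2
  simpa using h2

end Combination

/-! ### Operators supported on a set of sites -/

section Support

set_option linter.unusedSectionVars false

open scoped Kronecker

variable {Λ : Type u} [Fintype Λ] [DecidableEq Λ] {q : ℕ}

open scoped Classical in
/-- The operator `A ⊗ 1` for `A` acting on the sites in `X`. -/
def tensorOne (X : Set Λ) (A : Matrix (X → Fin q) (X → Fin q) ℂ) :
    Matrix (Λ → Fin q) (Λ → Fin q) ℂ :=
  (A ⊗ₖ (1 : Matrix ({x // x ∉ X} → Fin q) ({x // x ∉ X} → Fin q) ℂ)).submatrix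
    (Equiv.piEquivPiSubtypeProd (· ∈ X) fun _ => Fin q)
    (Equiv.piEquivPiSubtypeProd (· ∈ X) fun _ => Fin q)

lemma supportedOn_iff {X : Set Λ} {M : Matrix (Λ → Fin q) (Λ → Fin q) ℂ} :
    SupportedOn X M ↔ ∃ A, tensorOne X A = M := by
  classical
  refine exists_congr fun A => ?_
  rw [← Matrix.ext_iff]
  refine forall_congr' fun σ => forall_congr' fun τ => ?_
  rw [eq_comm]
  refine Eq.congr_left ?_
  have h : (∀ x, x ∉ X → σ x = τ x) ↔
      ((fun x : {x // x ∉ X} => σ x) = fun x : {x // x ∉ X} => τ x) := by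
    simp [funext_iff]
  simp only [h, tensorOne, Matrix.submatrix_apply, Matrix.kroneckerMap_apply, Matrix.one_apply,
    Equiv.piEquivPiSubtypeProd, Equiv.coe_fn_mk, mul_ite, mul_one, mul_zero]

open scoped Classical in
lemma tensorOne_mul (X : Set Λ) (A B : Matrix (X → Fin q) (X → Fin q) ℂ) :
    tensorOne X A * tensorOne X B = tensorOne X (A * B) := by
  rw [tensorOne, tensorOne, tensorOne, Matrix.submatrix_mul_equiv, ← Matrix.mul_kronecker_mul,
    one_mul]

/-- The subalgebra of the operators supported on `X`. -/
def supportedSubalgebra (X : Set Λ) (q : ℕ) :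
    Subalgebra ℂ (Matrix (Λ → Fin q) (Λ → Fin q) ℂ) where
  carrier := {M | SupportedOn X M}
  mul_mem' := by
    classical
    rintro _ _ hA hB
    obtain ⟨A, rfl⟩ := supportedOn_iff.1 hA
    obtain ⟨B, rfl⟩ := supportedOn_iff.1 hB
    exact supportedOn_iff.2 ⟨A * B, (tensorOne_mul X A B).symm⟩
  add_mem' := by
    rintro _ _ hA hB
    obtain ⟨A, rfl⟩ := supportedOn_iff.1 hA
    obtain ⟨B, rfl⟩ := supportedOn_iff.1 hB
    exact supportedOn_iff.2 ⟨A + B, by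
      rw [tensorOne, Matrix.add_kronecker, Matrix.submatrix_add]
      rfl⟩
  algebraMap_mem' c := by
    classical
    refine supportedOn_iff.2 ⟨algebraMap ℂ _ c, ?_⟩
    rw [tensorOne, Algebra.algebraMap_eq_smul_one, Matrix.smul_kronecker, Matrix.one_kronecker_one,
      Matrix.submatrix_smul, Pi.smul_apply, Pi.smul_apply, Matrix.submatrix_one_equiv,
      Algebra.algebraMap_eq_smul_one]

lemma SupportedOn.mono {X Y : Set Λ} (hXY : X ⊆ Y) {M : Matrix (Λ → Fin q) (Λ → Fin q) ℂ}
    (hM : SupportedOn X M) : SupportedOn Y M := by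
  classical
  obtain ⟨A, hA⟩ := hM
  refine ⟨Matrix.of fun a b => if ∀ x : Y, (x : Λ) ∉ X → a x = b x then
    A (fun x => a ⟨x, hXY x.2⟩) (fun x => b ⟨x, hXY x.2⟩) else 0, fun σ τ => ?_⟩
  rw [hA, Matrix.of_apply]
  by_cases h : ∀ x, x ∉ X → σ x = τ x
  · have h1 : ∀ x, x ∉ Y → σ x = τ x := fun x hx => h x fun hx' => hx (hXY hx')
    have h2 : ∀ x : Y, (x : Λ) ∉ X → σ x = τ x := fun x hx => h x hx
    simp only [if_pos h, if_pos h1, if_pos h2]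
  · rw [if_neg h]
    by_cases h1 : ∀ x, x ∉ Y → σ x = τ x
    · have h2 : ¬ ∀ x : Y, (x : Λ) ∉ X → σ x = τ x := fun h2 => h fun x hx => by
        by_cases hxY : x ∈ Y
        exacts [h2 ⟨x, hxY⟩ hx, h1 x hxY]
      simp only [if_pos h1, if_neg h2]
    · simp only [if_neg h1]

open scoped Classical in
/-- In the matrix product only the configuration that agrees with `τ` on `X` and with `σ` elsewhere
contributes. -/
lemma mul_apply_of_disjoint {X Y : Set Λ} (hXY : Disjoint X Y)
    {M N : Matrix (Λ → Fin q) (Λ → Fin q) ℂ} {A : Matrix (X → Fin q) (X → Fin q) ℂ}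
    {B : Matrix (Y → Fin q) (Y → Fin q) ℂ}
    (hM : ∀ σ τ : Λ → Fin q, M σ τ = if ∀ x, x ∉ X → σ x = τ x then
      A (fun x => σ x) (fun x => τ x) else 0)
    (hN : ∀ σ τ : Λ → Fin q, N σ τ = if ∀ x, x ∉ Y → σ x = τ x then
      B (fun x => σ x) (fun x => τ x) else 0) (σ τ : Λ → Fin q) :
    (M * N) σ τ = if ∀ x, x ∉ X → x ∉ Y → σ x = τ x then
      A (fun x => σ x) (fun x => τ x) * B (fun x => σ x) (fun x => τ x) else 0 := by
  set ρ₀ : Λ → Fin q := fun x => if x ∈ X then τ x else σ x with hρ₀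
  rw [Matrix.mul_apply, Finset.sum_eq_single ρ₀]
  · have h1 : ∀ x, x ∉ X → σ x = ρ₀ x := fun x hx => by simp [hρ₀, hx]
    have h2 : (fun x : X => ρ₀ x) = fun x : X => τ x := funext fun x => by simp [hρ₀]
    have h3 : (fun x : Y => ρ₀ x) = fun x : Y => σ x := funext fun x => by
      simp [hρ₀, Set.disjoint_right.1 hXY x.2]
    have h4 : (∀ x, x ∉ Y → ρ₀ x = τ x) ↔ ∀ x, x ∉ X → x ∉ Y → σ x = τ x := by
      refine forall_congr' fun x => ?_
      by_cases hx : x ∈ X <;> simp [hρ₀, hx]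
    rw [hM, hN, if_pos h1, h2, h3]
    by_cases h5 : ∀ x, x ∉ X → x ∉ Y → σ x = τ x
    · rw [if_pos h5, if_pos (h4.2 h5)]
    · rw [if_neg h5, if_neg (h4.not.2 h5), mul_zero]
  · intro ρ _ hρ
    rw [hM, hN]
    by_cases h1 : ∀ x, x ∉ X → σ x = ρ x
    · have h3 : ¬ ∀ x, x ∉ Y → ρ x = τ x := fun h2 => hρ (funext fun x => by
        by_cases hx : x ∈ X
        · simp [hρ₀, hx, h2 x (Set.disjoint_left.1 hXY hx)]
        · simp [hρ₀, hx, h1 x hx])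
      rw [if_neg h3, mul_zero]
    · rw [if_neg h1, zero_mul]
  · exact fun h => absurd (Finset.mem_univ _) h

lemma SupportedOn.commute {X Y : Set Λ} (hXY : Disjoint X Y)
    {M N : Matrix (Λ → Fin q) (Λ → Fin q) ℂ} (hM : SupportedOn X M) (hN : SupportedOn Y N) :
    M * N = N * M := by
  classical
  obtain ⟨A, hA⟩ := hM
  obtain ⟨B, hB⟩ := hN
  ext σ τ
  rw [mul_apply_of_disjoint hXY (fun σ τ => by convert hA σ τ) (fun σ τ => by convert hB σ τ),
    mul_apply_of_disjoint hXY.symm (fun σ τ => by convert hB σ τ) (fun σ τ => by convert hA σ τ)]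
  refine if_congr (forall_congr' fun x => ⟨fun h a b => h b a, fun h a b => h b a⟩) ?_ rfl
  exact mul_comm _ _

lemma exp_mem_supportedSubalgebra {X : Set Λ} {M : Matrix (Λ → Fin q) (Λ → Fin q) ℂ}
    (hM : M ∈ supportedSubalgebra X q) : NormedSpace.exp M ∈ supportedSubalgebra X q := by
  have hc : IsClosed (supportedSubalgebra X q : Set (Matrix (Λ → Fin q) (Λ → Fin q) ℂ)) :=
    Submodule.closed_of_finiteDimensional (Subalgebra.toSubmodule (supportedSubalgebra X q))
  have h := NormedSpace.exp_series_hasSum_exp' (𝕂 := ℂ) M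
  exact hc.mem_of_tendsto h (Filter.Eventually.of_forall fun s =>
    sum_mem fun k _ => Subalgebra.smul_mem _ (pow_mem hM k) _)

lemma heis_mem_supportedSubalgebra {X : Set Λ} {H M : Matrix (Λ → Fin q) (Λ → Fin q) ℂ}
    (hH : H ∈ supportedSubalgebra X q) (hM : M ∈ supportedSubalgebra X q) (t : ℝ) :
    heis H t M ∈ supportedSubalgebra X q := by
  refine mul_mem (mul_mem (exp_mem_supportedSubalgebra (Subalgebra.smul_mem _ hH _)) hM)
    (exp_mem_supportedSubalgebra ?_)
  rw [← neg_smul]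
  exact Subalgebra.smul_mem _ hH _

end Support

/-! ### A Lieb-Robinson bound -/

section LiebRobinson

set_option linter.unusedSectionVars false

open Set Filter Topology

/-- A bootstrap form of Grönwall's inequality for a finite family of functions: at a maximizer of
`c i t / (b i exp (κ t))` the one-step bound `hstep` forces the maximum to be at most `C`. -/
lemma le_of_bootstrap {ι : Type*} [Fintype ι] {c : ι → ℝ → ℝ} {b : ι → ℝ} {C κ T : ℝ}
    (hT : 0 ≤ T) (hc : ∀ i, ContinuousOn (c i) (Icc 0 T)) (hb : ∀ i, 0 ≤ b i) (hC : 0 ≤ C)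
    (hc0 : ∀ i, b i = 0 → ∀ t, c i t ≤ 0)
    (hstep : ∀ K, 0 ≤ K → (∀ i, ∀ u ∈ Icc 0 T, c i u ≤ K * (b i * Real.exp (κ * u))) →
      ∀ i, ∀ t ∈ Icc 0 T, c i t ≤ C * b i + K * (b i * (Real.exp (κ * t) - 1))) (i : ι) :
    c i T ≤ C * (b i * Real.exp (κ * T)) := by
  have h1 (i : ι) : ∃ t ∈ Icc 0 T, IsMaxOn (fun t => c i t / (b i * Real.exp (κ * t)))
      (Icc 0 T) t := by
    refine isCompact_Icc.exists_isMaxOn ⟨0, left_mem_Icc.2 hT⟩ ?_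
    rcases eq_or_ne (b i) 0 with h0 | h0
    · simp only [h0, zero_mul, div_zero]
      exact continuousOn_const
    · exact (hc i).div (by fun_prop) fun t _ => mul_ne_zero h0 (Real.exp_pos _).ne'
  choose t ht hmax using h1
  obtain ⟨j, -, hj⟩ := Finset.exists_max_image Finset.univ
    (fun i => c i (t i) / (b i * Real.exp (κ * t i))) ⟨i, Finset.mem_univ i⟩
  set K := c j (t j) / (b j * Real.exp (κ * t j)) with hK
  have h2 (i : ι) (u : ℝ) (hu : u ∈ Icc 0 T) : c i u ≤ K * (b i * Real.exp (κ * u)) := by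
    rcases (hb i).eq_or_lt with h0 | h0
    · rw [← h0, zero_mul, mul_zero]
      exact hc0 i h0.symm u
    · rw [← div_le_iff₀ (by positivity)]
      exact (hmax i hu).trans (hj i (Finset.mem_univ i))
  have h3 : K ≤ C := by
    by_contra! hlt
    have hbj : 0 < b j := (hb j).lt_of_ne fun h0 => by
      rw [← h0, zero_mul, div_zero] at hK
      linarith
    have h4 := hstep K (by linarith) h2 j (t j) (ht j)
    have h5 : c j (t j) = K * (b j * Real.exp (κ * t j)) := by
      rw [hK, div_mul_cancel₀]
      positivity
    rw [h5] at h4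
    nlinarith
  refine (h2 i T (right_mem_Icc.2 hT)).trans ?_
  have := hb i
  gcongr

section Derivatives

variable {n : Type u} [Fintype n] [DecidableEq n] {H K : Matrix n n ℂ}

lemma hasDerivAt_heis_neg_comp (K : Matrix n n ℂ) {f : ℝ → Matrix n n ℂ} {f' : Matrix n n ℂ}
    {u : ℝ} (hf : HasDerivAt f f' u) :
    HasDerivAt (fun u => heis K (-u) (f u))
      (heis K (-u) (f' - Complex.I • (K * f u - f u * K))) u := by
  have h1 : HasDerivAt (fun t => evol K (-t)) (-(Complex.I • (K * evol K (-u)))) u :=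
    ((hasDerivAt_evol K (-u)).scomp u (hasDerivAt_neg u)).congr_deriv (neg_one_smul _ _)
  have h2 := (h1.mul hf).mul (hasDerivAt_evol K u)
  refine (h2.congr_of_eventuallyEq (Eventually.of_forall fun s => ?_)).congr_deriv ?_
  · simp [heis_eq]
  · rw [heis_eq, neg_neg, commute_evol K (-u)]
    simp only [Pi.mul_apply, mul_sub, sub_mul, add_mul, Matrix.smul_mul, Matrix.mul_smul, neg_mul,
      smul_sub,
      mul_assoc]
    abel

/-- If `K` commutes with `V`, the commutator of an evolved operator with `V` changes, up to the
unitary evolution generated by `K`, only through `H - K`. -/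
lemma hasDerivAt_heis_neg_commutator {V : Matrix n n ℂ} (hV : K * V = V * K) (B : Matrix n n ℂ)
    (u : ℝ) :
    HasDerivAt (fun u => heis K (-u) (heis H u B * V - V * heis H u B))
      (heis K (-u) (Complex.I • (((H - K) * heis H u B - heis H u B * (H - K)) * V -
        V * ((H - K) * heis H u B - heis H u B * (H - K))))) u := by
  have h1 := hasDerivAt_heis H B u
  refine (hasDerivAt_heis_neg_comp K ((h1.mul_const V).sub (h1.const_mul V))).congr_deriv ?_
  congr 1
  simp only [Pi.sub_apply, Matrix.smul_mul, Matrix.mul_smul, ← smul_sub]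
  congr 1
  have h2 : heis H u B * (K * V) = heis H u B * (V * K) := by rw [hV]
  have h3 : K * V * heis H u B = V * K * heis H u B := by rw [hV]
  simp only [mul_sub, sub_mul, mul_assoc] at h2 h3 ⊢
  rw [h2, h3]
  abel

/-- Duhamel's bound for the difference of two Heisenberg evolutions. -/
lemma norm_heis_sub_heis_le (hK : K.IsHermitian) {T c : ℝ} (hT : 0 ≤ T) (B : Matrix n n ℂ)
    (hc : ∀ u ∈ Icc 0 T, ‖heis H u B * (H - K) - (H - K) * heis H u B‖ ≤ c) :
    ‖heis H T B - heis K T B‖ ≤ c * T := by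
  have h1 (u : ℝ) := hasDerivAt_heis_neg_comp K (hasDerivAt_heis H B u)
  have h2 := norm_image_sub_le_of_norm_deriv_le_segment' (f := fun u => heis K (-u) (heis H u B))
    (a := 0) (b := T) (C := c) (fun u _ => (h1 u).hasDerivWithinAt) (fun u hu => ?_) T
    (right_mem_Icc.2 hT)
  · rw [neg_zero, heis_zero, heis_zero, sub_zero] at h2
    rw [← norm_heis hK (-T)]
    refine le_trans (le_of_eq ?_) h2
    rw [← heisLin_apply, map_sub, heisLin_apply, heisLin_apply, ← heis_add_time, neg_add_cancel,
      heis_zero]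
  · rw [norm_heis hK, ← smul_sub, norm_smul, Complex.norm_I, one_mul]
    refine le_trans (le_of_eq ?_) (hc u (Ico_subset_Icc_self hu))
    rw [norm_sub_rev]
    congr 1
    simp only [mul_sub, sub_mul]
    abel

end Derivatives

variable {Λ : Type u} [Fintype Λ] [DecidableEq Λ] [MetricSpace Λ] {q : ℕ}
  {h : Finset Λ → Matrix (Λ → Fin q) (Λ → Fin q) ℂ} {J : ℝ}

/-- The weight of the interaction term on `Z`, decaying with the distance from `X`. -/
def weight (h : Finset Λ → Matrix (Λ → Fin q) (Λ → Fin q) ℂ) (X Z : Finset Λ) : ℝ :=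
  ‖h Z‖ * ∑ x ∈ Z, Real.exp (-Metric.infDist x X)

lemma weight_nonneg (h : Finset Λ → Matrix (Λ → Fin q) (Λ → Fin q) ℂ) (X Z : Finset Λ) :
    0 ≤ weight h X Z := by
  unfold weight
  positivity

lemma GeomLocal.dist_le (hh : GeomLocal J h) {Z : Finset Λ} (hZ : h Z ≠ 0) {x y : Λ}
    (hx : x ∈ Z) (hy : y ∈ Z) : dist x y ≤ 1 := by
  refine (Metric.dist_le_diam_of_mem Z.finite_toSet.isBounded hx hy).trans ?_
  by_contra! hlt
  exact hZ (hh.range Z hlt)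

lemma GeomLocal.nonneg (hh : GeomLocal J h) (x : Λ) : 0 ≤ J :=
  (Finset.sum_nonneg fun _ _ => by positivity).trans (hh.strength x)

lemma GeomLocal.weight_le (hh : GeomLocal J h) (X : Finset Λ) {Z : Finset Λ} {x : Λ}
    (hx : x ∈ Z) : weight h X Z ≤
      Real.exp 1 * Real.exp (-Metric.infDist x X) * (Z.card * ‖h Z‖) := by
  rcases eq_or_ne (h Z) 0 with h0 | h0
  · simp [weight, h0]
  · have h1 : ∑ y ∈ Z, Real.exp (-Metric.infDist y X) ≤
        ∑ _y ∈ Z, Real.exp 1 * Real.exp (-Metric.infDist x X) := by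
      refine Finset.sum_le_sum fun y hy => ?_
      rw [← Real.exp_add]
      refine Real.exp_le_exp.2 ?_
      have h2 := Metric.infDist_le_infDist_add_dist (s := (X : Set Λ)) (x := x) (y := y)
      have h3 := hh.dist_le h0 hx hy
      linarith
    rw [Finset.sum_const, nsmul_eq_mul] at h1
    calc weight h X Z ≤ ‖h Z‖ * (Z.card * (Real.exp 1 * Real.exp (-Metric.infDist x X))) :=
          mul_le_mul_of_nonneg_left h1 (norm_nonneg _)
      _ = _ := by ring

/-- Terms that overlap with `Z` are controlled by the sites of `Z`. -/
lemma GeomLocal.sum_weight_le (hh : GeomLocal J h) (X Z : Finset Λ) :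
    ∑ Z' ∈ Finset.univ.filter (fun Z' => ¬ Disjoint Z' Z), weight h X Z' ≤
      Real.exp 1 * J * ∑ x ∈ Z, Real.exp (-Metric.infDist x X) := by
  calc _ ≤ ∑ Z' : Finset Λ, ∑ x ∈ Z, if x ∈ Z' then weight h X Z' else 0 := by
        rw [Finset.sum_filter]
        refine Finset.sum_le_sum fun Z' _ => ?_
        have h0 : ∀ x ∈ Z, 0 ≤ if x ∈ Z' then weight h X Z' else 0 := fun x _ => by
          split_ifs
          exacts [weight_nonneg h X Z', le_rfl]
        by_cases hd : Disjoint Z' Z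
        · rw [if_neg (not_not.2 hd)]
          exact Finset.sum_nonneg h0
        · rw [if_pos hd]
          obtain ⟨x, hx, hx'⟩ := Finset.not_disjoint_iff.1 hd
          refine le_trans (le_of_eq ?_) (Finset.single_le_sum h0 hx')
          rw [if_pos hx]
    _ = ∑ x ∈ Z, ∑ Z' ∈ Finset.univ.filter (fun Z' => x ∈ Z'), weight h X Z' := by
        rw [Finset.sum_comm]
        simp only [Finset.sum_filter]
    _ ≤ ∑ x ∈ Z, Real.exp 1 * Real.exp (-Metric.infDist x X) * J := by
        refine Finset.sum_le_sum fun x _ => ?_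
        calc _ ≤ ∑ Z' ∈ Finset.univ.filter (fun Z' => x ∈ Z'),
              Real.exp 1 * Real.exp (-Metric.infDist x X) * (Z'.card * ‖h Z'‖) :=
              Finset.sum_le_sum fun Z' hZ' => hh.weight_le X (Finset.mem_filter.1 hZ').2
          _ ≤ _ := by
              rw [← Finset.mul_sum]
              exact mul_le_mul_of_nonneg_left (hh.strength x) (by positivity)
    _ = _ := by
        rw [Finset.mul_sum]
        exact Finset.sum_congr rfl fun x _ => by ring

lemma supportedOn_univ (M : Matrix (Λ → Fin q) (Λ → Fin q) ℂ) : SupportedOn univ M := by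
  refine ⟨Matrix.of fun a b => M (fun x => a ⟨x, mem_univ x⟩) fun x => b ⟨x, mem_univ x⟩,
    fun σ τ => ?_⟩
  rw [if_pos fun x hx => absurd (mem_univ x) hx]
  rfl

lemma GeomLocal.isHermitian_sum (hh : GeomLocal J h) (s : Finset (Finset Λ)) :
    (∑ Z ∈ s, h Z).IsHermitian := by
  rw [Matrix.IsHermitian, Matrix.conjTranspose_sum]
  exact Finset.sum_congr rfl fun Z _ => hh.herm Z

/-- At time zero only the terms that meet the support of `B` fail to commute with `B`, and these
have a site at distance at most `ρ` from `X`. -/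
lemma GeomLocal.norm_initial_commutator_le (hh : GeomLocal J h) {X : Finset Λ} {Y : Set Λ}
    {ρ : ℝ} (hY : ∀ y ∈ Y, Metric.infDist y X ≤ ρ) {B : Matrix (Λ → Fin q) (Λ → Fin q) ℂ}
    (hB : SupportedOn Y B) (Z : Finset Λ) :
    ‖B * h Z - h Z * B‖ ≤ 2 * ‖B‖ * Real.exp ρ * weight h X Z := by
  by_cases hd : Disjoint Y Z
  · rw [hB.commute hd (hh.supported Z), sub_self, norm_zero]
    have := weight_nonneg h X Z
    positivity
  · obtain ⟨y, hy, hyZ⟩ := Set.not_disjoint_iff.1 hd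
    have h0 : Real.exp (-ρ) ≤ Real.exp (-Metric.infDist y X) :=
      Real.exp_le_exp.2 (neg_le_neg (hY y hy))
    have h1 : Real.exp (-ρ) ≤ ∑ x ∈ Z, Real.exp (-Metric.infDist x X) := by
      refine h0.trans ?_
      exact Finset.single_le_sum (f := fun x : Λ => Real.exp (-Metric.infDist x (X : Set Λ)))
        (fun x _ => Real.exp_nonneg _) (Finset.mem_coe.1 hyZ)
    have h2 : 1 ≤ Real.exp ρ * ∑ x ∈ Z, Real.exp (-Metric.infDist x X) := by
      calc (1 : ℝ) = Real.exp ρ * Real.exp (-ρ) := by rw [← Real.exp_add]; simp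
        _ ≤ _ := by gcongr
    calc _ ≤ 2 * ‖B‖ * ‖h Z‖ * 1 := by rw [mul_one]; exact GibbsKraus.norm_commutator_le _ _
      _ ≤ 2 * ‖B‖ * ‖h Z‖ * (Real.exp ρ * ∑ x ∈ Z, Real.exp (-Metric.infDist x X)) := by gcongr
      _ = _ := by rw [weight]; ring

/-- A term of weight zero vanishes or is supported on the empty set, hence is a scalar. -/
lemma GeomLocal.commute_of_weight_eq_zero (hh : GeomLocal J h) {X Z : Finset Λ}
    (hZ : weight h X Z = 0) (M : Matrix (Λ → Fin q) (Λ → Fin q) ℂ) : M * h Z = h Z * M := by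
  rcases mul_eq_zero.1 hZ with h0 | h0
  · rw [norm_eq_zero.1 h0, mul_zero, zero_mul]
  · have h2 : Z = ∅ := by
      by_contra hne
      have : 0 < ∑ x ∈ Z, Real.exp (-Metric.infDist x X) :=
        Finset.sum_pos (fun _ _ => Real.exp_pos _) (Finset.nonempty_iff_ne_empty.2 hne)
      exact this.ne' h0
    have h3 := hh.supported Z
    rw [h2, Finset.coe_empty] at h3
    rw [h2]
    exact SupportedOn.commute (Set.disjoint_empty univ) (supportedOn_univ M) h3

lemma hasDerivAt_const_add_exp (a K w κ u : ℝ) :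
    HasDerivAt (fun u => a + K * (w * (Real.exp (κ * u) - 1)))
      (K * (w * (Real.exp (κ * u) * κ))) u := by
  have h1 : HasDerivAt (fun u => Real.exp (κ * u)) (Real.exp (κ * u) * κ) u := by
    simpa using ((hasDerivAt_id u).const_mul κ).exp
  exact (((h1.sub_const 1).const_mul w).const_mul K).const_add a

/-- A bound on all commutators controls the growth of a single one: only the terms overlapping
with `Z` contribute. -/
lemma GeomLocal.norm_commutator_step (hh : GeomLocal J h) {X Z : Finset Λ}
    {B : Matrix (Λ → Fin q) (Λ → Fin q) ℂ} {T C K κ : ℝ} (hκ : κ = 2 * Real.exp 1 * J)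
    (hK : 0 ≤ K) (h0 : ‖B * h Z - h Z * B‖ ≤ C)
    (hc : ∀ Z', ∀ u ∈ Icc 0 T, ‖heis (∑ Z, h Z) u B * h Z' - h Z' * heis (∑ Z, h Z) u B‖ ≤
      K * (weight h X Z' * Real.exp (κ * u))) {t : ℝ} (ht : t ∈ Icc 0 T) :
    ‖heis (∑ Z, h Z) t B * h Z - h Z * heis (∑ Z, h Z) t B‖ ≤
      C + K * (weight h X Z * (Real.exp (κ * t) - 1)) := by
  set H := ∑ Z, h Z with hHdef
  set F := Finset.univ.filter fun Z' => ¬ Disjoint Z' Z with hF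
  set N := ∑ Z' ∈ Finset.univ.filter (fun Z' => ¬ ¬ Disjoint Z' Z), h Z' with hN
  have hNherm : N.IsHermitian := hh.isHermitian_sum _
  have hsplit : H - N = ∑ Z' ∈ F, h Z' := by
    rw [hHdef, ← Finset.sum_filter_add_sum_filter_not Finset.univ fun Z' => ¬ Disjoint Z' Z]
    exact add_sub_cancel_right _ _
  have hcomm : N * h Z = h Z * N := by
    rw [hN, Finset.sum_mul, Finset.mul_sum]
    refine Finset.sum_congr rfl fun Z' hZ' => (hh.supported Z').commute ?_ (hh.supported Z)
    exact Finset.disjoint_coe.2 (not_not.1 (Finset.mem_filter.1 hZ').2)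
  have hder (u : ℝ) := hasDerivAt_heis_neg_commutator (H := H) hcomm B u
  have hnorm (u : ℝ) (hu : u ∈ Ico 0 T) :
      ‖heis N (-u) (Complex.I • (((H - N) * heis H u B - heis H u B * (H - N)) * h Z -
        h Z * ((H - N) * heis H u B - heis H u B * (H - N))))‖ ≤
      K * (weight h X Z * (Real.exp (κ * u) * κ)) := by
    rw [norm_heis hNherm, norm_smul, Complex.norm_I, one_mul, hsplit]
    have h1 : ‖(∑ Z' ∈ F, h Z') * heis H u B - heis H u B * ∑ Z' ∈ F, h Z'‖ ≤
        K * Real.exp (κ * u) *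
          (Real.exp 1 * J * ∑ x ∈ Z, Real.exp (-Metric.infDist x X)) := by
      rw [Finset.sum_mul, Finset.mul_sum, ← Finset.sum_sub_distrib]
      calc _ ≤ ∑ Z' ∈ F, K * Real.exp (κ * u) * weight h X Z' := by
            refine (norm_sum_le _ _).trans (Finset.sum_le_sum fun Z' _ => ?_)
            rw [norm_sub_rev]
            refine (hc Z' u (Ico_subset_Icc_self hu)).trans (le_of_eq ?_)
            ring
        _ ≤ _ := by
            rw [← Finset.mul_sum]
            exact mul_le_mul_of_nonneg_left (hh.sum_weight_le X Z) (by positivity)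
    calc _ ≤ 2 * ‖(∑ Z' ∈ F, h Z') * heis H u B - heis H u B * ∑ Z' ∈ F, h Z'‖ * ‖h Z‖ :=
          GibbsKraus.norm_commutator_le _ _
      _ ≤ 2 * (K * Real.exp (κ * u) *
          (Real.exp 1 * J * ∑ x ∈ Z, Real.exp (-Metric.infDist x X))) * ‖h Z‖ := by gcongr
      _ = _ := by rw [weight, hκ]; ring
  have hmain := image_norm_le_of_norm_deriv_right_le_deriv_boundary
    (fun u _ => (hder u).continuousAt.continuousWithinAt)
    (fun u _ => (hder u).hasDerivWithinAt) (a := 0) (b := T)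
    (B := fun u => C + K * (weight h X Z * (Real.exp (κ * u) - 1)))
    (by simpa [heis_zero] using h0) (fun u => hasDerivAt_const_add_exp _ _ _ _ u) hnorm ht
  rwa [norm_heis hNherm] at hmain

/-- The Lieb-Robinson bound. -/
theorem GeomLocal.norm_commutator_le (hh : GeomLocal J h) {X : Finset Λ}
    {Y : Set Λ} {ρ : ℝ} (hY : ∀ y ∈ Y, Metric.infDist y X ≤ ρ)
    {B : Matrix (Λ → Fin q) (Λ → Fin q) ℂ} (hB : SupportedOn Y B) {T : ℝ} (hT : 0 ≤ T)
    (Z : Finset Λ) :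
    ‖heis (∑ Z, h Z) T B * h Z - h Z * heis (∑ Z, h Z) T B‖ ≤
      2 * ‖B‖ * Real.exp ρ * (weight h X Z * Real.exp (2 * Real.exp 1 * J * T)) := by
  refine le_of_bootstrap (c := fun Z t => ‖heis (∑ Z, h Z) t B * h Z - h Z * heis (∑ Z, h Z) t B‖)
    (b := weight h X) hT (fun Z => ?_) (weight_nonneg h X) (by positivity) (fun Z hZ t => ?_)
    (fun K hK hc Z t ht => ?_) Z
  · have := continuous_heis (∑ Z, h Z) B
    exact ((this.mul continuous_const).sub (continuous_const.mul this)).norm.continuousOn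
  · rw [hh.commute_of_weight_eq_zero hZ, sub_self, norm_zero]
  · exact hh.norm_commutator_step rfl hK (hh.norm_initial_commutator_le hY hB Z) hc ht

end LiebRobinson

/-! ### Localizing the evolution -/

section Localization

set_option linter.unusedSectionVars false

open Set Filter Topology

/-- A bound for `∑_y exp (-dist y x / 4)` under polynomial growth of balls. -/
def growthSum (G : ℝ) (D : ℕ) : ℝ := ∑' k : ℕ, |G| * (1 + (k + 1 : ℝ)) ^ D * Real.exp (-k / 4)

lemma summable_growthSum (G : ℝ) (D : ℕ) :
    Summable fun k : ℕ => |G| * (1 + (k + 1 : ℝ)) ^ D * Real.exp (-k / 4) := by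
  have h1 := (summable_nat_add_iff 2).2
    (Real.summable_pow_mul_exp_neg_nat_mul D (r := 1 / 4) (by norm_num))
  refine (h1.mul_left (|G| * Real.exp (1 / 2))).congr fun k => ?_
  have h2 : Real.exp (-k / 4) = Real.exp (1 / 2) * Real.exp (-(1 / 4) * ((k + 2 : ℕ) : ℝ)) := by
    rw [← Real.exp_add]
    congr 1
    push_cast
    ring
  rw [h2]
  push_cast
  ring

lemma growthSum_nonneg (G : ℝ) (D : ℕ) : 0 ≤ growthSum G D :=
  tsum_nonneg fun _ => by positivity

variable {Λ : Type u} [Fintype Λ] [DecidableEq Λ] [MetricSpace Λ] {q : ℕ}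
  {h : Finset Λ → Matrix (Λ → Fin q) (Λ → Fin q) ℂ} {J G : ℝ} {D : ℕ}

lemma PolyGrowth.sum_exp_le (hG : PolyGrowth Λ G D) (x : Λ) :
    ∑ y, Real.exp (-dist y x / 4) ≤ growthSum G D := by
  classical
  obtain ⟨N, hN⟩ : ∃ N : ℕ, ∀ y : Λ, ⌊dist y x⌋₊ < N := by
    refine ⟨(Finset.univ.sup fun y : Λ => ⌊dist y x⌋₊) + 1, fun y => Nat.lt_succ_of_le ?_⟩
    exact Finset.le_sup (f := fun y : Λ => ⌊dist y x⌋₊) (Finset.mem_univ y)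
  rw [← Finset.sum_fiberwise_of_maps_to (t := Finset.range N) (g := fun y : Λ => ⌊dist y x⌋₊)
    fun y _ => Finset.mem_range.2 (hN y)]
  refine le_trans (Finset.sum_le_sum fun k _ => ?_)
    ((summable_growthSum G D).sum_le_tsum (Finset.range N) fun _ _ => by positivity)
  have h1 : ∀ y ∈ Finset.univ.filter (fun y : Λ => ⌊dist y x⌋₊ = k),
      Real.exp (-dist y x / 4) ≤ Real.exp (-k / 4) := by
    intro y hy
    have h2 : ((⌊dist y x⌋₊ : ℕ) : ℝ) ≤ dist y x := Nat.floor_le dist_nonneg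
    rw [(Finset.mem_filter.1 hy).2] at h2
    refine Real.exp_le_exp.2 ?_
    linarith
  refine (Finset.sum_le_card_nsmul _ _ _ h1).trans ?_
  rw [nsmul_eq_mul]
  refine mul_le_mul_of_nonneg_right ?_ (Real.exp_pos _).le
  have h3 : (Finset.univ.filter fun y : Λ => ⌊dist y x⌋₊ = k).card ≤
      (Metric.closedBall x (k + 1 : ℝ)).ncard := by
    rw [← ncard_coe_finset]
    refine ncard_le_ncard (fun y hy => ?_) (toFinite _)
    have h4 : dist y x < ⌊dist y x⌋₊ + 1 := Nat.lt_floor_add_one _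
    have h5 := (Finset.mem_filter.1 (Finset.mem_coe.1 hy)).2
    rw [h5] at h4
    exact h4.le
  calc ((Finset.univ.filter fun y : Λ => ⌊dist y x⌋₊ = k).card : ℝ) ≤
        (Metric.closedBall x (k + 1 : ℝ)).ncard := by exact_mod_cast h3
    _ ≤ G * (1 + (k + 1 : ℝ)) ^ D := hG x _ (by positivity)
    _ ≤ |G| * (1 + (k + 1 : ℝ)) ^ D := by
        gcongr
        exact le_abs_self G

lemma exists_infDist_eq_dist {X : Finset Λ} (hX : X.Nonempty) (y : Λ) :
    ∃ x ∈ X, Metric.infDist y X = dist y x := by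
  obtain ⟨x, hx, h⟩ := X.finite_toSet.isCompact.exists_infDist_eq_dist (by exact_mod_cast hX) y
  exact ⟨x, hx, h⟩

lemma mem_nbhd_iff {X : Finset Λ} (hX : X.Nonempty) {r : ℝ} {y : Λ} :
    y ∈ nbhd X r ↔ Metric.infDist y X ≤ r := by
  constructor
  · rintro ⟨x, hx, hxy⟩
    rw [dist_comm] at hxy
    exact (Metric.infDist_le_dist_of_mem (Finset.mem_coe.2 hx)).trans hxy
  · intro h
    obtain ⟨x, hx, hxy⟩ := exists_infDist_eq_dist hX y
    exact ⟨x, hx, by rwa [dist_comm, ← hxy]⟩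

lemma PolyGrowth.sum_exp_infDist_le (hG : PolyGrowth Λ G D) {X : Finset Λ} (hX : X.Nonempty) :
    ∑ y, Real.exp (-Metric.infDist y (X : Set Λ) / 4) ≤ X.card * growthSum G D := by
  calc _ ≤ ∑ y, ∑ x ∈ X, Real.exp (-dist y x / 4) := by
        refine Finset.sum_le_sum fun y _ => ?_
        obtain ⟨x, hx, hxy⟩ := exists_infDist_eq_dist hX y
        rw [hxy]
        exact Finset.single_le_sum (f := fun x : Λ => Real.exp (-dist y x / 4))
          (fun x _ => Real.exp_nonneg _) hx
    _ = ∑ x ∈ X, ∑ y, Real.exp (-dist y x / 4) := Finset.sum_comm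
    _ ≤ ∑ _x ∈ X, growthSum G D := Finset.sum_le_sum fun x _ => hG.sum_exp_le x
    _ = _ := by rw [Finset.sum_const, nsmul_eq_mul]

open scoped Classical in
/-- The part of the interaction that is contained in `R`. -/
def restrictedSum (h : Finset Λ → Matrix (Λ → Fin q) (Λ → Fin q) ℂ) (R : Set Λ) :
    Matrix (Λ → Fin q) (Λ → Fin q) ℂ :=
  ∑ Z ∈ Finset.univ.filter (fun Z : Finset Λ => (Z : Set Λ) ⊆ R), h Z

lemma GeomLocal.restrictedSum_mem (hh : GeomLocal J h) (R : Set Λ) :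
    restrictedSum h R ∈ supportedSubalgebra R q :=
  sum_mem fun Z hZ => SupportedOn.mono (by simpa using hZ) (hh.supported Z)

lemma GeomLocal.weight_le_of_not_subset (hh : GeomLocal J h) {X Z : Finset Λ} (hX : X.Nonempty)
    {r : ℝ} (hZ : ¬ (Z : Set Λ) ⊆ nbhd X r) :
    weight h X Z ≤ ∑ x ∈ Z, Real.exp (3 / 4) * Real.exp (-(3 / 4 * r)) *
      Real.exp (-Metric.infDist x (X : Set Λ) / 4) * (Z.card * ‖h Z‖) := by
  rcases eq_or_ne (h Z) 0 with hz | hz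
  · rw [weight, hz, norm_zero, zero_mul]
    simp
  obtain ⟨y, hyZ, hy⟩ := Set.not_subset.1 hZ
  rw [mem_nbhd_iff hX, not_le] at hy
  rw [weight, Finset.mul_sum]
  refine Finset.sum_le_sum fun x hx => ?_
  have h1 := Metric.infDist_le_infDist_add_dist (s := (X : Set Λ)) (x := y) (y := x)
  have h2 := hh.dist_le hz (Finset.mem_coe.1 hyZ) hx
  have h3 : Real.exp (-Metric.infDist x (X : Set Λ)) ≤ Real.exp (3 / 4) *
      Real.exp (-(3 / 4 * r)) * Real.exp (-Metric.infDist x (X : Set Λ) / 4) := by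
    rw [← Real.exp_add, ← Real.exp_add]
    refine Real.exp_le_exp.2 ?_
    linarith
  have h4 : (1 : ℝ) ≤ Z.card := by exact_mod_cast Finset.card_pos.2 ⟨x, hx⟩
  calc ‖h Z‖ * Real.exp (-Metric.infDist x (X : Set Λ)) ≤ (Z.card * ‖h Z‖) *
        (Real.exp (3 / 4) * Real.exp (-(3 / 4 * r)) *
          Real.exp (-Metric.infDist x (X : Set Λ) / 4)) :=
        mul_le_mul (le_mul_of_one_le_left (norm_nonneg _) h4) h3 (Real.exp_nonneg _)
          (by positivity)
    _ = _ := mul_comm _ _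

/-- The terms that reach beyond `X^{+r}` have exponentially small weight. -/
lemma GeomLocal.sum_weight_outside_le (hh : GeomLocal J h) (hG : PolyGrowth Λ G D)
    {X : Finset Λ} (hX : X.Nonempty) (r : ℝ)
    [DecidablePred fun Z : Finset Λ => ¬ (Z : Set Λ) ⊆ nbhd X r] :
    ∑ Z ∈ Finset.univ.filter (fun Z : Finset Λ => ¬ (Z : Set Λ) ⊆ nbhd X r), weight h X Z ≤
      Real.exp (3 / 4) * Real.exp (-(3 / 4 * r)) * J * (X.card * growthSum G D) := by
  have hJ : 0 ≤ J := hh.nonneg hX.choose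
  set a := Real.exp (3 / 4) * Real.exp (-(3 / 4 * r)) with ha
  set e : Λ → ℝ := fun x => Real.exp (-Metric.infDist x (X : Set Λ) / 4) with he
  have ha0 : 0 ≤ a := by positivity
  have he0 (x : Λ) : 0 ≤ e x := Real.exp_nonneg _
  calc _ ≤ ∑ Z : Finset Λ, ∑ x ∈ Z, a * e x * (Z.card * ‖h Z‖) := by
        refine (Finset.sum_le_sum fun Z hZ =>
          hh.weight_le_of_not_subset hX (Finset.mem_filter.1 hZ).2).trans ?_
        refine Finset.sum_le_sum_of_subset_of_nonneg (Finset.filter_subset _ _) fun Z _ _ => ?_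
        exact Finset.sum_nonneg fun x _ => mul_nonneg (mul_nonneg ha0 (he0 x)) (by positivity)
    _ = ∑ x, a * e x * ∑ Z ∈ Finset.univ.filter (fun Z : Finset Λ => x ∈ Z), Z.card * ‖h Z‖ := by
        simp only [Finset.mul_sum]
        exact Finset.sum_comm' fun Z x => by simp
    _ ≤ ∑ x, a * J * e x := by
        refine Finset.sum_le_sum fun x _ => ?_
        rw [mul_right_comm a J]
        exact mul_le_mul_of_nonneg_left (hh.strength x) (mul_nonneg ha0 (he0 x))
    _ ≤ _ := by
        rw [← Finset.mul_sum]
        exact mul_le_mul_of_nonneg_left (hG.sum_exp_infDist_le hX) (mul_nonneg ha0 hJ)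

lemma heis_neg (H : Matrix (Λ → Fin q) (Λ → Fin q) ℂ) (t : ℝ)
    (B : Matrix (Λ → Fin q) (Λ → Fin q) ℂ) : heis (-H) t B = heis H (-t) B := by
  simp [heis]

lemma GeomLocal.neg (hh : GeomLocal J h) : GeomLocal J fun Z => -h Z where
  herm Z := (hh.herm Z).neg
  supported Z := neg_mem (show h Z ∈ supportedSubalgebra (Z : Set Λ) q from hh.supported Z)
  range Z hZ := by rw [hh.range Z hZ, neg_zero]
  strength x := by simpa only [norm_neg] using hh.strength x

lemma GeomLocal.norm_heis_sub_heis_restrictedSum_le_of_nonneg (hh : GeomLocal J h)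
    (hG : PolyGrowth Λ G D) {X : Finset Λ} (hX : X.Nonempty) {r : ℝ}
    {B : Matrix (Λ → Fin q) (Λ → Fin q) ℂ} (hB : SupportedOn (nbhd X (r / 2)) B) {t : ℝ}
    (ht : 0 ≤ t) :
    ‖heis (∑ Z, h Z) t B - heis (restrictedSum h (nbhd X r)) t B‖ ≤
      2 * Real.exp 1 * J * growthSum G D * X.card * ‖B‖ *
        Real.exp ((2 * Real.exp 1 * J + 1) * t) * Real.exp (-(r / 4)) := by
  classical
  have hJ : 0 ≤ J := hh.nonneg hX.choose
  have hS := growthSum_nonneg G D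
  set H' := restrictedSum h (nbhd X r) with hH'
  have hsub : (∑ Z, h Z) - H' =
      ∑ Z ∈ Finset.univ.filter (fun Z : Finset Λ => ¬ (Z : Set Λ) ⊆ nbhd X r), h Z := by
    rw [hH', restrictedSum, ← Finset.sum_filter_add_sum_filter_not Finset.univ
      fun Z : Finset Λ => (Z : Set Λ) ⊆ nbhd X r]
    exact add_sub_cancel_left _ _
  have h1 := norm_heis_sub_heis_le (H := ∑ Z, h Z) (K := H')
    (hh.isHermitian_sum _) (c := 2 * ‖B‖ * Real.exp (r / 2) * Real.exp (2 * Real.exp 1 * J * t) *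
      (Real.exp (3 / 4) * Real.exp (-(3 / 4 * r)) * J * (X.card * growthSum G D))) ht B
    fun u hu => ?_
  · refine h1.trans ?_
    have h2 : t ≤ Real.exp t := by linarith [Real.add_one_le_exp t]
    have h3 : Real.exp (3 / 4) ≤ Real.exp 1 := Real.exp_le_exp.2 (by norm_num)
    have h4 : Real.exp (r / 2) * Real.exp (-(3 / 4 * r)) = Real.exp (-(r / 4)) := by
      rw [← Real.exp_add]; congr 1; ring
    have h5 : Real.exp ((2 * Real.exp 1 * J + 1) * t) =
        Real.exp (2 * Real.exp 1 * J * t) * Real.exp t := by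
      rw [← Real.exp_add]; congr 1; ring
    calc _ = 2 * Real.exp (3 / 4) * J * growthSum G D * X.card * ‖B‖ *
          (Real.exp (2 * Real.exp 1 * J * t) * t) *
          (Real.exp (r / 2) * Real.exp (-(3 / 4 * r))) := by ring
      _ ≤ _ := by
        rw [h4, h5]
        gcongr
  · rw [hsub, Finset.mul_sum, Finset.sum_mul, ← Finset.sum_sub_distrib]
    calc _ ≤ ∑ Z ∈ Finset.univ.filter (fun Z : Finset Λ => ¬ (Z : Set Λ) ⊆ nbhd X r),
          2 * ‖B‖ * Real.exp (r / 2) * Real.exp (2 * Real.exp 1 * J * t) * weight h X Z := by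
          refine (norm_sum_le _ _).trans (Finset.sum_le_sum fun Z _ => ?_)
          have h2 := hh.norm_commutator_le (fun y hy => (mem_nbhd_iff hX).1 hy) hB hu.1 Z
          have h3 := weight_nonneg h X Z
          calc _ ≤ _ := h2
            _ = 2 * ‖B‖ * Real.exp (r / 2) * Real.exp (2 * Real.exp 1 * J * u) *
                weight h X Z := by ring
            _ ≤ _ := by
              have := hu.2
              gcongr
      _ ≤ _ := by
          rw [← Finset.mul_sum]
          exact mul_le_mul_of_nonneg_left (hh.sum_weight_outside_le hG hX r) (by positivity)

/-- Up to an exponentially small error the evolution of an operator near `X` is generated by the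
terms of the interaction that are contained in `X^{+r}`. -/
theorem GeomLocal.norm_heis_sub_heis_restrictedSum_le (hh : GeomLocal J h)
    (hG : PolyGrowth Λ G D) {X : Finset Λ} (hX : X.Nonempty) {r : ℝ}
    {B : Matrix (Λ → Fin q) (Λ → Fin q) ℂ} (hB : SupportedOn (nbhd X (r / 2)) B) (t : ℝ) :
    ‖heis (∑ Z, h Z) t B - heis (restrictedSum h (nbhd X r)) t B‖ ≤
      2 * Real.exp 1 * J * growthSum G D * X.card * ‖B‖ *
        Real.exp ((2 * Real.exp 1 * J + 1) * |t|) * Real.exp (-(r / 4)) := by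
  rcases le_total 0 t with ht | ht
  · rw [abs_of_nonneg ht]
    exact hh.norm_heis_sub_heis_restrictedSum_le_of_nonneg hG hX hB ht
  · have h1 := hh.neg.norm_heis_sub_heis_restrictedSum_le_of_nonneg hG hX hB (neg_nonneg.2 ht)
    have h2 : restrictedSum (fun Z => -h Z) (nbhd X r) = -restrictedSum h (nbhd X r) := by
      simp only [restrictedSum, Finset.sum_neg_distrib]
    rw [h2, Finset.sum_neg_distrib, heis_neg, heis_neg, neg_neg] at h1
    rwa [abs_of_nonpos ht]

end Localization

/-! ### Exchanging the generator in a linear combination -/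

section Comparison

variable {n : Type u} [Fintype n] [DecidableEq n] {H K M : Matrix n n ℂ}

lemma norm_one_le_one : ‖(1 : Matrix n n ℂ)‖ ≤ 1 := by
  rcases isEmpty_or_nonempty n with hn | hn
  · rw [Subsingleton.elim (1 : Matrix n n ℂ) 0, norm_zero]
    exact zero_le_one
  · rw [norm_one]

lemma norm_prod_ofFn_sub_le {k : ℕ} {f g : Fin k → Matrix n n ℂ} {μ δ : ℝ} (hμ : 1 ≤ μ)
    (hf : ∀ i, ‖f i‖ ≤ μ) (hg : ∀ i, ‖g i‖ ≤ μ) (hδ : ∀ i, ‖f i - g i‖ ≤ δ) :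
    ‖(List.ofFn f).prod - (List.ofFn g).prod‖ ≤ k * (μ ^ k * δ) := by
  induction k with
  | zero => simp
  | succ k ih =>
    have hδ0 : 0 ≤ δ := (norm_nonneg _).trans (hδ 0)
    have hμ0 : 0 ≤ μ := by linarith
    rw [List.ofFn_succ, List.ofFn_succ, List.prod_cons, List.prod_cons]
    set P := (List.ofFn fun i => f (Fin.succ i)).prod
    set Q := (List.ofFn fun i => g (Fin.succ i)).prod
    have h1 : ‖P‖ ≤ μ ^ k := (norm_prod_ofFn_le fun i => hf _).trans
      (mul_le_of_le_one_left (by positivity) norm_one_le_one)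
    have h2 : f 0 * P - g 0 * Q = (f 0 - g 0) * P + g 0 * (P - Q) := by noncomm_ring
    rw [h2]
    calc _ ≤ ‖f 0 - g 0‖ * ‖P‖ + ‖g 0‖ * ‖P - Q‖ :=
          (norm_add_le _ _).trans (add_le_add (norm_mul_le _ _) (norm_mul_le _ _))
      _ ≤ δ * μ ^ k + μ * (k * (μ ^ k * δ)) := by
          gcongr
          · exact hδ 0
          · exact hg 0
          · exact ih (fun i => hf _) (fun i => hg _) fun i => hδ _
      _ ≤ μ * (μ ^ k * δ) + μ * (k * (μ ^ k * δ)) := by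
          have : 1 * (μ ^ k * δ) ≤ μ * (μ ^ k * δ) := by gcongr
          linarith
      _ = _ := by push_cast; ring

/-- Exchanging the generator of the evolution in a linear combination of products. -/
lemma IsCombination.exists_near {m : ℕ} {τ W μ δ : ℝ} {B : Matrix n n ℂ}
    (hB : IsCombination H M m τ W B) (hH : H.IsHermitian) (hK : K.IsHermitian) (hμ : 1 ≤ μ)
    (hM : ‖M‖ ≤ μ) (hτ : 0 ≤ τ) (hδ0 : 0 ≤ δ)
    (hδ : ∀ t : ℝ, |t| ≤ m * τ → ‖heis H t M - heis K t M‖ ≤ δ) :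
    ∃ B', IsCombination K M m τ W B' ∧ ‖B - B'‖ ≤ W * (m * (μ ^ m * δ)) := by
  obtain ⟨ι, _, w, k, t, h1, h2, h3, rfl⟩ := hB
  refine ⟨_, ⟨ι, inferInstance, w, k, t, h1, h2, h3, rfl⟩, ?_⟩
  rw [← Finset.sum_sub_distrib]
  calc _ ≤ ∑ j, ‖w j‖ * (m * (μ ^ m * δ)) := by
        refine (norm_sum_le _ _).trans (Finset.sum_le_sum fun j _ => ?_)
        rw [← smul_sub, norm_smul]
        refine mul_le_mul_of_nonneg_left ?_ (norm_nonneg _)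
        have h4 : (k j : ℝ) ≤ m := by exact_mod_cast h2 j
        refine (norm_prod_ofFn_sub_le hμ (fun i => (norm_heis hH _ _).le.trans hM)
          (fun i => (norm_heis hK _ _).le.trans hM) fun i => hδ _ ((h3 j i).trans ?_)).trans ?_
        · gcongr
        · gcongr
          exact h2 j
    _ = (∑ j, ‖w j‖) * (m * (μ ^ m * δ)) := by rw [Finset.sum_mul]
    _ ≤ _ := mul_le_mul_of_nonneg_right h1 (by positivity)

lemma IsCombination.mem {A : Subalgebra ℂ (Matrix n n ℂ)} {m : ℕ} {τ W : ℝ} {B : Matrix n n ℂ}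
    (hB : IsCombination K M m τ W B) (hA : ∀ t, heis K t M ∈ A) : B ∈ A := by
  obtain ⟨ι, _, w, k, t, -, -, -, rfl⟩ := hB
  refine sum_mem fun j _ => Subalgebra.smul_mem _ (list_prod_mem fun x hx => ?_) _
  obtain ⟨i, rfl⟩ := (List.mem_ofFn' _ _).1 hx
  exact hA _

end Comparison

/-! ### Quasi-locality -/

section Parameters

variable {ε L : ℝ}

lemma log_one_div_le (hε : 0 < ε) (hL : Real.exp (-L) ≤ ε) : Real.log (1 / ε) ≤ L := by
  have h1 := (Real.le_log_iff_exp_le hε).2 hL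
  rw [one_div, Real.log_inv]
  linarith

lemma order_le (hε : 0 < ε) (hε1 : ε ≤ 1) (hL : Real.exp (-L) ≤ ε) :
    (order ε : ℝ) ≤ 3 / 2 * L := by
  have h1 := log_one_div_le hε hL
  have h2 := Real.log_two_gt_d9
  have h3 : 0 ≤ Real.log (1 / ε) := Real.log_nonneg ((one_le_div hε).2 hε1)
  refine (Nat.floor_le (div_nonneg h3 (by linarith))).trans ?_
  rw [div_le_iff₀ (by linarith)]
  nlinarith

lemma cutoff_le (hε : 0 < ε) (hL1 : 1 ≤ L) (hL : Real.exp (-L) ≤ ε) : cutoff ε ≤ 1 / 2 * L := by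
  have h1 := log_one_div_le hε hL
  have h2 := Real.log_two_lt_d9
  have hπ := Real.pi_gt_three
  have h3 : Real.log (4 / ε) = 2 * Real.log 2 + Real.log (1 / ε) := by
    rw [show 4 / ε = 2 ^ 2 * (1 / ε) by ring, Real.log_mul (by norm_num) (by positivity),
      Real.log_pow]
    norm_num
  rw [cutoff, h3, div_le_iff₀ (by positivity)]
  nlinarith

lemma normS_le {h : ℝ} (hh : 0 ≤ h) (hε : 0 < ε) (hε1 : ε ≤ 1) (hL1 : 1 ≤ L)
    (hL : Real.exp (-L) ≤ ε) : normS h ε ≤ 4 * superopBound h * L := by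
  have hπ := Real.pi_gt_three
  have h0 := one_le_superopBound hh
  have h1 := log_one_div_le hε hL
  have h2 : Real.log (1 + 2 * h / (ε * Real.pi)) ≤
      Real.log (1 / ε) + 2 * Real.log (1 + h / 2) := by
    have h3 : 1 + 2 * h / (ε * Real.pi) ≤ 1 / ε * (1 + h / 2) ^ 2 := by
      rw [show 1 / ε * (1 + h / 2) ^ 2 = 1 / ε + (h + h ^ 2 / 4) / ε by ring]
      have h4 : 1 ≤ 1 / ε := (one_le_div hε).2 hε1
      have h5 : 2 * h / (ε * Real.pi) ≤ (h + h ^ 2 / 4) / ε := by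
        rw [div_le_div_iff₀ (by positivity) hε]
        have : 0 ≤ h * ε := by positivity
        nlinarith [mul_nonneg (sq_nonneg h) (mul_pos hε Real.pi_pos).le]
      linarith
    refine (Real.log_le_log (by positivity) h3).trans (le_of_eq ?_)
    rw [Real.log_mul (by positivity) (by positivity), Real.log_pow]
    norm_num
  have h3 : 2 / Real.pi * Real.log (1 + 2 * h / (ε * Real.pi)) ≤
      L + 4 * (superopBound h - 1) := by
    calc _ ≤ 2 / Real.pi * (L + 2 * Real.log (1 + h / 2)) :=
          mul_le_mul_of_nonneg_left (by linarith) (by positivity)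
      _ = 2 / Real.pi * L + 4 * (superopBound h - 1) := by rw [superopBound]; ring
      _ ≤ 1 * L + 4 * (superopBound h - 1) := by
          gcongr
          rw [div_le_one Real.pi_pos]
          linarith
      _ = _ := by rw [one_mul]
  rw [normS]
  nlinarith

/-- All polynomial factors and the growth of the light cone are absorbed by `exp (-r / 4)` when `r`
is at least of order `L ^ 3`. -/
lemma mul_pow_mul_exp_le {κ r : ℝ} {m : ℕ} (hL1 : 1 ≤ L) (hm : (m : ℝ) ≤ 3 / 2 * L)
    (hr : 4 * (9 + κ) * L ^ 3 ≤ r) :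
    m * (L ^ 2) ^ m * L ^ 2 * Real.exp ((κ + 1) * L ^ 3) * Real.exp (-(r / 4)) ≤
      Real.exp (-L) := by
  have hLL : L ≤ L ^ 3 := le_self_pow₀ hL1 (by norm_num)
  have hL23 : L ^ 2 ≤ L ^ 3 := pow_le_pow_right₀ hL1 (by norm_num)
  have hexp := Real.add_one_le_exp (2 * L ^ 3)
  have hexpL : L ≤ Real.exp L := by linarith [Real.add_one_le_exp L]
  have h1 : (m : ℝ) ≤ Real.exp (2 * L ^ 3) := by linarith
  have h2 : (L ^ 2) ^ m ≤ Real.exp (3 * L ^ 3) := by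
    calc (L ^ 2) ^ m ≤ (Real.exp L ^ 2) ^ m := by gcongr
      _ = Real.exp (2 * m * L) := by
          rw [← pow_mul, ← Real.exp_nat_mul]
          push_cast
          rfl
      _ ≤ _ := by
          refine Real.exp_le_exp.2 ?_
          have : (m : ℝ) * L ≤ 3 / 2 * L * L := by gcongr
          linarith
  have h3 : L ^ 2 ≤ Real.exp (2 * L ^ 3) := by linarith
  calc _ ≤ Real.exp (2 * L ^ 3) * Real.exp (3 * L ^ 3) *
        Real.exp (2 * L ^ 3) * Real.exp ((κ + 1) * L ^ 3) * Real.exp (-(r / 4)) := by gcongr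
    _ ≤ _ := by
        rw [← Real.exp_add, ← Real.exp_add, ← Real.exp_add, ← Real.exp_add]
        refine Real.exp_le_exp.2 ?_
        linarith

end Parameters

lemma norm_le_of_norm_sub_le {E : Type*} [NormedAddCommGroup E] {x y : E} {s ε : ℝ} (hs : 0 < s)
    (hε : ε ≤ 1 / 2) (hx : ‖x‖ ≤ 1 / (32 * s ^ 2)) (hxy : ‖x - y‖ ≤ ε / (16 * s ^ 2)) :
    ‖y‖ ≤ 1 / (16 * s ^ 2) := by
  have h1 : ‖y‖ ≤ ‖x‖ + ‖x - y‖ := by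
    simpa [sub_sub_cancel] using norm_sub_le x (x - y)
  have h2 : ε / (16 * s ^ 2) ≤ (1 / 2) / (16 * s ^ 2) := by gcongr
  have h3 : 1 / (32 * s ^ 2) + (1 / 2) / (16 * s ^ 2) = 1 / (16 * s ^ 2) := by
    field_simp
    norm_num
  linarith

/-- The Kraus operator is close to `1`, without any assumption of locality. -/
lemma norm_krausOp_sub_one_le {n : Type u} [Fintype n] [DecidableEq n] {H O : Matrix n n ℂ}
    (hH : H.IsHermitian) (hO : O.IsHermitian) (hOs : ‖O‖ ≤ 1 / (16 * superopBound ‖H‖ ^ 2)) :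
    ‖krausOp H O - 1‖ ≤ 1 / 2 := by
  have h0 := one_le_superopBound (norm_nonneg H)
  obtain ⟨N, -, -, hN, hK⟩ := exists_krausOp_eq hH hO (s := superopBound ‖H‖) (by linarith)
    (superopNormLE_opSpm hH) hOs
  have h1 : ‖opSpm hH false N‖ ≤ superopBound ‖H‖ * ‖N‖ := superopNormLE_opSpm hH false N
  rw [hK, sub_sub_cancel_left, norm_neg]
  have := norm_nonneg N
  nlinarith

section QuasiLocality

set_option linter.unusedSectionVars false

variable {Λ : Type u} [Fintype Λ] [DecidableEq Λ] [MetricSpace Λ] {q : ℕ}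
  {h : Finset Λ → Matrix (Λ → Fin q) (Λ → Fin q) ℂ} {J G : ℝ} {D : ℕ}

lemma nbhd_mono (X : Finset Λ) {r r' : ℝ} (hr : r ≤ r') : nbhd X r ⊆ nbhd X r' :=
  fun _ ⟨x, hx, hxy⟩ => ⟨x, hx, hxy.trans hr⟩

/-- If `O` is close to an operator `O'` on `X^{+r/2}`, then `krausOp H O` is close to an operator
on `X^{+r}`: the combination of products of evolved copies of `O'`, with the evolution generated
by the terms inside `X^{+r}`. -/
lemma GeomLocal.exists_supportedOn_near_krausOp (hh : GeomLocal J h) (hG : PolyGrowth Λ G D)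
    {X : Finset Λ} (hX : X.Nonempty) {O O' : Matrix (Λ → Fin q) (Λ → Fin q) ℂ}
    (hO : O.IsHermitian) {r ε L κ : ℝ} (hr : 0 ≤ r) (hε2 : ε ≤ 1 / 2) (hL1 : 1 ≤ L)
    (hL : Real.exp (-L) ≤ ε) (hκ : κ = 2 * Real.exp 1 * J) (hLr : 4 * (9 + κ) * L ^ 3 ≤ r)
    (hOs : ‖O‖ ≤ 1 / (32 * superopBound ‖∑ Z, h Z‖ ^ 2))
    (hO' : SupportedOn (nbhd X (r / 2)) O')
    (hOO : ‖O - O'‖ ≤ ε / (16 * superopBound ‖∑ Z, h Z‖ ^ 2)) :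
    ∃ B, SupportedOn (nbhd X r) B ∧ ‖krausOp (∑ Z, h Z) O - B‖ ≤
      ε + 2 * (κ * growthSum G D) * X.card * Real.exp (-L) := by
  have hJ : 0 ≤ J := hh.nonneg hX.choose
  have hκ0 : 0 ≤ κ := by rw [hκ]; positivity
  have hS := growthSum_nonneg G D
  have hε : 0 < ε := (Real.exp_pos _).trans_le hL
  have hLpos : 0 < L := by linarith
  set H := ∑ Z, h Z with hHdef
  have hH : H.IsHermitian := hh.isHermitian_sum _
  have hHn := norm_nonneg H
  have hs0 := one_le_superopBound hHn
  set s₀ := superopBound ‖H‖ with hs₀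
  have hs := one_le_normS hHn hε
  have hsL : normS ‖H‖ ε ≤ 4 * s₀ * L := normS_le hHn hε (by linarith) hL1 hL
  set s := normS ‖H‖ ε with hsdef
  have hOs16 : ‖O‖ ≤ 1 / (16 * s₀ ^ 2) :=
    hOs.trans (one_div_le_one_div_of_le (by positivity) (by nlinarith))
  have hOs' : ‖O'‖ ≤ 1 / (16 * s₀ ^ 2) := norm_le_of_norm_sub_le (by linarith) hε2 hOs hOO
  have hτ := cutoff_pos hε hε2
  have hτL := cutoff_le hε hL1 hL
  have hmL := order_le hε (by linarith) hL
  obtain ⟨B, hB, hKB⟩ := exists_isCombination_near_krausOp hH hO hε hε2 hOs16 hOs' hOO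
  set M := s ^ 2 • O' with hM
  set m := order ε with hm
  have hMs : SupportedOn (nbhd X (r / 2)) M :=
    Subalgebra.smul_mem (supportedSubalgebra (nbhd X (r / 2)) q) hO' ((s ^ 2 : ℝ) : ℂ)
  have hMn : ‖M‖ ≤ L ^ 2 := by
    rw [hM, norm_smul, Real.norm_of_nonneg (by positivity)]
    calc s ^ 2 * ‖O'‖ ≤ (4 * s₀ * L) ^ 2 * (1 / (16 * s₀ ^ 2)) := by gcongr
      _ = L ^ 2 := by field_simp; norm_num
  have hμ : 1 ≤ L ^ 2 := one_le_pow₀ hL1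
  have hL23 : L ^ 2 ≤ L ^ 3 := pow_le_pow_right₀ hL1 (by norm_num)
  have hmτ : m * cutoff ε ≤ L ^ 3 := by
    calc m * cutoff ε ≤ (3 / 2 * L) * (1 / 2 * L) := by gcongr
      _ ≤ L ^ 3 := by nlinarith
  set δ := κ * growthSum G D * X.card * L ^ 2 * Real.exp ((κ + 1) * L ^ 3) * Real.exp (-(r / 4))
    with hδ
  obtain ⟨B', hB', hBB'⟩ := hB.exists_near (K := restrictedSum h (nbhd X r)) (δ := δ) hH
    (hh.isHermitian_sum _) hμ hMn hτ.le (by positivity) fun t ht => by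
      refine (hh.norm_heis_sub_heis_restrictedSum_le hG hX hMs t).trans ?_
      rw [← hκ, hδ]
      have := ht.trans hmτ
      gcongr
  refine ⟨B', hB'.mem (A := supportedSubalgebra (nbhd X r) q) fun t =>
    heis_mem_supportedSubalgebra (hh.restrictedSum_mem _)
      (SupportedOn.mono (nbhd_mono X (by linarith)) hMs) t, ?_⟩
  have h4 : 2 * (m * ((L ^ 2) ^ m * δ)) ≤
      2 * (κ * growthSum G D) * X.card * Real.exp (-L) := by
    calc _ = 2 * (κ * growthSum G D) * X.card * (m * (L ^ 2) ^ m * L ^ 2 *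
          Real.exp ((κ + 1) * L ^ 3) * Real.exp (-(r / 4))) := by rw [hδ]; ring
      _ ≤ _ := mul_le_mul_of_nonneg_left (mul_pow_mul_exp_le hL1 hmL hLr) (by positivity)
  calc ‖krausOp H O - B'‖ = ‖(krausOp H O - B) + (B - B')‖ := by rw [sub_add_sub_cancel]
    _ ≤ ε + 2 * (m * ((L ^ 2) ^ m * δ)) := (norm_add_le _ _).trans (add_le_add hKB hBB')
    _ ≤ _ := by linarith

/-- Stretched-exponential decay with a slower rate and a smaller exponent. -/
lemma rpow_div_le_rpow_div {r ξ ξ' α β : ℝ} (hξ : 0 < ξ) (hξ' : 2 * ξ ≤ ξ') (hβ : β ≤ α)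
    (hα : 0 ≤ α) (hr : 1 ≤ r / ξ') : (r / ξ') ^ β ≤ (r / 2 / ξ) ^ α := by
  have hξ0 : 0 < ξ' := by linarith
  have hr0 : 0 ≤ r := by
    rw [one_le_div hξ0] at hr
    linarith
  refine (Real.rpow_le_rpow_of_exponent_le hr hβ).trans ?_
  refine Real.rpow_le_rpow (by positivity) ?_ hα
  rw [div_div]
  gcongr

/-- Quasi-locality of the Kraus operator. The precision `ε` is the larger one of `exp (-L)` and of
the error that replacing `O` by an operator on `X^{+r/2}` causes. -/
theorem quasiLocal_krausOp (G J ξ α : ℝ) (D : ℕ) (hξ : 0 < ξ) (hα : 0 < α) :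
    ∃ C ξ' : ℝ, 0 < C ∧ 0 < ξ' ∧
        ∀ (Λ : Type u) [Fintype Λ] [DecidableEq Λ] [MetricSpace Λ] (q : ℕ)
          (h : Finset Λ → Matrix (Λ → Fin q) (Λ → Fin q) ℂ)
          (O : Matrix (Λ → Fin q) (Λ → Fin q) ℂ) (X : Finset Λ) (A : ℝ),
          PolyGrowth Λ G D → GeomLocal J h → O.IsHermitian →
          ‖O‖ ≤ 1 / 128 / Real.log (‖∑ Z, h Z‖ + 2) ^ 2 → X.Nonempty → 0 ≤ A →
          QuasiLocal X (fun r => A * Real.exp (-(r / ξ) ^ α)) O →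
          QuasiLocal X
            (fun r => C * (1 + A * Real.log (‖∑ Z, h Z‖ + 2) ^ 2) * X.card
              * Real.exp (-(r / ξ') ^ min α (1 / 3)))
            (krausOp (∑ Z, h Z) O) := by
  have hS := growthSum_nonneg G D
  set κ := 2 * Real.exp 1 * |J| with hκ
  have hκ0 : 0 ≤ κ := by positivity
  set ξ' := max (2 * ξ) (4 * (9 + κ)) with hξ'
  have hξ'0 : 0 < ξ' := lt_max_of_lt_left (by linarith)
  refine ⟨64 + 2 * (κ * growthSum G D), ξ', by positivity, hξ'0,
    fun Λ _ _ _ q h O X A hG hh hO hOs hX hA hQ r hr => ?_⟩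
  have hJ : 0 ≤ J := hh.nonneg hX.choose
  rw [abs_of_nonneg hJ] at hκ
  set β := min α (1 / 3) with hβ
  have hβ0 : 0 < β := lt_min hα (by norm_num)
  set L := (r / ξ') ^ β with hL
  have hx0 : 0 ≤ r / ξ' := by positivity
  set H := ∑ Z, h Z with hHdef
  have hH : H.IsHermitian := hh.isHermitian_sum _
  have hHn := norm_nonneg H
  have hs0 := one_le_superopBound hHn
  have hsl := superopBound_le hHn
  have hOs' := norm_le_of_norm_le_div_log_sq hHn hOs
  set ℓ := Real.log (‖H‖ + 2) with hℓ
  set s₀ := superopBound ‖H‖ with hs₀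
  have hcard : (1 : ℝ) ≤ X.card := by exact_mod_cast hX.card_pos
  have hAℓ : 0 ≤ A * ℓ ^ 2 := by positivity
  -- The target bound dominates both contributions of the error.
  have htarget : 64 * (1 + A * ℓ ^ 2) * Real.exp (-L) +
      2 * (κ * growthSum G D) * X.card * Real.exp (-L) ≤
      (64 + 2 * (κ * growthSum G D)) * (1 + A * ℓ ^ 2) * X.card * Real.exp (-L) := by
    have h1 : 64 * (1 + A * ℓ ^ 2) ≤ 64 * (1 + A * ℓ ^ 2) * X.card :=
      le_mul_of_one_le_right (by positivity) hcard
    have h2 : 2 * (κ * growthSum G D) * X.card ≤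
        2 * (κ * growthSum G D) * X.card * (1 + A * ℓ ^ 2) :=
      le_mul_of_one_le_right (by positivity) (by linarith)
    rw [← add_mul]
    refine mul_le_mul_of_nonneg_right ?_ (Real.exp_nonneg _)
    linarith
  have hrest : 0 ≤ 2 * (κ * growthSum G D) * X.card * Real.exp (-L) := by positivity
  -- If the target bound is not small, the identity is a good enough approximation.
  have htriv (hbig : 1 / 2 ≤ 64 * (1 + A * ℓ ^ 2) * Real.exp (-L)) :
      ∃ M' : Matrix (Λ → Fin q) (Λ → Fin q) ℂ, SupportedOn (nbhd X r) M' ∧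
        ‖krausOp H O - M'‖ ≤
          (64 + 2 * (κ * growthSum G D)) * (1 + A * ℓ ^ 2) * X.card * Real.exp (-L) := by
    refine ⟨1, one_mem (supportedSubalgebra (nbhd X r) q), ?_⟩
    have h1 : ‖krausOp H O - 1‖ ≤ 1 / 2 := norm_krausOp_sub_one_le hH hO
      (hOs'.trans (one_div_le_one_div_of_le (by positivity) (by nlinarith)))
    linarith
  rcases lt_or_ge (r / ξ') 1 with hr1 | hr1
  · refine htriv ?_
    have h1 : L ≤ 1 := Real.rpow_le_one hx0 hr1.le hβ0.le
    have h2 : 1 / 3 ≤ Real.exp (-L) := by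
      have h3 : Real.exp (-1) ≤ Real.exp (-L) := Real.exp_le_exp.2 (by linarith)
      have h4 : 1 / 3 ≤ Real.exp (-1) := by
        rw [Real.exp_neg, ← one_div]
        exact one_div_le_one_div_of_le (Real.exp_pos _) Real.exp_one_lt_three.le
      linarith
    nlinarith
  have hL1 : 1 ≤ L := Real.one_le_rpow hr1 hβ0.le
  have hL3 : L ^ 3 ≤ r / ξ' := by
    rw [hL, ← Real.rpow_natCast, ← Real.rpow_mul hx0]
    calc _ ≤ (r / ξ') ^ (1 : ℝ) := Real.rpow_le_rpow_of_exponent_le hr1 (by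
          have := min_le_right α (1 / 3)
          push_cast
          linarith)
      _ = _ := Real.rpow_one _
  have hdec : Real.exp (-(r / 2 / ξ) ^ α) ≤ Real.exp (-L) :=
    Real.exp_le_exp.2 (neg_le_neg (rpow_div_le_rpow_div hξ (le_max_left _ _)
      (min_le_left _ _) hα.le hr1))
  -- The precision is large enough for replacing `O` by an operator on `X^{+r/2}`.
  set ε := max (Real.exp (-L)) (16 * s₀ ^ 2 * (A * Real.exp (-(r / 2 / ξ) ^ α))) with hε
  have hεle : ε ≤ 64 * (1 + A * ℓ ^ 2) * Real.exp (-L) := by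
    refine max_le ?_ ?_
    · refine le_mul_of_one_le_left (Real.exp_nonneg _) ?_
      linarith
    · have h1 : s₀ ^ 2 ≤ (2 * ℓ) ^ 2 := by gcongr
      calc _ ≤ 16 * (2 * ℓ) ^ 2 * (A * Real.exp (-L)) := by gcongr
        _ = 64 * (A * ℓ ^ 2) * Real.exp (-L) := by ring
        _ ≤ _ := by gcongr; linarith
  rcases le_total (1 / 2) ε with hε2 | hε2
  · exact htriv (hε2.trans hεle)
  obtain ⟨O', hO's, hOO⟩ := hQ (r / 2) (by linarith)
  obtain ⟨B, hB, hKB⟩ := hh.exists_supportedOn_near_krausOp hG hX hO hr hε2 hL1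
    (le_max_left _ _) hκ (by
      calc _ ≤ ξ' * (r / ξ') := mul_le_mul (le_max_right _ _) hL3 (by positivity) hξ'0.le
        _ = r := mul_div_cancel₀ _ hξ'0.ne') hOs' hO's (by
      rw [le_div_iff₀ (by positivity)]
      refine le_trans ?_ (le_max_right _ _)
      rw [mul_comm]
      exact mul_le_mul_of_nonneg_left hOO (by positivity))
  exact ⟨B, hB, by linarith⟩

end QuasiLocality

end

end GibbsKraus

theorem mainTheorem3 :
    -- approximation error bound for perturbed superoperators
    (∀ (n : Type u) [Fintype n] [DecidableEq n] (H O O' : Matrix n n ℂ) (hH : H.IsHermitian)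
        (Sp Sm : Matrix n n ℂ →ₗ[ℂ] Matrix n n ℂ) (ε s : ℝ),
        O.IsHermitian → 0 < ε → ε ≤ 1 / 2 →
        (∀ b, GibbsKraus.SuperopNormLE (GibbsKraus.opSpm hH b) s) →
        GibbsKraus.SuperopNormLE Sp s → GibbsKraus.SuperopNormLE Sm s →
        ‖O‖ ≤ 1 / (16 * s ^ 2) → ‖O'‖ ≤ 1 / (16 * s ^ 2) → ‖O - O'‖ ≤ ε / (16 * s ^ 2) →
        GibbsKraus.SuperopNormLE (fun A => GibbsKraus.opSpm hH true A - Sp A) (ε * s) →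
        GibbsKraus.SuperopNormLE (fun A => GibbsKraus.opSpm hH false A - Sm A) (ε * s) →
        ‖1 - ∑ k ∈ Finset.Icc 1 (GibbsKraus.order ε), Sm (GibbsKraus.nabla Sp Sm O' k)
          - GibbsKraus.krausOp H O‖ ≤ ε) ∧
    -- the kernels: norms, supports and the approximate integral representation
    (∀ f : Bool → MeasureTheory.ComplexMeasure ℝ,
      ((∀ b, GibbsKraus.l1norm (f b) ≤ ENNReal.ofReal (1 / 2)) →
        ∀ k, 1 ≤ k → ∀ b, GibbsKraus.l1norm (GibbsKraus.kernel f k b)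
          ≤ ENNReal.ofReal (GibbsKraus.coeffA k)) ∧
      (∀ I : Set ℝ, I.OrdConnected → (∀ t ∈ I, -t ∈ I) → (∀ b, GibbsKraus.supp (f b) ⊆ I) →
        ∀ k, 1 ≤ k → ∀ b, GibbsKraus.supp (GibbsKraus.kernel f k b) ⊆
          Set.univ.pi fun _ => (fun t => (k : ℝ) * t) '' I) ∧
      (∀ (n : Type u) [Fintype n] [DecidableEq n] (H O O' : Matrix n n ℂ) (hH : H.IsHermitian)
        (ε s : ℝ),
        O.IsHermitian → 0 < ε → ε ≤ 1 / 2 →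
        1 + 1 / Real.pi * Real.log (1 + ‖H‖ / 2) ≤ s →
        (∀ b, GibbsKraus.SuperopNormLE (fun A => GibbsKraus.opSpm hH b A
          - s • GibbsKraus.heisAverage H (f b) A) (ε * s)) →
        ‖O‖ ≤ 1 / (16 * s ^ 2) → ‖O'‖ ≤ 1 / (16 * s ^ 2) → ‖O - O'‖ ≤ ε / (16 * s ^ 2) →
        ‖GibbsKraus.krausOp H O - 1 + (1 / s) • ∑ k ∈ Finset.Icc 1 (GibbsKraus.order ε),
          GibbsKraus.heisIntegral H (GibbsKraus.kernel f k false) (s ^ 2 • O')‖ ≤ ε)) ∧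
    -- explicit short-time kernels, finite linear combinations, and quasi-locality
    (∃ c : ℝ, 0 < c ∧
      (∀ (n : Type u) [Fintype n] [DecidableEq n] (H O : Matrix n n ℂ) (ε : ℝ),
        H.IsHermitian → O.IsHermitian → ‖O‖ ≤ c / Real.log (‖H‖ + 2) ^ 2 → 0 < ε → ε ≤ 1 / 2 →
        (∀ k, 1 ≤ k → ∀ b,
          GibbsKraus.l1norm (GibbsKraus.kernel (GibbsKraus.seed ‖H‖ ε) k b)
            ≤ ENNReal.ofReal (GibbsKraus.coeffA k) ∧
          GibbsKraus.supp (GibbsKraus.kernel (GibbsKraus.seed ‖H‖ ε) k b) ⊆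
            Set.univ.pi fun _ => Set.Icc (-(k * GibbsKraus.cutoff ε)) (k * GibbsKraus.cutoff ε)) ∧
        ‖GibbsKraus.krausOp H O - 1 + (1 / GibbsKraus.normS ‖H‖ ε) •
          ∑ k ∈ Finset.Icc 1 (GibbsKraus.order ε),
            GibbsKraus.heisIntegral H (GibbsKraus.kernel (GibbsKraus.seed ‖H‖ ε) k false)
              (GibbsKraus.normS ‖H‖ ε ^ 2 • O)‖ ≤ ε ∧
        ∃ (N : ℕ) (w : Fin N → ℂ) (k : Fin N → ℕ) (t : (j : Fin N) → Fin (k j) → ℝ),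
          ∑ j, ‖w j‖ ≤ 2 ∧ (∀ j, k j ≤ GibbsKraus.order ε) ∧
          (∀ j i, |t j i| ≤ k j * GibbsKraus.cutoff ε) ∧
          ‖GibbsKraus.krausOp H O - ∑ j, w j • (List.ofFn fun i =>
            GibbsKraus.heis H (t j i) (GibbsKraus.normS ‖H‖ ε ^ 2 • O)).prod‖ ≤ ε) ∧
      (∀ (G J ξ α : ℝ) (D : ℕ), 0 < ξ → 0 < α → ∃ C ξ' : ℝ, 0 < C ∧ 0 < ξ' ∧
        ∀ (Λ : Type u) [Fintype Λ] [DecidableEq Λ] [MetricSpace Λ] (q : ℕ)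
          (h : Finset Λ → Matrix (Λ → Fin q) (Λ → Fin q) ℂ)
          (O : Matrix (Λ → Fin q) (Λ → Fin q) ℂ) (X : Finset Λ) (A : ℝ),
          GibbsKraus.PolyGrowth Λ G D → GibbsKraus.GeomLocal J h → O.IsHermitian →
          ‖O‖ ≤ c / Real.log (‖∑ Z, h Z‖ + 2) ^ 2 → X.Nonempty → 0 ≤ A →
          GibbsKraus.QuasiLocal X (fun r => A * Real.exp (-(r / ξ) ^ α)) O →
          GibbsKraus.QuasiLocal X
            (fun r => C * (1 + A * Real.log (‖∑ Z, h Z‖ + 2) ^ 2) * X.card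
              * Real.exp (-(r / ξ') ^ min α (1 / 3)))
            (GibbsKraus.krausOp (∑ Z, h Z) O))) := by
  -- `s = superopBound ‖H‖ ≤ 2 ln (‖H‖ + 2)`, so the constant `1 / 128` puts `‖O‖` a factor two
  -- below the threshold `1 / (16 s²)`; quasi-locality uses this room to replace `O` by an
  -- approximation.
  refine ⟨?_, ?_, 1 / 128, by norm_num, ?_, fun G J ξ α D hξ hα =>
    GibbsKraus.quasiLocal_krausOp G J ξ α D hξ hα⟩
  · intro n _ _ H O O' hH Sp Sm ε s hO hε hε2 hS _ _ hOs hOs' hOO hp hm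
    rcases isEmpty_or_nonempty n with hn | hn
    · rw [Subsingleton.elim (1 - _ - GibbsKraus.krausOp H O) 0, norm_zero]
      exact hε.le
    · refine (GibbsKraus.norm_truncation_sub_krausOp_le hH hO hε hε2
        (GibbsKraus.one_half_le_of_superopNormLE hH (hS true)) hS hOs hOs' hOO hp hm).trans ?_
      linarith
  · intro f
    refine ⟨fun hf k hk b => ?_, fun I hI hs hf k hk b => ?_,
      fun n _ _ H O O' hH ε s hO hε hε2 hs hf hOs hOs' hOO => ?_⟩
    · obtain ⟨k, rfl⟩ := Nat.exists_eq_add_of_le' hk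
      exact GibbsKraus.l1norm_kernel_le hf k b
    · obtain ⟨k, rfl⟩ := Nat.exists_eq_add_of_le' hk
      exact GibbsKraus.supp_kernel_subset hI hs hf k b
    · have h1 : s ≠ 0 := by
        have := GibbsKraus.one_le_superopBound (norm_nonneg H)
        rw [GibbsKraus.superopBound] at this
        linarith
      refine (GibbsKraus.norm_krausOp_sub_one_add_sum_heisIntegral_le hH hO f hε hε2 hs h1 hf
        hOs hOs' hOO).trans ?_
      linarith
  · intro n _ _ H O ε hH hO hOn hε hε2
    have hh := norm_nonneg H
    have h0 := GibbsKraus.one_le_superopBound hh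
    have h1 : ‖O‖ ≤ 1 / (16 * GibbsKraus.superopBound ‖H‖ ^ 2) :=
      (GibbsKraus.norm_le_of_norm_le_div_log_sq hh hOn).trans
        (one_div_le_one_div_of_le (by positivity) (by nlinarith))
    have h2 : ‖O - O‖ ≤ ε / (16 * GibbsKraus.superopBound ‖H‖ ^ 2) := by
      rw [sub_self, norm_zero]
      positivity
    refine ⟨fun k hk b => ?_, ?_, ?_⟩
    · obtain ⟨k, rfl⟩ := Nat.exists_eq_add_of_le' hk
      exact ⟨GibbsKraus.l1norm_kernel_le (GibbsKraus.l1norm_seed_le hh hε) k b,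
        GibbsKraus.supp_kernel_subset_of_supp_subset_Icc
          (GibbsKraus.supp_seed_subset hh hε hε2) k b⟩
    · refine (GibbsKraus.norm_krausOp_sub_one_add_sum_seed_le hH hO hε hε2 h1 h1 h2).trans ?_
      linarith
    · obtain ⟨B, hB, hB'⟩ :=
        GibbsKraus.exists_isCombination_near_krausOp hH hO hε hε2 h1 h1 h2
      obtain ⟨N, w, k, t, h3, h4, h5, rfl⟩ := hB.exists_fin
      exact ⟨N, w, k, t, h3, h4, h5, hB'⟩
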